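/- Let $\mathcal X,\mathcal Y,\mathcal S$ be finite sets, let $P_{Y,S^+|X,S}$ be a finite-state channel (given input $x$ and state $s$, it produces an output and a next state with law $P_{Y,S^+|X,S}(\cdot,\cdot|x,s)$), and let $P(s_0)$ be the law of the initial state. Assume that the channel is strongly connected: for every $s\in\mathcal S$ there are an integer $T(s)$ and an input distribution of the form $\{P(x_i|s_{i-1})\}_{i=1}^{T(s)}$ such that $\sum_{i=1}^{T(s)}P(S_i=s|S_0=s')>0$ for all $s'\in\mathcal S$. A code of length $n$ for a message $M$ uniformly distributed on $\mathcal M=\{1,\dots,\lceil 2^{nR}\rceil\}$ consists of encoding maps $x_i=f_i(m,s_0^{i-1},y^{i-1})$, $i=1,\dots,n$, and a decoding map $\hat m:\mathcal Y^n\to\mathcal M$. The rate $R$ is achievable if there is a sequence of such codes, one for each $n$, whose average probability of error $\Pr(\hat m(Y^n)\ne M)$ tends to $0$ as $n\to\infty$. The feedback capacity with state information known causally at the encoder, $C_{\text{fb-csi}}$, is the supremum of all achievable rates. Then $C_{\text{fb-csi}}$ is finite and $$C_{\text{fb-csi}}=\lim_{N\to\infty}\frac1N\max\ \sum_{i=1}^N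 I(U_i,U_{i-1};Y_i|Y^{i-1}),$$ where, for each $N$, the maximum is over all finite or countably infinite alphabets $\mathcal U$ (their cardinality is not bounded), all functions $f:\mathcal U\times\mathcal S\to\mathcal X$ and all input laws $\{P(u_i|u_{i-1},y^{i-1})\}_{i=1}^N$ on $\mathcal U$ (with $u_0$ and $y^0$ empty), and the information, in bits, is computed under the joint distribution $$P(x^N,s_0^N,y^N,u^N)=P(s_0)\prod_{i=1}^N P(u_i|u_{i-1},y^{i-1})\,\mathbf 1\{x_i=f(u_i,s_{i-1})\}\,P_{Y,S^+|X,S}(y_i,s_i|x_i,s_{i-1}).$$ In particular, for each $N$ the maximum is attained, and the limit exists. -/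

import Mathlib

open Filter Topology
open scoped ENNReal

noncomputable section

namespace FiniteState

/-- A finite-state channel: the time-invariant law `P(y, s⁺ | x, s)` and the law `P(s₀)` of the
initial state. (Finiteness of the three alphabets is assumed where the structure is used.) -/
structure Channel (X Y S : Type*) where
  /-- `trans x s` is the law of (output, next state) given input `x` and current state `s`. -/
  trans : X → S → PMF (Y × S)
  /-- the law of the initial state -/
  init : PMF S

variable {X Y S : Type*}

/-- The law of `S_i` given `S_0 = s'`, when the input at time `i + 1` is drawn from
`P i s_i`, i.e. from a distribution that depends on the current state only. -/
def Channel.stateLaw (ch : Channel X Y S) (P : ℕ → S → PMF X) (s' : S) : ℕ → PMF S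
  | 0 => PMF.pure s'
  | i + 1 => (ch.stateLaw P s' i).bind fun s =>
      (P i s).bind fun x => (ch.trans x s).map Prod.snd

/-- Strong connectivity: every state `s` has a horizon `T` and a state-dependent input distribution
under which `s` is reached with positive probability, at some time in `1, …, T`, from every
state `s'`. -/
def Channel.StronglyConnected (ch : Channel X Y S) : Prop :=
  ∀ s : S, ∃ (T : ℕ) (P : ℕ → S → PMF X), ∀ s' : S,
    0 < ∑ i ∈ Finset.Icc 1 T, ch.stateLaw P s' i s

/-! ### Sequences

Sequences indexed from `1` in mathematical notation are functions on `Fin n`: entry `i : Fin n`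
is the symbol at time `i + 1`. State sequences `s₀, …, sₙ` are functions on `Fin (n + 1)`, so the
state just before time `i + 1` is `s i.castSucc` and the one just after it is `s i.succ`. -/

/-- The first `i` entries of a sequence. -/
def past {α : Type*} {n : ℕ} (z : Fin n → α) (i : Fin n) : Fin (i : ℕ) → α :=
  fun j => z ⟨j, j.isLt.trans i.isLt⟩

/-- The first `i + 1` entries of a sequence of length `n + 1`: the states `s₀, …, s_i`. -/
def statesUpTo {α : Type*} {n : ℕ} (s : Fin (n + 1) → α) (i : Fin n) : Fin ((i : ℕ) + 1) → α :=
  fun j => s ⟨j, by omega⟩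

/-- The entry before entry `i`, and `none` if there is none (the empty symbol `u₀`). -/
def prev {α : Type*} {n : ℕ} (u : Fin n → α) (i : Fin n) : Option α :=
  if h : (i : ℕ) = 0 then none else some (u ⟨(i : ℕ) - 1, by omega⟩)

/-! ### Codes and capacity -/

/-- A block code of length `n` with `k` messages. At time `i + 1` the encoder sees the message, the
states `s₀, …, s_i` and the outputs `y₁, …, y_i`; the decoder sees only `y₁, …, yₙ`. -/
structure Code (X Y S : Type*) (n k : ℕ) where
  enc : (i : Fin n) → Fin k → (Fin ((i : ℕ) + 1) → S) → (Fin (i : ℕ) → Y) → X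
  dec : (Fin n → Y) → Fin k

open Classical in
/-- The probability of `(s₀ⁿ, xⁿ, yⁿ)` given that message `m` is sent. -/
def Code.jointProb (ch : Channel X Y S) {n k : ℕ} (c : Code X Y S n k) (m : Fin k)
    (ω : (Fin (n + 1) → S) × (Fin n → X) × (Fin n → Y)) : ℝ≥0∞ :=
  ch.init (ω.1 0) * ∏ i : Fin n,
    ((if ω.2.1 i = c.enc i m (statesUpTo ω.1 i) (past ω.2.2 i) then 1 else 0) *
      ch.trans (ω.2.1 i) (ω.1 i.castSucc) (ω.2.2 i, ω.1 i.succ))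

open Classical in
/-- The average probability of error, for a uniformly distributed message. -/
def Code.errorProb (ch : Channel X Y S) {n k : ℕ} (c : Code X Y S n k) : ℝ≥0∞ :=
  (k : ℝ≥0∞)⁻¹ * ∑ m : Fin k, ∑' ω : (Fin (n + 1) → S) × (Fin n → X) × (Fin n → Y),
    if c.dec ω.2.2 ≠ m then c.jointProb ch m ω else 0

/-- `R` is achievable if some codes of length `n` with `⌈2^(nR)⌉` messages have average error
probability tending to `0`. -/
def Channel.Achievable (ch : Channel X Y S) (R : ℝ) : Prop :=
  ∃ c : (n : ℕ) → Code X Y S n ⌈(2 : ℝ) ^ ((n : ℝ) * R)⌉₊,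
    Tendsto (fun n => (c n).errorProb ch) atTop (𝓝 0)

/-- The feedback capacity with state information known causally at the encoder. -/
def Channel.feedbackCapacity (ch : Channel X Y S) : ℝ :=
  sSup {R : ℝ | ch.Achievable R}

/-! ### Conditional mutual information of discrete random variables -/

open Classical in
/-- The probability mass function of the random variable `Z`, if outcomes have mass `p`. -/
def marginal {Ω α : Type*} (p : Ω → ℝ≥0∞) (Z : Ω → α) (z : α) : ℝ≥0∞ :=
  ∑' ω, if Z ω = z then p ω else 0

/-- `I(A; B | C)` in bits: `∑ P(a,b,c) log₂ (P(a,b,c) P(c) / (P(a,c) P(b,c)))`.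
Terms with `P(a,b,c) = 0` vanish. The sum converges absolutely if `p` has total mass one and `B`
and `C` take finitely many values, even if `A` takes countably many. -/
def condMutualInfo {Ω α β γ : Type*} (p : Ω → ℝ≥0∞) (A : Ω → α) (B : Ω → β) (C : Ω → γ) : ℝ :=
  ∑' t : α × β × γ,
    (marginal p (fun ω => (A ω, B ω, C ω)) t).toReal *
      Real.logb 2
        ((marginal p (fun ω => (A ω, B ω, C ω)) t).toReal * (marginal p C t.2.2).toReal /
          ((marginal p (fun ω => (A ω, C ω)) (t.1, t.2.2)).toReal *
            (marginal p (fun ω => (B ω, C ω)) t.2).toReal))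

/-! ### First-order auxiliary processes -/

/-- A first-order input law `P(u_i | u_{i-1}, y^{i-1})`, `i = 1, …, N`, on the alphabet `U`. -/
abbrev InputLaw (U Y : Type*) (N : ℕ) : Type _ :=
  (i : Fin N) → Option U → (Fin (i : ℕ) → Y) → PMF U

/-- Outcomes `(s₀ᴺ, xᴺ, yᴺ, uᴺ)`. -/
abbrev Outcome (U X Y S : Type*) (N : ℕ) : Type _ :=
  (Fin (N + 1) → S) × (Fin N → X) × (Fin N → Y) × (Fin N → U)

open Classical in
/-- The joint law
`P(s₀) ∏ P(u_i | u_{i-1}, y^{i-1}) 1{x_i = f(u_i, s_{i-1})} P(y_i, s_i | x_i, s_{i-1})`. -/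
def jointProb (ch : Channel X Y S) {U : Type*} {N : ℕ} (f : U → S → X) (K : InputLaw U Y N)
    (ω : Outcome U X Y S N) : ℝ≥0∞ :=
  let s := ω.1
  let x := ω.2.1
  let y := ω.2.2.1
  let u := ω.2.2.2
  ch.init (s 0) * ∏ i : Fin N,
    (K i (prev u i) (past y i) (u i) *
      (if x i = f (u i) (s i.castSucc) then 1 else 0) *
      ch.trans (x i) (s i.castSucc) (y i, s i.succ))

/-- The objective `∑ I(U_i, U_{i-1}; Y_i | Y^{i-1})`, `i = 1, …, N`. -/
def objective (ch : Channel X Y S) {U : Type*} {N : ℕ} (f : U → S → X) (K : InputLaw U Y N) : ℝ :=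
  ∑ i : Fin N,
    condMutualInfo (jointProb ch f K)
      (fun ω => (ω.2.2.2 i, prev ω.2.2.2 i))
      (fun ω => ω.2.2.1 i)
      (fun ω => past ω.2.2.1 i)

/-- All values of the objective at horizon `N`: over all countable (in particular, all finite)
auxiliary alphabets `U`, all functions `f : U × S → X` and all first-order input laws. -/
def objectiveValues (ch : Channel X Y S) (N : ℕ) : Set ℝ :=
  {r | ∃ (U : Type) (_ : Countable U) (f : U → S → X) (K : InputLaw U Y N),
    r = objective ch f K}

end FiniteState

end

/-!
The maximum `M N` of the objective is the largest mutual information `I(T; Yᴺ)` between a random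
decision tree `T` and the outputs it produces. A decision tree (`Tree`) prescribes, for each time
and each sequence of earlier outputs, a function from the current state to the input.

*The objective and random trees.* An input law is realized by a random tree that is drawn before
the transmission (`exists_random_tree`). Then `(U_i, U_{i-1})` is a function of the source of
randomness and of `Y^{i-1}`, so the data-processing inequality and the chain rule bound the
objective by `I(T; Yᴺ)` (`objective_le_treeInfo`). Conversely, a process whose symbol `U_i` stores
the whole tree, besides the function that is currently used, is a first-order process on a finite
alphabet, and loses nothing (`exists_treeInfo_le_objective`). There are finitely many trees, and
mutual information is continuous on the simplex of their distributions, so the maximum is attained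
(`exists_isGreatest_objectiveValues`).

*Converse.* Against a fixed decoder, an encoder that remembers all states may be replaced by a
decision tree: choosing the inputs is a Markov decision problem in which the current state and the
past outputs are a sufficient statistic (`exists_tree_le`). Fano's inequality (`fano_le_treeInfo`)
then gives `R ≤ liminf M N / N` for every achievable rate (`tendsto_of_achievable`).

*Achievability.* Fix `N` and an optimal distribution of trees. By convexity of mutual information
in the channel there is an initial state `s₁` from which the optimal distribution gives at least
`M N` (`exists_treeInfo_le_startAt`). Strong connectivity lets the encoder, who sees the state,
drive it to `s₁` within `D` steps up to a small probability, where `D` does not depend on `N`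
(`exists_missProb_le`). A block of length `N + D` drives the state to `s₁` and then follows a random
tree. The decoder does not know when `s₁` was reached, so it averages the likelihood ratio over the
possible delays, which costs `log (2 (D + 1))` bits per block (`le_expect_log_score`). The scores
of the blocks multiply, whatever the state at the start of each block is, and exponential moments
(`exists_exponent`, `exists_block_ensemble`) replace a law of large numbers in random coding with
threshold decoding (`exists_code_errorProb_le`). Hence the capacity `C` satisfies
`(N + D) C ≥ (1 - ε) M N - log (2 (D + 1)) - 1` (`achievable_of_lt_treeInfo`), that is,
`limsup M N / N ≤ C / (1 - ε)`. Together with the converse, `M N / N` converges to `C`.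
-/

noncomputable section

namespace FiniteState

/-! ### The log-sum inequality -/

/-- The log-sum inequality `A log (A / B) ≤ ∑ xᵢ log (xᵢ / zᵢ)`, with the convention
`0 log (0 / z) = 0`, which the default value of `logb` at zero provides. -/
theorem log_sum_inequality {ι : Type*} (s : Finset ι) (x z : ι → ℝ) (hx : ∀ i ∈ s, 0 ≤ x i)
    (hz : ∀ i ∈ s, 0 ≤ z i) (h0 : ∀ i ∈ s, z i = 0 → x i = 0) :
    (∑ i ∈ s, x i) * Real.logb 2 ((∑ i ∈ s, x i) / ∑ i ∈ s, z i) ≤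
      ∑ i ∈ s, x i * Real.logb 2 (x i / z i) := by
  set A := ∑ i ∈ s, x i with hA
  set B := ∑ i ∈ s, z i with hB
  have hA0 : 0 ≤ A := Finset.sum_nonneg hx
  have hB0 : 0 ≤ B := Finset.sum_nonneg hz
  have hlog2 : 0 < Real.log 2 := Real.log_pos (by norm_num)
  rcases hA0.eq_or_lt with h | hApos
  · have hxi : ∀ i ∈ s, x i = 0 := (Finset.sum_eq_zero_iff_of_nonneg hx).1 h.symm
    rw [Finset.sum_congr rfl (fun i hi => by rw [hxi i hi, zero_mul]), ← h]
    simp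
  · have hBpos : 0 < B := by
      rcases hB0.eq_or_lt with h | h
      · have hzi := (Finset.sum_eq_zero_iff_of_nonneg hz).1 h.symm
        have : A = 0 := Finset.sum_eq_zero fun i hi => h0 i hi (hzi i hi)
        exact absurd this hApos.ne'
      · exact h
    -- `log t ≤ t - 1` at `t = zᵢ (A / B) / xᵢ`; the linear terms cancel in the sum over `i`
    have key : ∀ i ∈ s, x i * Real.logb 2 (A / B) + (x i - z i * (A / B)) / Real.log 2 ≤
        x i * Real.logb 2 (x i / z i) := by
      intro i hi
      rcases (hx i hi).eq_or_lt with h | hxp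
      · rw [← h]
        have : 0 ≤ z i * (A / B) := mul_nonneg (hz i hi) (by positivity)
        simp only [zero_mul, zero_sub, zero_add]
        exact div_nonpos_of_nonpos_of_nonneg (by linarith) hlog2.le
      · have hzp : 0 < z i := lt_of_le_of_ne (hz i hi) fun h => hxp.ne' (h0 i hi h.symm)
        have h1 := Real.log_le_sub_one_of_pos (x := z i * (A / B) / x i) (by positivity)
        have h2 : Real.log (z i * (A / B) / x i) = Real.log (A / B) - Real.log (x i / z i) := by
          rw [← Real.log_div (by positivity) (by positivity)]
          congr 1
          field_simp
        rw [h2] at h1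
        have h3 : x i * (Real.log (A / B) - Real.log (x i / z i)) ≤ z i * (A / B) - x i := by
          have := mul_le_mul_of_nonneg_left h1 hxp.le
          have h4 : x i * (z i * (A / B) / x i - 1) = z i * (A / B) - x i := by field_simp
          linarith
        simp only [Real.logb]
        have h6 : x i * (Real.log (A / B) / Real.log 2) + (x i - z i * (A / B)) / Real.log 2 =
            (x i * Real.log (A / B) + (x i - z i * (A / B))) / Real.log 2 := by ring
        rw [h6, ← mul_div_assoc (x i)]
        exact (div_le_div_iff_of_pos_right hlog2).2 (by linarith)
    have := Finset.sum_le_sum key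
    rw [Finset.sum_add_distrib, ← Finset.sum_mul, ← Finset.sum_div, Finset.sum_sub_distrib,
      ← Finset.sum_mul, ← hA, ← hB] at this
    have h5 : B * (A / B) = A := by field_simp
    rw [h5] at this
    simpa using this

/-! ### Marginals -/

section Marginal

variable {Ω α β γ : Type*}

open Classical in
theorem marginal_eq_tsum_fiber (p : Ω → ℝ≥0∞) (Z : Ω → α) (z : α) :
    marginal p Z z = ∑' ω : Z ⁻¹' {z}, p ω := by
  rw [tsum_subtype (Z ⁻¹' {z}) p]
  refine tsum_congr fun ω => ?_
  simp [Set.indicator]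

theorem tsum_marginal (p : Ω → ℝ≥0∞) (Z : Ω → α) : ∑' z, marginal p Z z = ∑' ω, p ω := by
  classical
  unfold marginal
  rw [ENNReal.tsum_comm]
  refine tsum_congr fun ω => ?_
  rw [tsum_eq_single (Z ω) (fun z hz => by simp [hz.symm])]
  simp

theorem tsum_marginal_mul (p : Ω → ℝ≥0∞) (Z : Ω → α) (F : α → ℝ≥0∞) :
    ∑' z, marginal p Z z * F z = ∑' ω, p ω * F (Z ω) := by
  classical
  unfold marginal
  simp_rw [← ENNReal.tsum_mul_right]
  rw [ENNReal.tsum_comm]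
  refine tsum_congr fun ω => ?_
  rw [tsum_eq_single (Z ω) (fun z hz => by simp [hz.symm])]
  simp

theorem marginal_comp (p : Ω → ℝ≥0∞) (π : Ω → β) (Z : β → α) (z : α) :
    marginal p (fun ω => Z (π ω)) z = marginal (marginal p π) Z z := by
  classical
  have := tsum_marginal_mul p π (fun b => if Z b = z then 1 else 0)
  simpa [marginal] using this.symm

theorem marginal_le_comp (p : Ω → ℝ≥0∞) (Z : Ω → α) (g : α → β) (z : α) :
    marginal p Z z ≤ marginal p (fun ω => g (Z ω)) (g z) := by
  classical
  unfold marginal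
  refine ENNReal.tsum_le_tsum fun ω => ?_
  split_ifs with h1 h2
  · exact le_rfl
  · exact absurd (congrArg g h1) h2
  · exact zero_le
  · exact le_rfl

theorem marginal_le_tsum (p : Ω → ℝ≥0∞) (Z : Ω → α) (z : α) : marginal p Z z ≤ ∑' ω, p ω := by
  rw [← tsum_marginal p Z]
  exact ENNReal.le_tsum z

theorem marginal_ne_top {p : Ω → ℝ≥0∞} (hp : ∑' ω, p ω ≠ ⊤) (Z : Ω → α) (z : α) :
    marginal p Z z ≠ ⊤ :=
  ne_top_of_le_ne_top hp (marginal_le_tsum p Z z)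

theorem marginal_toReal_le_comp {p : Ω → ℝ≥0∞} (hp : ∑' ω, p ω ≠ ⊤) (Z : Ω → α) (g : α → β)
    (z : α) : (marginal p Z z).toReal ≤ (marginal p (fun ω => g (Z ω)) (g z)).toReal :=
  ENNReal.toReal_mono (marginal_ne_top hp _ _) (marginal_le_comp p Z g z)

theorem tsum_marginal_prodMk (p : Ω → ℝ≥0∞) (A : Ω → α) (B : Ω → β) (b : β) :
    ∑' a, marginal p (fun ω => (A ω, B ω)) (a, b) = marginal p B b := by
  classical
  unfold marginal
  rw [ENNReal.tsum_comm]
  refine tsum_congr fun ω => ?_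
  rw [tsum_eq_single (A ω) (fun z hz => by simp [hz.symm])]
  simp

/-- The expectation of a bounded function of `Z`, computed from the law of `Z`. -/
theorem hasSum_marginal {p : Ω → ℝ≥0∞} (hp : ∑' ω, p ω ≠ ⊤) (Z : Ω → α) (F : α → ℝ) (H : ℝ)
    (hF : ∀ z, |F z| ≤ H) :
    HasSum (fun z => (marginal p Z z).toReal * F z) (∑' ω, (p ω).toReal * F (Z ω)) := by
  have hs : Summable fun ω => (p ω).toReal * F (Z ω) := by
    refine Summable.of_norm_bounded ((ENNReal.summable_toReal hp).mul_right H) fun ω => ?_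
    rw [norm_mul, Real.norm_of_nonneg ENNReal.toReal_nonneg]
    exact mul_le_mul_of_nonneg_left (hF _) ENNReal.toReal_nonneg
  have h := hs.hasSum.tsum_fiberwise Z
  have e : (fun z => (marginal p Z z).toReal * F z) =
      fun z => ∑' b : Z ⁻¹' {z}, (p b).toReal * F (Z b) := by
    funext z
    have h1 : ∀ b : Z ⁻¹' {z}, (p b).toReal * F (Z b) = (p b).toReal * F z := fun b => by
      rw [show Z b = z from b.2]
    rw [tsum_congr h1, tsum_mul_right, marginal_eq_tsum_fiber, ENNReal.tsum_toReal_eq]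
    intro b
    exact ne_top_of_le_ne_top hp (ENNReal.le_tsum (b : Ω))
  rw [e]
  exact h

theorem sum_marginal_toReal_mul [Fintype Ω] [Fintype α] {p : Ω → ℝ≥0∞} (hp : ∀ ω, p ω ≠ ⊤)
    (Z : Ω → α) (F : α → ℝ) :
    ∑ z, (marginal p Z z).toReal * F z = ∑ ω, (p ω).toReal * F (Z ω) := by
  have hp' : ∑' ω, p ω ≠ ⊤ := by
    rw [tsum_fintype]
    exact ENNReal.sum_ne_top.2 fun ω _ => hp ω
  have := (hasSum_marginal hp' Z F (∑ z, |F z|) fun z =>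
    Finset.single_le_sum (f := fun z => |F z|) (fun _ _ => abs_nonneg _)
      (Finset.mem_univ z)).tsum_eq
  rwa [tsum_fintype, tsum_fintype] at this

end Marginal

/-! ### Conditional mutual information -/

section Info

variable {Ω Ω' α α' β γ : Type*}

/-- Conditional mutual information depends on the joint law of the variables only. -/
theorem condMutualInfo_comp (p : Ω → ℝ≥0∞) (π : Ω → Ω') (A : Ω' → α) (B : Ω' → β) (C : Ω' → γ) :
    condMutualInfo p (fun ω => A (π ω)) (fun ω => B (π ω)) (fun ω => C (π ω)) =
      condMutualInfo (marginal p π) A B C := by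
  unfold condMutualInfo
  have h1 := marginal_comp p π (fun ω => (A ω, B ω, C ω))
  have h2 := marginal_comp p π C
  have h3 := marginal_comp p π (fun ω => (A ω, C ω))
  have h4 := marginal_comp p π (fun ω => (B ω, C ω))
  simp only [h1, h2, h3, h4]

/-- Data processing in pointwise form: the log-sum inequality over the values of `A'`. The
hypothesis `hM` is the Markov property of `A — (A', C) — B`, with denominators cleared. -/
theorem condMutualInfo_term_le [Fintype α'] {p : Ω → ℝ≥0∞} (hp : ∑' ω, p ω ≠ ⊤) (A : Ω → α)
    (A' : Ω → α') (B : Ω → β) (C : Ω → γ)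
    (hM : ∀ a a' b c,
      marginal p (fun ω => (A' ω, A ω, B ω, C ω)) (a', a, b, c) *
          marginal p (fun ω => (A' ω, C ω)) (a', c) =
        marginal p (fun ω => (A' ω, A ω, C ω)) (a', a, c) *
          marginal p (fun ω => (A' ω, B ω, C ω)) (a', b, c)) (a : α) (b : β) (c : γ) :
    (marginal p (fun ω => (A ω, B ω, C ω)) (a, b, c)).toReal *
      Real.logb 2
        ((marginal p (fun ω => (A ω, B ω, C ω)) (a, b, c)).toReal * (marginal p C c).toReal /
          ((marginal p (fun ω => (A ω, C ω)) (a, c)).toReal *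
            (marginal p (fun ω => (B ω, C ω)) (b, c)).toReal)) ≤
    ∑ a', (marginal p (fun ω => (A' ω, A ω, B ω, C ω)) (a', a, b, c)).toReal *
      Real.logb 2
        ((marginal p (fun ω => (A' ω, B ω, C ω)) (a', b, c)).toReal * (marginal p C c).toReal /
          ((marginal p (fun ω => (A' ω, C ω)) (a', c)).toReal *
            (marginal p (fun ω => (B ω, C ω)) (b, c)).toReal)) := by
  have hx : ∑ a', (marginal p (fun ω => (A' ω, A ω, B ω, C ω)) (a', a, b, c)).toReal =
      (marginal p (fun ω => (A ω, B ω, C ω)) (a, b, c)).toReal := by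
    rw [← ENNReal.toReal_sum fun _ _ => marginal_ne_top hp _ _,
      ← tsum_marginal_prodMk p A' (fun ω => (A ω, B ω, C ω)), tsum_fintype]
  have hy : ∑ a', (marginal p (fun ω => (A' ω, A ω, C ω)) (a', a, c)).toReal =
      (marginal p (fun ω => (A ω, C ω)) (a, c)).toReal := by
    rw [← ENNReal.toReal_sum fun _ _ => marginal_ne_top hp _ _,
      ← tsum_marginal_prodMk p A' (fun ω => (A ω, C ω)), tsum_fintype]
  have hle1 : ∀ a', (marginal p (fun ω => (A' ω, A ω, B ω, C ω)) (a', a, b, c)).toReal ≤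
      (marginal p (fun ω => (A' ω, A ω, C ω)) (a', a, c)).toReal := fun a' =>
    marginal_toReal_le_comp hp (fun ω => (A' ω, A ω, B ω, C ω)) (fun t => (t.1, t.2.1, t.2.2.2))
      (a', a, b, c)
  have hle2 : ∀ a', (marginal p (fun ω => (A' ω, A ω, B ω, C ω)) (a', a, b, c)).toReal ≤
      (marginal p (fun ω => (B ω, C ω)) (b, c)).toReal := fun a' =>
    marginal_toReal_le_comp hp (fun ω => (A' ω, A ω, B ω, C ω)) (fun t => t.2.2)
      (a', a, b, c)
  have hle3 : ∀ a', (marginal p (fun ω => (A' ω, A ω, B ω, C ω)) (a', a, b, c)).toReal ≤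
      (marginal p C c).toReal := fun a' =>
    marginal_toReal_le_comp hp (fun ω => (A' ω, A ω, B ω, C ω)) (fun t => t.2.2.2)
      (a', a, b, c)
  have hle4 : ∀ a', (marginal p (fun ω => (A' ω, A ω, B ω, C ω)) (a', a, b, c)).toReal ≤
      (marginal p (fun ω => (A' ω, C ω)) (a', c)).toReal := fun a' =>
    marginal_toReal_le_comp hp (fun ω => (A' ω, A ω, B ω, C ω)) (fun t => (t.1, t.2.2.2))
      (a', a, b, c)
  -- compare `P(a', a, b, c)` with `P(a', a, c) P(b | c)`
  have key := log_sum_inequality Finset.univ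
    (fun a' => (marginal p (fun ω => (A' ω, A ω, B ω, C ω)) (a', a, b, c)).toReal)
    (fun a' => (marginal p (fun ω => (A' ω, A ω, C ω)) (a', a, c)).toReal *
      ((marginal p (fun ω => (B ω, C ω)) (b, c)).toReal / (marginal p C c).toReal))
    (fun _ _ => ENNReal.toReal_nonneg)
    (fun _ _ => mul_nonneg ENNReal.toReal_nonneg
      (div_nonneg ENNReal.toReal_nonneg ENNReal.toReal_nonneg))
    (fun a' _ h => by
      refine le_antisymm ?_ ENNReal.toReal_nonneg
      rcases mul_eq_zero.1 h with h | h
      · exact (hle1 a').trans h.le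
      · rcases div_eq_zero_iff.1 h with h | h
        · exact (hle2 a').trans h.le
        · exact (hle3 a').trans h.le)
  rw [← Finset.sum_mul, hx, hy] at key
  rw [← mul_div_assoc, div_div_eq_mul_div] at key
  refine key.trans (Finset.sum_le_sum fun a' _ => ?_)
  rcases (ENNReal.toReal_nonneg
    (a := marginal p (fun ω => (A' ω, A ω, B ω, C ω)) (a', a, b, c))).eq_or_lt with h | h
  · rw [← h, zero_mul, zero_mul]
  · refine le_of_eq ?_
    congr 2
    have h1 := h.trans_le (hle1 a')
    have h2 := h.trans_le (hle2 a')
    have h3 := h.trans_le (hle3 a')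
    have h4 := h.trans_le (hle4 a')
    have hM' := congrArg ENNReal.toReal (hM a a' b c)
    rw [ENNReal.toReal_mul, ENNReal.toReal_mul] at hM'
    rw [← mul_div_assoc, div_div_eq_mul_div, div_eq_div_iff (by positivity) (by positivity)]
    linear_combination (marginal p C c).toReal *
      (marginal p (fun ω => (B ω, C ω)) (b, c)).toReal * hM'

theorem condMutualInfo_nonneg [Fintype α'] [Fintype β] [Fintype γ] {p : Ω → ℝ≥0∞}
    (hp : ∑' ω, p ω ≠ ⊤) (A' : Ω → α') (B : Ω → β) (C : Ω → γ) :
    0 ≤ condMutualInfo p A' B C := by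
  unfold condMutualInfo
  rw [tsum_fintype, Fintype.sum_prod_type_right]
  refine Finset.sum_nonneg fun t _ => ?_
  have hx : ∑ a', (marginal p (fun ω => (A' ω, B ω, C ω)) (a', t)).toReal =
      (marginal p (fun ω => (B ω, C ω)) t).toReal := by
    rw [← ENNReal.toReal_sum fun _ _ => marginal_ne_top hp _ _,
      ← tsum_marginal_prodMk p A' (fun ω => (B ω, C ω)), tsum_fintype]
  have hy : ∑ a', (marginal p (fun ω => (A' ω, C ω)) (a', t.2)).toReal =
      (marginal p C t.2).toReal := by
    rw [← ENNReal.toReal_sum fun _ _ => marginal_ne_top hp _ _,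
      ← tsum_marginal_prodMk p A' C, tsum_fintype]
  have hle1 : ∀ a', (marginal p (fun ω => (A' ω, B ω, C ω)) (a', t)).toReal ≤
      (marginal p (fun ω => (A' ω, C ω)) (a', t.2)).toReal := fun a' =>
    ENNReal.toReal_mono (marginal_ne_top hp _ _)
      (marginal_le_comp p (fun ω => (A' ω, B ω, C ω)) (fun t => (t.1, t.2.2)) (a', t))
  have hle2 : (marginal p (fun ω => (B ω, C ω)) t).toReal ≤ (marginal p C t.2).toReal :=
    ENNReal.toReal_mono (marginal_ne_top hp _ _)
      (marginal_le_comp p (fun ω => (B ω, C ω)) (fun t => t.2) t)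
  have hle3 : ∀ a', (marginal p (fun ω => (A' ω, B ω, C ω)) (a', t)).toReal ≤
      (marginal p (fun ω => (B ω, C ω)) t).toReal := fun a' =>
    ENNReal.toReal_mono (marginal_ne_top hp _ _)
      (marginal_le_comp p (fun ω => (A' ω, B ω, C ω)) (fun t => t.2) (a', t))
  have key := log_sum_inequality Finset.univ
    (fun a' => (marginal p (fun ω => (A' ω, B ω, C ω)) (a', t)).toReal)
    (fun a' => (marginal p (fun ω => (A' ω, C ω)) (a', t.2)).toReal *
      ((marginal p (fun ω => (B ω, C ω)) t).toReal / (marginal p C t.2).toReal))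
    (fun _ _ => ENNReal.toReal_nonneg)
    (fun _ _ => mul_nonneg ENNReal.toReal_nonneg
      (div_nonneg ENNReal.toReal_nonneg ENNReal.toReal_nonneg))
    (fun a' _ h => by
      refine le_antisymm ?_ ENNReal.toReal_nonneg
      rcases mul_eq_zero.1 h with h | h
      · exact (hle1 a').trans h.le
      · rcases div_eq_zero_iff.1 h with h | h
        · exact (hle3 a').trans h.le
        · exact ((hle3 a').trans hle2).trans h.le)
  rw [← Finset.sum_mul, hx, hy] at key
  have hz : (marginal p (fun ω => (B ω, C ω)) t).toReal *
      Real.logb 2 ((marginal p (fun ω => (B ω, C ω)) t).toReal / ((marginal p C t.2).toReal *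
        ((marginal p (fun ω => (B ω, C ω)) t).toReal / (marginal p C t.2).toReal))) = 0 := by
    rcases (ENNReal.toReal_nonneg
      (a := marginal p (fun ω => (B ω, C ω)) t)).eq_or_lt with h | h
    · rw [← h, zero_mul]
    · have := h.trans_le hle2
      rw [mul_div_cancel₀ _ this.ne', div_self h.ne', Real.logb_one, mul_zero]
  rw [hz] at key
  refine key.trans_eq (Finset.sum_congr rfl fun a' _ => ?_)
  rw [← mul_div_assoc, div_div_eq_mul_div]

/-- The data-processing inequality `I(A; B | C) ≤ I(A'; B | C)` when `A — (A', C) — B` is a Markov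
chain. Only `A'`, `B` and `C` have to take finitely many values. -/
theorem condMutualInfo_le_of_markov [Fintype α'] [Fintype β] [Fintype γ] {p : Ω → ℝ≥0∞}
    (hp : ∑' ω, p ω ≠ ⊤) (A : Ω → α) (A' : Ω → α') (B : Ω → β) (C : Ω → γ)
    (hM : ∀ a a' b c,
      marginal p (fun ω => (A' ω, A ω, B ω, C ω)) (a', a, b, c) *
          marginal p (fun ω => (A' ω, C ω)) (a', c) =
        marginal p (fun ω => (A' ω, A ω, C ω)) (a', a, c) *
          marginal p (fun ω => (A' ω, B ω, C ω)) (a', b, c)) :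
    condMutualInfo p A B C ≤ condMutualInfo p A' B C := by
  have h0 := condMutualInfo_nonneg hp A' B C
  set h : α' × β × γ → ℝ := fun t => Real.logb 2
        ((marginal p (fun ω => (A' ω, B ω, C ω)) t).toReal * (marginal p C t.2.2).toReal /
          ((marginal p (fun ω => (A' ω, C ω)) (t.1, t.2.2)).toReal *
            (marginal p (fun ω => (B ω, C ω)) t.2).toReal)) with hh
  -- `I(A'; B | C)` as the expectation of `h`, and then as a sum over the values of `(A, B, C)`
  have hb : ∀ t, |h t| ≤ ∑ t, |h t| := fun t =>
    Finset.single_le_sum (f := fun t => |h t|) (fun _ _ => abs_nonneg _) (Finset.mem_univ t)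
  have e1 := hasSum_marginal hp (fun ω => (A' ω, B ω, C ω)) h _ hb
  have e2 := hasSum_marginal hp (fun ω => (A' ω, A ω, B ω, C ω))
    (fun t => h (t.1, t.2.2)) _ (fun t => hb _)
  have e3 := (Equiv.prodComm _ _).hasSum_iff.2 e2
  have e4 := e3.prod_fiberwise (fun t => hasSum_fintype _)
  have e5 : condMutualInfo p A' B C = _ := e1.tsum_eq
  rw [e5] at h0 ⊢
  unfold condMutualInfo
  by_cases hs : Summable fun t : α × β × γ =>
    (marginal p (fun ω => (A ω, B ω, C ω)) t).toReal *
      Real.logb 2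
        ((marginal p (fun ω => (A ω, B ω, C ω)) t).toReal * (marginal p C t.2.2).toReal /
          ((marginal p (fun ω => (A ω, C ω)) (t.1, t.2.2)).toReal *
            (marginal p (fun ω => (B ω, C ω)) t.2).toReal))
  · refine hasSum_le (fun t => ?_) hs.hasSum e4
    obtain ⟨a, b, c⟩ := t
    exact condMutualInfo_term_le hp A A' B C hM a b c
  · -- `A` may take infinitely many values; a divergent series has the value zero by convention
    rw [tsum_eq_zero_of_not_summable hs]
    exact h0

end Info

/-! ### Mutual information of a finite channel, and the chain rule -/

section MutInfo

variable {T O : Type*} [Fintype T]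

/-- The mutual information, in bits, between the input and the output of a memoryless channel with
transition matrix `W`, for the input distribution `w`. -/
def mutInfo [Fintype O] (w : T → ℝ) (W : T → O → ℝ) : ℝ :=
  ∑ t, ∑ y, w t * W t y * Real.logb 2 (W t y / ∑ t', w t' * W t' y)

theorem output_pos {w : T → ℝ} {W : T → O → ℝ} (hw : ∀ t, 0 ≤ w t) (hW : ∀ t y, 0 ≤ W t y)
    {t : T} {y : O} (h : 0 < w t * W t y) : 0 < ∑ t', w t' * W t' y :=
  h.trans_le (Finset.single_le_sum (f := fun t' => w t' * W t' y)
    (fun t' _ => mul_nonneg (hw t') (hW t' y)) (Finset.mem_univ t))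

variable [Fintype O]

/-- Output entropy minus conditional entropy, a form that is continuous in `w` also at the boundary
of the simplex. -/
theorem mutInfo_eq_sub {w : T → ℝ} {W : T → O → ℝ} (hw : ∀ t, 0 ≤ w t) (hW : ∀ t y, 0 ≤ W t y) :
    mutInfo w W = (∑ t, ∑ y, w t * (W t y * Real.logb 2 (W t y))) -
      ∑ y, (∑ t, w t * W t y) * Real.logb 2 (∑ t, w t * W t y) := by
  have h2 : ∑ y, (∑ t, w t * W t y) * Real.logb 2 (∑ t, w t * W t y) =
      ∑ t, ∑ y, w t * W t y * Real.logb 2 (∑ t', w t' * W t' y) := by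
    rw [Finset.sum_comm]
    exact Finset.sum_congr rfl fun y _ => by rw [Finset.sum_mul]
  rw [h2, ← Finset.sum_sub_distrib]
  refine Finset.sum_congr rfl fun t _ => ?_
  rw [← Finset.sum_sub_distrib]
  refine Finset.sum_congr rfl fun y _ => ?_
  rcases (mul_nonneg (hw t) (hW t y)).eq_or_lt with h | h
  · rw [← h, zero_mul, zero_mul, ← mul_assoc, ← h]
    ring
  · have h3 : W t y ≠ 0 := fun h0 => by simp [h0] at h
    rw [Real.logb_div h3 (output_pos hw hW h).ne']
    ring

theorem continuousOn_mutInfo {W : T → O → ℝ} (hW : ∀ t y, 0 ≤ W t y) :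
    ContinuousOn (fun w : T → ℝ => mutInfo w W) (stdSimplex ℝ T) := by
  have hc : Continuous fun w : T → ℝ => (∑ t, ∑ y, w t * (W t y * Real.logb 2 (W t y))) -
      ∑ y, (∑ t, w t * W t y) * Real.logb 2 (∑ t, w t * W t y) := by
    have hm : Continuous fun x : ℝ => x * Real.logb 2 x := by
      have := Real.continuous_mul_log.div_const (Real.log 2)
      refine this.congr fun x => ?_
      rw [Real.logb, mul_div_assoc]
    refine Continuous.sub (by fun_prop) ?_
    refine continuous_finsetSum _ fun y _ => ?_
    exact hm.comp (by fun_prop : Continuous fun w : T → ℝ => ∑ t, w t * W t y)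
  exact hc.continuousOn.congr fun w hw => mutInfo_eq_sub hw.1 hW

theorem sum_output {w : T → ℝ} {W : T → O → ℝ} (hw1 : ∑ t, w t = 1) (hW1 : ∀ t, ∑ y, W t y = 1) :
    ∑ y, ∑ t, w t * W t y = 1 := by
  rw [Finset.sum_comm]
  simp_rw [← Finset.mul_sum, hW1, mul_one, hw1]

/-- Mutual information is at least the mean of `log (V / w)`, for any "guess" `V` of the posterior
distribution of the input. -/
theorem le_mutInfo {w : T → ℝ} {W : T → O → ℝ} (hw : ∀ t, 0 ≤ w t) (hw1 : ∑ t, w t = 1)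
    (hW : ∀ t y, 0 ≤ W t y) (hW1 : ∀ t, ∑ y, W t y = 1) (V : T → O → ℝ) (hV : ∀ t y, 0 < V t y)
    (hV1 : ∀ y, ∑ t, V t y ≤ 1) :
    ∑ t, ∑ y, w t * W t y * Real.logb 2 (V t y / w t) ≤ mutInfo w W := by
  have key := log_sum_inequality (Finset.univ : Finset (T × O)) (fun i => w i.1 * W i.1 i.2)
    (fun i => V i.1 i.2 * ∑ t', w t' * W t' i.2)
    (fun i _ => mul_nonneg (hw _) (hW _ _))
    (fun i _ => mul_nonneg (hV _ _).le (Finset.sum_nonneg fun t _ => mul_nonneg (hw _) (hW _ _)))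
    (fun i _ h => by
      by_contra h'
      have hp : 0 < w i.1 * W i.1 i.2 := lt_of_le_of_ne (mul_nonneg (hw _) (hW _ _)) (Ne.symm h')
      exact (mul_pos (hV i.1 i.2) (output_pos hw hW hp)).ne' h)
  have h1 : ∑ i : T × O, w i.1 * W i.1 i.2 = 1 := by
    rw [Fintype.sum_prod_type]
    simp_rw [← Finset.mul_sum, hW1, mul_one, hw1]
  have h2 : ∑ i : T × O, V i.1 i.2 * ∑ t', w t' * W t' i.2 ≤ 1 := by
    rw [Fintype.sum_prod_type_right]
    simp_rw [← Finset.sum_mul]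
    calc ∑ y, (∑ t, V t y) * ∑ t', w t' * W t' y ≤ ∑ y, 1 * ∑ t', w t' * W t' y :=
          Finset.sum_le_sum fun y _ => mul_le_mul_of_nonneg_right (hV1 y)
            (Finset.sum_nonneg fun t _ => mul_nonneg (hw _) (hW _ _))
      _ = 1 := by simp_rw [one_mul]; exact sum_output hw1 hW1
  rw [h1, one_mul] at key
  have h0 : 0 ≤ ∑ i : T × O, V i.1 i.2 * ∑ t', w t' * W t' i.2 :=
    Finset.sum_nonneg fun i _ => mul_nonneg (hV _ _).le
      (Finset.sum_nonneg fun t _ => mul_nonneg (hw _) (hW _ _))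
  have h3 : 0 ≤ Real.logb 2 (1 / ∑ i : T × O, V i.1 i.2 * ∑ t', w t' * W t' i.2) := by
    rcases h0.eq_or_lt with h | h
    · rw [← h]; simp
    · exact Real.logb_nonneg (by norm_num) ((one_le_div h).2 h2)
  have h4 := h3.trans key
  rw [Fintype.sum_prod_type] at h4
  unfold mutInfo
  rw [← sub_nonneg, ← Finset.sum_sub_distrib]
  refine h4.trans_eq (Finset.sum_congr rfl fun t _ => ?_)
  rw [← Finset.sum_sub_distrib]
  refine Finset.sum_congr rfl fun y _ => ?_
  rcases (mul_nonneg (hw t) (hW t y)).eq_or_lt with h | h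
  · simp only [← h, zero_mul, sub_self]
  · have h5 : w t ≠ 0 := fun h0 => by simp [h0] at h
    have h6 : W t y ≠ 0 := fun h0 => by simp [h0] at h
    have h7 := (output_pos hw hW h).ne'
    have h8 := (hV t y).ne'
    simp only
    rw [Real.logb_div (mul_ne_zero h5 h6) (mul_ne_zero h8 h7), Real.logb_mul h5 h6,
      Real.logb_mul h8 h7, Real.logb_div h6 h7, Real.logb_div h8 h5]
    ring

theorem mutInfo_nonneg {w : T → ℝ} {W : T → O → ℝ} (hw : ∀ t, 0 ≤ w t) (hw1 : ∑ t, w t = 1)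
    (hW : ∀ t y, 0 ≤ W t y) (hW1 : ∀ t, ∑ y, W t y = 1) : 0 ≤ mutInfo w W := by
  have key := log_sum_inequality (Finset.univ : Finset (T × O)) (fun i => w i.1 * W i.1 i.2)
    (fun i => w i.1 * ∑ t', w t' * W t' i.2)
    (fun i _ => mul_nonneg (hw _) (hW _ _))
    (fun i _ => mul_nonneg (hw _) (Finset.sum_nonneg fun t _ => mul_nonneg (hw _) (hW _ _)))
    (fun i _ h => by
      rcases mul_eq_zero.1 h with h | h
      · rw [h, zero_mul]
      · by_contra h'
        have hp : 0 < w i.1 * W i.1 i.2 := lt_of_le_of_ne (mul_nonneg (hw _) (hW _ _)) (Ne.symm h')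
        exact (output_pos hw hW hp).ne' h)
  have h1 : ∑ i : T × O, w i.1 * W i.1 i.2 = 1 := by
    rw [Fintype.sum_prod_type]
    simp_rw [← Finset.mul_sum, hW1, mul_one, hw1]
  have h2 : ∑ i : T × O, w i.1 * ∑ t', w t' * W t' i.2 = 1 := by
    rw [Fintype.sum_prod_type]
    simp_rw [← Finset.mul_sum, sum_output hw1 hW1, mul_one, hw1]
  rw [h1, h2, div_one, Real.logb_one, mul_zero, Fintype.sum_prod_type] at key
  refine key.trans_eq (Finset.sum_congr rfl fun t _ => Finset.sum_congr rfl fun y _ => ?_)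
  by_cases h : w t = 0
  · simp [h]
  · rw [mul_div_mul_left _ _ h]

/-- The output alphabet bounds mutual information: `I ≤ log |O|`. -/
theorem mutInfo_le {w : T → ℝ} {W : T → O → ℝ} (hw : ∀ t, 0 ≤ w t) (hw1 : ∑ t, w t = 1)
    (hW : ∀ t y, 0 ≤ W t y) (hW1 : ∀ t, ∑ y, W t y = 1) :
    mutInfo w W ≤ Real.logb 2 (Fintype.card O) := by
  have hWle : ∀ t y, W t y ≤ 1 := fun t y => by
    rw [← hW1 t]
    exact Finset.single_le_sum (fun y _ => hW t y) (Finset.mem_univ y)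
  rw [mutInfo_eq_sub hw hW]
  have h1 : ∑ t, ∑ y, w t * (W t y * Real.logb 2 (W t y)) ≤ 0 :=
    Finset.sum_nonpos fun t _ => Finset.sum_nonpos fun y _ =>
      mul_nonpos_of_nonneg_of_nonpos (hw t) (mul_nonpos_of_nonneg_of_nonpos (hW t y)
        (Real.logb_nonpos (by norm_num) (hW t y) (hWle t y)))
  have h2 := log_sum_inequality (Finset.univ : Finset O) (fun y => ∑ t, w t * W t y) (fun _ => 1)
    (fun y _ => Finset.sum_nonneg fun t _ => mul_nonneg (hw _) (hW _ _)) (fun _ _ => zero_le_one)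
    (fun _ _ h => absurd h one_ne_zero)
  rw [sum_output hw1 hW1] at h2
  simp only [Finset.sum_const, Finset.card_univ, nsmul_eq_mul, mul_one, one_mul, div_one,
    one_div, Real.logb_inv] at h2
  linarith

/-- For a fixed input distribution, mutual information is convex in the channel. -/
theorem mutInfo_le_average {ι : Type*} [Fintype ι] {w : T → ℝ} (hw : ∀ t, 0 ≤ w t) (q : ι → ℝ)
    (hq : ∀ i, 0 ≤ q i) (W : ι → T → O → ℝ) (hW : ∀ i t y, 0 ≤ W i t y) :
    mutInfo w (fun t y => ∑ i, q i * W i t y) ≤ ∑ i, q i * mutInfo w (W i) := by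
  have h1 : ∑ i, q i * mutInfo w (W i) = ∑ t, ∑ y, ∑ i, q i * (w t * W i t y *
      Real.logb 2 (W i t y / ∑ t', w t' * W i t' y)) := by
    simp_rw [mutInfo, Finset.mul_sum]
    rw [Finset.sum_comm]
    exact Finset.sum_congr rfl fun t _ => by rw [Finset.sum_comm]
  rw [h1]
  refine Finset.sum_le_sum fun t _ => Finset.sum_le_sum fun y _ => ?_
  rcases (hw t).eq_or_lt with h | h
  · simp [← h]
  have key := log_sum_inequality (Finset.univ : Finset ι) (fun i => q i * W i t y)
    (fun i => q i * ∑ t', w t' * W i t' y)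
    (fun i _ => mul_nonneg (hq _) (hW _ _ _))
    (fun i _ => mul_nonneg (hq _) (Finset.sum_nonneg fun t _ => mul_nonneg (hw _) (hW _ _ _)))
    (fun i _ h0 => by
      rcases mul_eq_zero.1 h0 with h0 | h0
      · rw [h0, zero_mul]
      · by_contra h'
        have hp : 0 < W i t y := lt_of_le_of_ne (hW i t y) fun h2 => h' (by rw [← h2, mul_zero])
        exact (output_pos hw (hW i) (mul_pos h hp)).ne' h0)
  have h2 : ∑ t', w t' * ∑ i, q i * W i t' y = ∑ i, q i * ∑ t', w t' * W i t' y := by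
    simp_rw [Finset.mul_sum]
    rw [Finset.sum_comm]
    exact Finset.sum_congr rfl fun t _ => Finset.sum_congr rfl fun y _ => by ring
  rw [h2, mul_assoc]
  refine (mul_le_mul_of_nonneg_left key h.le).trans_eq ?_
  rw [Finset.mul_sum]
  refine Finset.sum_congr rfl fun i _ => ?_
  by_cases h3 : q i = 0
  · simp [h3]
  · rw [mul_div_mul_left _ _ h3]
    ring

end MutInfo

section ChainRule

variable {T Y : Type*} {N : ℕ}

/-- The probability of the first `j` entries of `y`. -/
def prefixMass (Q : (Fin N → Y) → ℝ≥0∞) (j : ℕ) (y : Fin N → Y) : ℝ≥0∞ :=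
  marginal Q (fun y' (k : {k : Fin N // (k : ℕ) < j}) => y' k) (fun k => y k)

theorem le_prefixMass (Q : (Fin N → Y) → ℝ≥0∞) (j : ℕ) (y : Fin N → Y) :
    Q y ≤ prefixMass Q j y := by
  classical
  unfold prefixMass marginal
  refine le_trans ?_ (ENNReal.le_tsum y)
  simp

theorem marginal_congr_iff {Ω α β : Type*} (p : Ω → ℝ≥0∞) (Z : Ω → α) (Z' : Ω → β) (z : α) (z' : β)
    (h : ∀ ω, Z ω = z ↔ Z' ω = z') : marginal p Z z = marginal p Z' z' := by
  classical
  unfold marginal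
  exact tsum_congr fun ω => by simp only [h ω]

theorem past_eq_iff (y y' : Fin N → Y) (i : Fin N) :
    past y' i = past y i ↔ ∀ k : Fin N, k < i → y' k = y k := by
  constructor
  · intro h k hk
    exact congrFun h ⟨k, hk⟩
  · intro h
    funext j
    exact h ⟨j, j.isLt.trans i.isLt⟩ j.isLt

theorem marginal_past (Q : (Fin N → Y) → ℝ≥0∞) (i : Fin N) (y : Fin N → Y) :
    marginal Q (fun y' => past y' i) (past y i) = prefixMass Q i y := by
  refine marginal_congr_iff _ _ _ _ _ fun y' => ?_
  rw [past_eq_iff, funext_iff, Subtype.forall]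
  exact Iff.rfl

theorem marginal_past_succ (Q : (Fin N → Y) → ℝ≥0∞) (i : Fin N) (y : Fin N → Y) :
    marginal Q (fun y' => (y' i, past y' i)) (y i, past y i) = prefixMass Q (i + 1) y := by
  refine marginal_congr_iff _ _ _ _ _ fun y' => ?_
  rw [Prod.mk.injEq, past_eq_iff, funext_iff, Subtype.forall]
  constructor
  · rintro ⟨h1, h2⟩ k hk
    rcases Nat.lt_succ_iff_lt_or_eq.1 hk with h | h
    · exact h2 k h
    · obtain rfl : k = i := Fin.ext h
      exact h1
  · intro h
    exact ⟨h i (Nat.lt_succ_self _), fun k hk => h k (Nat.lt_succ_of_lt hk)⟩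

theorem prefixMass_zero (Q : (Fin N → Y) → ℝ≥0∞) (y : Fin N → Y) :
    prefixMass Q 0 y = ∑' y', Q y' := by
  classical
  unfold prefixMass marginal
  refine tsum_congr fun y' => if_pos ?_
  funext k
  exact absurd k.2 (Nat.not_lt_zero _)

theorem prefixMass_self (Q : (Fin N → Y) → ℝ≥0∞) (y : Fin N → Y) : prefixMass Q N y = Q y := by
  classical
  unfold prefixMass marginal
  rw [tsum_eq_single y]
  · simp
  · intro y' h
    refine if_neg fun h' => h ?_
    funext k
    exact congrFun h' ⟨k, k.isLt⟩

theorem marginal_mul_kernel {O α : Type*} (p : T → ℝ≥0∞) (W : T → O → ℝ≥0∞)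
    (Z : O → α) (t : T) (z : α) :
    marginal (fun ω : T × O => p ω.1 * W ω.1 ω.2) (fun ω => (ω.1, Z ω.2)) (t, z) =
      p t * marginal (W t) Z z := by
  classical
  unfold marginal
  rw [ENNReal.tsum_prod', tsum_eq_single t]
  · rw [← ENNReal.tsum_mul_left]
    exact tsum_congr fun y => by simp
  · intro t' h
    simp [h]

theorem marginal_snd_mul_kernel {O α : Type*} [Fintype T] (p : T → ℝ≥0∞) (W : T → O → ℝ≥0∞)
    (Z : O → α) (z : α) :
    marginal (fun ω : T × O => p ω.1 * W ω.1 ω.2) (fun ω => Z ω.2) z =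
      marginal (fun y => ∑ t, p t * W t y) Z z := by
  classical
  unfold marginal
  rw [ENNReal.tsum_prod', ENNReal.tsum_comm]
  refine tsum_congr fun y => ?_
  rw [tsum_fintype]
  split_ifs <;> simp

/-- The chain rule: the sum of the informations that the input gives on the output symbols, each
conditioned on the preceding ones, is the mutual information of input and output sequence. -/
theorem sum_condMutualInfo_eq_mutInfo [Fintype T] [Fintype Y] (p : T → ℝ≥0∞) (hp : ∑ t, p t = 1)
    (W : T → (Fin N → Y) → ℝ≥0∞) (hW : ∀ t, ∑ y, W t y = 1) :
    ∑ i : Fin N, condMutualInfo (fun ω : T × (Fin N → Y) => p ω.1 * W ω.1 ω.2) (fun ω => ω.1)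
        (fun ω => ω.2 i) (fun ω => past ω.2 i) =
      mutInfo (fun t => (p t).toReal) (fun t y => (W t y).toReal) := by
  classical
  set r : T × (Fin N → Y) → ℝ≥0∞ := fun ω => p ω.1 * W ω.1 ω.2 with hr
  set Q : (Fin N → Y) → ℝ≥0∞ := fun y => ∑ t, p t * W t y with hQ
  have hp1 : ∀ t, p t ≤ 1 := fun t => by
    rw [← hp]; exact Finset.single_le_sum (fun _ _ => zero_le) (Finset.mem_univ t)
  have hW1 : ∀ t y, W t y ≤ 1 := fun t y => by
    rw [← hW t]; exact Finset.single_le_sum (fun _ _ => zero_le) (Finset.mem_univ y)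
  have hpt : ∀ t, p t ≠ ⊤ := fun t => ne_top_of_le_ne_top ENNReal.one_ne_top (hp1 t)
  have hWt : ∀ t y, W t y ≠ ⊤ := fun t y => ne_top_of_le_ne_top ENNReal.one_ne_top (hW1 t y)
  have hrt : ∀ ω, r ω ≠ ⊤ := fun ω => ENNReal.mul_ne_top (hpt _) (hWt _ _)
  have hQ1 : ∑ y, Q y = 1 := by
    rw [hQ, Finset.sum_comm]
    simp_rw [← Finset.mul_sum, hW, mul_one, hp]
  have hWm : ∀ t j y, prefixMass (W t) j y ≠ ⊤ := fun t j y =>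
    marginal_ne_top (by rw [tsum_fintype, hW]; exact ENNReal.one_ne_top) _ _
  have hQm : ∀ j y, prefixMass Q j y ≠ ⊤ := fun j y =>
    marginal_ne_top (by rw [tsum_fintype, hQ1]; exact ENNReal.one_ne_top) _ _
  -- the information that the first `j` outputs give on the input; the sum over `j` telescopes
  set L : T × (Fin N → Y) → ℕ → ℝ := fun ω j =>
    Real.logb 2 (prefixMass (W ω.1) j ω.2).toReal - Real.logb 2 (prefixMass Q j ω.2).toReal with hL
  have hterm : ∀ i : Fin N, condMutualInfo r (fun ω => ω.1) (fun ω => ω.2 i)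
      (fun ω => past ω.2 i) = ∑ ω, (r ω).toReal * (L ω (i + 1) - L ω i) := by
    intro i
    unfold condMutualInfo
    rw [tsum_fintype, sum_marginal_toReal_mul hrt]
    refine Finset.sum_congr rfl fun ω _ => ?_
    obtain ⟨t, y⟩ := ω
    have e1 : marginal r (fun ω => (ω.1, ω.2 i, past ω.2 i)) (t, y i, past y i) =
        p t * prefixMass (W t) (i + 1) y := by
      rw [← marginal_past_succ]
      exact marginal_mul_kernel p W (fun y => (y i, past y i)) t _
    have e2 : marginal r (fun ω => past ω.2 i) (past y i) = prefixMass Q i y := by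
      rw [← marginal_past]
      exact marginal_snd_mul_kernel p W (fun y => past y i) _
    have e3 : marginal r (fun ω => (ω.1, past ω.2 i)) (t, past y i) =
        p t * prefixMass (W t) i y := by
      rw [← marginal_past]
      exact marginal_mul_kernel p W (fun y => past y i) t _
    have e4 : marginal r (fun ω => (ω.2 i, past ω.2 i)) (y i, past y i) =
        prefixMass Q (i + 1) y := by
      rw [← marginal_past_succ]
      exact marginal_snd_mul_kernel p W (fun y => (y i, past y i)) _
    simp only [e1, e2, e3, e4]
    rcases (ENNReal.toReal_nonneg (a := r (t, y))).eq_or_lt with h | h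
    · rw [← h, zero_mul, zero_mul]
    · congr 1
      have hr0 : r (t, y) ≠ 0 := fun h0 => by rw [h0] at h; simp at h
      have hp0 : p t ≠ 0 := left_ne_zero_of_mul hr0
      have hW0 : W t y ≠ 0 := right_ne_zero_of_mul hr0
      have hQ0 : Q y ≠ 0 := fun h0 => hr0
        ((Finset.sum_eq_zero_iff_of_nonneg (fun _ _ => zero_le)).1 h0 t (Finset.mem_univ t))
      have a1 : (p t).toReal ≠ 0 := ENNReal.toReal_ne_zero.2 ⟨hp0, hpt t⟩
      have a2 : ∀ j, (prefixMass (W t) j y).toReal ≠ 0 := fun j =>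
        ENNReal.toReal_ne_zero.2 ⟨fun h0 => hW0 (le_zero_iff.1 (h0 ▸ le_prefixMass (W t) j y)),
          hWm t j y⟩
      have a3 : ∀ j, (prefixMass Q j y).toReal ≠ 0 := fun j =>
        ENNReal.toReal_ne_zero.2 ⟨fun h0 => hQ0 (le_zero_iff.1 (h0 ▸ le_prefixMass Q j y)),
          hQm j y⟩
      simp only [hL, ENNReal.toReal_mul]
      rw [Real.logb_div (mul_ne_zero (mul_ne_zero a1 (a2 _)) (a3 _))
          (mul_ne_zero (mul_ne_zero a1 (a2 _)) (a3 _)),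
        Real.logb_mul (mul_ne_zero a1 (a2 _)) (a3 _), Real.logb_mul a1 (a2 _),
        Real.logb_mul (mul_ne_zero a1 (a2 _)) (a3 _), Real.logb_mul a1 (a2 _)]
      ring
  rw [Finset.sum_congr rfl fun i _ => hterm i, Finset.sum_comm]
  unfold mutInfo
  rw [Fintype.sum_prod_type]
  refine Finset.sum_congr rfl fun t _ => Finset.sum_congr rfl fun y _ => ?_
  rw [← Finset.mul_sum, Fin.sum_univ_eq_sum_range (fun j => L (t, y) (j + 1) - L (t, y) j),
    Finset.sum_range_sub]
  simp only [hL, prefixMass_zero, prefixMass_self, tsum_fintype, hW, hQ1, hr, ENNReal.toReal_mul]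
  have hQr : (Q y).toReal = ∑ t', (p t').toReal * (W t' y).toReal := by
    rw [hQ, ENNReal.toReal_sum fun t' _ => ENNReal.mul_ne_top (hpt _) (hWt _ _)]
    simp_rw [ENNReal.toReal_mul]
  rw [← hQr]
  by_cases h : (p t).toReal * (W t y).toReal = 0
  · rw [h, zero_mul, zero_mul]
  · have hr0 : r (t, y) ≠ 0 := fun h0 => h (by
      rw [← ENNReal.toReal_mul]; exact (ENNReal.toReal_eq_zero_iff _).2 (Or.inl h0))
    have hQ0 : Q y ≠ 0 := fun h0 => hr0
        ((Finset.sum_eq_zero_iff_of_nonneg (fun _ _ => zero_le)).1 h0 t (Finset.mem_univ t))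
    have hQ2 : Q y ≠ ⊤ := by rw [← prefixMass_self Q y]; exact hQm N y
    rw [Real.logb_div (right_ne_zero_of_mul h) (ENNReal.toReal_ne_zero.2 ⟨hQ0, hQ2⟩)]
    simp

end ChainRule

/-! ### Decision trees and their output laws -/

section Trees

variable {X Y S V : Type*}

/-- A decision tree of depth `N`: at time `i + 1` it chooses a symbol of `V` as a function of the
outputs `y₁, …, y_i`. With `V = S → X` this is a feedback code for a single message whose input at
each time depends, besides the past outputs, on the current state only. -/
abbrev Tree (V Y : Type*) (N : ℕ) : Type _ := (i : Fin N) → (Fin (i : ℕ) → Y) → V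

/-- The symbols that a decision tree chooses along an output sequence. -/
def follow {N : ℕ} (t : Tree V Y N) (y : Fin N → Y) : Fin N → V := fun i => t i (past y i)

theorem sum_snoc {α M : Type*} [Fintype α] [AddCommMonoid M] {n : ℕ}
    (F : (Fin (n + 1) → α) → M) :
    ∑ z, F z = ∑ z' : Fin n → α, ∑ a, F (Fin.snoc z' a) := by
  rw [← (Fin.snocEquiv fun _ : Fin (n + 1) => α).sum_comp, Fintype.sum_prod_type_right]
  rfl

theorem sum_cons {α M : Type*} [Fintype α] [AddCommMonoid M] {n : ℕ}
    (F : (Fin (n + 1) → α) → M) :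
    ∑ z, F z = ∑ a, ∑ z' : Fin n → α, F (Fin.cons a z') := by
  rw [← (Fin.consEquiv fun _ : Fin (n + 1) => α).sum_comp, Fintype.sum_prod_type]
  rfl

/-- The probability of the states `s₁, …, s_N` and the outputs `y`, given the initial state and
the inputs `x`. -/
def Channel.pathWeight (ch : Channel X Y S) {N : ℕ} (x : Fin N → X) (s : Fin (N + 1) → S)
    (y : Fin N → Y) : ℝ≥0∞ :=
  ∏ i : Fin N, ch.trans (x i) (s i.castSucc) (y i, s i.succ)

/-- The probability of the output sequence `y` when the input at time `i + 1` is `v i s_i`. -/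
def Channel.outputLaw [Fintype S] (ch : Channel X Y S) {N : ℕ} (v : Fin N → S → X)
    (y : Fin N → Y) : ℝ≥0∞ :=
  ∑ s : Fin (N + 1) → S, ch.init (s 0) * ch.pathWeight (fun i => v i (s i.castSucc)) s y

/-- The law of the output sequence when the inputs are chosen by a decision tree. -/
def Channel.treeLaw [Fintype S] (ch : Channel X Y S) {N : ℕ} (t : Tree (S → X) Y N)
    (y : Fin N → Y) : ℝ≥0∞ :=
  ch.outputLaw (follow t y) y

theorem past_snoc_castSucc {α : Type*} {n : ℕ} (z : Fin n → α) (a : α) (i : Fin n) :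
    past (Fin.snoc z a : Fin (n + 1) → α) i.castSucc = past z i := by
  funext j
  exact Fin.snoc_castSucc (α := fun _ => α) a z ⟨j, j.isLt.trans i.isLt⟩

theorem past_snoc_last {α : Type*} {n : ℕ} (z : Fin n → α) (a : α) :
    past (Fin.snoc z a : Fin (n + 1) → α) (Fin.last n) = z := by
  funext j
  exact Fin.snoc_castSucc (α := fun _ => α) a z j

/-- A decision tree of depth `N + 1` from one of depth `N` and its last decision. -/
def Tree.snoc {N : ℕ} (t : Tree V Y N) (r : (Fin N → Y) → V) : Tree V Y (N + 1) :=
  Fin.snoc (α := fun i : Fin (N + 1) => (Fin (i : ℕ) → Y) → V) t r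

theorem Tree.exists_eq_snoc {N : ℕ} (t : Tree V Y (N + 1)) : ∃ t' r, t = Tree.snoc t' r := by
  refine ⟨fun i => t i.castSucc, t (Fin.last N), ?_⟩
  funext i
  refine Fin.lastCases ?_ (fun i => ?_) i
  · exact (Fin.snoc_last (α := fun i : Fin (N + 1) => (Fin (i : ℕ) → Y) → V) _ _).symm
  · exact (Fin.snoc_castSucc (α := fun i : Fin (N + 1) => (Fin (i : ℕ) → Y) → V)
      (t (Fin.last N)) (fun i => t i.castSucc) i).symm

theorem follow_snoc {N : ℕ} (t : Tree V Y N) (r : (Fin N → Y) → V) (y : Fin N → Y) (b : Y) :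
    follow (t.snoc r) (Fin.snoc y b) = Fin.snoc (follow t y) (r y) := by
  funext i
  refine Fin.lastCases ?_ (fun i => ?_) i
  · rw [Fin.snoc_last]
    unfold follow Tree.snoc
    rw [Fin.snoc_last (α := fun i : Fin (N + 1) => (Fin (i : ℕ) → Y) → V), past_snoc_last]
  · rw [Fin.snoc_castSucc (α := fun _ => V)]
    unfold follow Tree.snoc
    rw [Fin.snoc_castSucc (α := fun i : Fin (N + 1) => (Fin (i : ℕ) → Y) → V),
      past_snoc_castSucc]

theorem pathWeight_snoc (ch : Channel X Y S) {N : ℕ} (x : Fin N → X) (a : X)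
    (s : Fin (N + 1) → S) (c : S) (y : Fin N → Y) (b : Y) :
    ch.pathWeight (Fin.snoc x a : Fin (N + 1) → X) (Fin.snoc s c : Fin (N + 2) → S)
      (Fin.snoc y b : Fin (N + 1) → Y) =
      ch.pathWeight x s y * ch.trans a (s (Fin.last N)) (b, c) := by
  unfold Channel.pathWeight
  rw [Fin.prod_univ_castSucc]
  congr 1
  · refine Finset.prod_congr rfl fun i _ => ?_
    rw [Fin.snoc_castSucc (α := fun _ => X), Fin.snoc_castSucc (α := fun _ => S),
      Fin.snoc_castSucc (α := fun _ => Y), ← Fin.castSucc_succ, Fin.snoc_castSucc (α := fun _ => S)]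
  · rw [Fin.snoc_last, Fin.snoc_last, Fin.snoc_castSucc (α := fun _ => S), Fin.succ_last,
      Fin.snoc_last]

theorem sum_trans [Fintype Y] [Fintype S] (ch : Channel X Y S) (x : X) (s : S) :
    ∑ c, ∑ b, ch.trans x s (b, c) = 1 := by
  rw [← Fintype.sum_prod_type_right (f := fun p => ch.trans x s p)]
  have := (ch.trans x s).tsum_coe
  rwa [tsum_fintype] at this

theorem snoc_apply_castSucc_family {N : ℕ} (v : Fin N → S → X) (a : S → X)
    (s : Fin (N + 1) → S) (c : S) :
    (fun i : Fin (N + 1) => (Fin.snoc v a : Fin (N + 1) → S → X) i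
      ((Fin.snoc s c : Fin (N + 2) → S) i.castSucc)) =
    Fin.snoc (fun i => v i (s i.castSucc)) (a (s (Fin.last N))) := by
  funext i
  refine Fin.lastCases ?_ (fun i => ?_) i
  · rw [Fin.snoc_last, Fin.snoc_last, Fin.snoc_castSucc (α := fun _ => S)]
  · rw [Fin.snoc_castSucc (α := fun _ => S → X), Fin.snoc_castSucc (α := fun _ => X),
      Fin.snoc_castSucc (α := fun _ => S)]

theorem snoc_apply_zero {α : Type*} {n : ℕ} (s : Fin (n + 1) → α) (c : α) :
    (Fin.snoc s c : Fin (n + 2) → α) 0 = s 0 :=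
  Fin.snoc_castSucc (α := fun _ => α) c s 0

theorem sum_outputLaw_snoc [Fintype Y] [Fintype S] (ch : Channel X Y S) {N : ℕ}
    (v : Fin N → S → X) (a : S → X) (y : Fin N → Y) :
    ∑ b, ch.outputLaw (Fin.snoc v a) (Fin.snoc y b) = ch.outputLaw v y := by
  unfold Channel.outputLaw
  rw [Finset.sum_comm, sum_snoc]
  refine Finset.sum_congr rfl fun s _ => ?_
  simp_rw [snoc_apply_castSucc_family, pathWeight_snoc, snoc_apply_zero, ← mul_assoc,
    ← Finset.mul_sum]
  rw [sum_trans, mul_one]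

theorem sum_treeLaw [Fintype Y] [Fintype S] (ch : Channel X Y S) {N : ℕ}
    (t : Tree (S → X) Y N) : ∑ y, ch.treeLaw t y = 1 := by
  induction N with
  | zero =>
    rw [Fintype.sum_unique]
    unfold Channel.treeLaw Channel.outputLaw Channel.pathWeight
    simp only [Finset.univ_eq_empty, Finset.prod_empty, mul_one]
    rw [sum_cons (fun s : Fin 1 → S => ch.init (s 0))]
    simp only [Fin.cons_zero, Finset.sum_const, Finset.card_univ, Fintype.card_unique, one_smul]
    have := ch.init.tsum_coe
    rwa [tsum_fintype] at this
  | succ N ih =>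
    obtain ⟨t, r, rfl⟩ := t.exists_eq_snoc
    rw [sum_snoc, ← ih t]
    refine Finset.sum_congr rfl fun y _ => ?_
    unfold Channel.treeLaw
    simp_rw [follow_snoc]
    exact sum_outputLaw_snoc ch _ _ y

end Trees

/-! ### The joint law of auxiliary symbols and outputs -/

section Auxiliary

variable {X Y S U : Type*}

/-- The causally conditioned probability `∏ P(u_i | u_{i-1}, y^{i-1})`. -/
def InputLaw.weight {N : ℕ} (K : InputLaw U Y N) (u : Fin N → U) (y : Fin N → Y) : ℝ≥0∞ :=
  ∏ i, K i (prev u i) (past y i) (u i)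

/-- The states and inputs summed out of the joint law: the auxiliary symbols enter the channel only
through the functions `f (u i)`. -/
theorem marginal_jointProb [Fintype S] (ch : Channel X Y S) {N : ℕ} (f : U → S → X)
    (K : InputLaw U Y N) (u : Fin N → U) (y : Fin N → Y) :
    marginal (jointProb ch f K) (fun ω => (ω.2.2.2, ω.2.2.1)) (u, y) =
      K.weight u y * ch.outputLaw (fun i => f (u i)) y := by
  classical
  unfold marginal
  rw [ENNReal.tsum_prod']
  trans ∑' s : Fin (N + 1) → S, K.weight u y * (ch.init (s 0) *
    ch.pathWeight (fun i => f (u i) (s i.castSucc)) s y)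
  · refine tsum_congr fun s => ?_
    rw [tsum_eq_single ((fun i => f (u i) (s i.castSucc)), y, u)]
    · rw [if_pos rfl]
      simp only [jointProb, InputLaw.weight, Channel.pathWeight, if_true, mul_one,
        Finset.prod_mul_distrib]
      ring
    · rintro ⟨x, y', u'⟩ hne
      by_cases h : (u', y') = (u, y)
      · rw [if_pos h]
        obtain ⟨rfl, rfl⟩ := Prod.mk.inj h
        have hx : x ≠ fun i => f (u' i) (s i.castSucc) := fun h => hne (by rw [h])
        obtain ⟨i, hi⟩ := Function.ne_iff.1 hx
        simp only [jointProb]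
        rw [Finset.prod_eq_zero (Finset.mem_univ i), mul_zero]
        rw [if_neg hi, mul_zero, zero_mul]
      · rw [if_neg h]
  · rw [tsum_fintype, ← Finset.mul_sum]
    rfl

/-- The last entry of a sequence, and `none` if it is empty. -/
def lastEntry {n : ℕ} (w : Fin n → U) : Option U :=
  if h : n = 0 then none else some (w ⟨n - 1, by omega⟩)

theorem prev_snoc_castSucc {n : ℕ} (w : Fin n → U) (a : U) (i : Fin n) :
    prev (Fin.snoc w a : Fin (n + 1) → U) i.castSucc = prev w i := by
  unfold prev
  by_cases h : (i : ℕ) = 0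
  · rw [dif_pos h, dif_pos (by simpa using h)]
  · rw [dif_neg h, dif_neg (by simpa using h)]
    congr 1
    exact Fin.snoc_castSucc (α := fun _ => U) a w ⟨(i : ℕ) - 1, by omega⟩

theorem prev_snoc_last {n : ℕ} (w : Fin n → U) (a : U) :
    prev (Fin.snoc w a : Fin (n + 1) → U) (Fin.last n) = lastEntry w := by
  unfold prev lastEntry
  by_cases h : n = 0
  · rw [dif_pos h, dif_pos (by simpa using h)]
  · rw [dif_neg h, dif_neg (by simpa using h)]
    congr 1
    exact Fin.snoc_castSucc (α := fun _ => U) a w ⟨n - 1, by omega⟩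

theorem weight_snoc {N : ℕ} (K : InputLaw U Y (N + 1)) (u : Fin N → U) (a : U) (y : Fin N → Y)
    (b : Y) :
    K.weight (Fin.snoc u a) (Fin.snoc y b) =
      InputLaw.weight (fun i => K i.castSucc) u y * K (Fin.last N) (lastEntry u) y a := by
  unfold InputLaw.weight
  rw [Fin.prod_univ_castSucc]
  congr 1
  · refine Finset.prod_congr rfl fun i _ => ?_
    rw [prev_snoc_castSucc, past_snoc_castSucc, Fin.snoc_castSucc (α := fun _ => U)]
  · rw [prev_snoc_last, past_snoc_last, Fin.snoc_last]

/-- Finitely many distributions have a coupling, for instance the independent one. -/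
theorem exists_coupling {ι : Type*} [Finite ι] [Countable U] (κ : ι → PMF U) :
    ∃ ρ : PMF (ι → U), ∀ i, ρ.map (fun r => r i) = κ i := by
  classical
  have := Fintype.ofFinite ι
  let : MeasurableSpace U := ⊤
  have : MeasurableSingletonClass U := ⟨fun _ => trivial⟩
  let μ := MeasureTheory.Measure.pi fun i => (κ i).toMeasure
  have : MeasureTheory.IsProbabilityMeasure μ := by infer_instance
  refine ⟨μ.toPMF, fun i => ?_⟩
  apply PMF.toMeasure_injective
  rw [← PMF.toMeasure_map _ _ (measurable_pi_apply i), MeasureTheory.Measure.toPMF_toMeasure]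
  exact (MeasureTheory.measurePreserving_eval (fun i => (κ i).toMeasure) i).map_eq

/-- Randomizing once over decision trees is as good as randomizing at each time: an input law is
realized by a random decision tree that is drawn before the transmission. -/
theorem exists_random_tree [Finite Y] [Countable U] {N : ℕ} (K : InputLaw U Y N) :
    ∃ P : PMF (Tree U Y N), ∀ u y, P.map (fun τ => follow τ y) u = K.weight u y := by
  classical
  induction N with
  | zero =>
    refine ⟨PMF.pure (fun i => i.elim0), fun u y => ?_⟩
    rw [PMF.pure_map, PMF.pure_apply, if_pos (Subsingleton.elim _ _)]
    simp [InputLaw.weight]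
  | succ N ih =>
    obtain ⟨P, hP⟩ := ih (fun i => K i.castSucc)
    choose ρ hρ using fun τ : Tree U Y N =>
      exists_coupling (fun y : Fin N → Y => K (Fin.last N) (lastEntry (follow τ y)) y)
    refine ⟨P.bind fun τ => (ρ τ).map fun r => τ.snoc r, fun u y => ?_⟩
    obtain ⟨y, b, rfl⟩ : ∃ (y' : Fin N → Y) (b : Y), y = Fin.snoc y' b :=
      ⟨Fin.init y, y (Fin.last N), (Fin.snoc_init_self y).symm⟩
    obtain ⟨u, a, rfl⟩ : ∃ (u' : Fin N → U) (a : U), u = Fin.snoc u' a :=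
      ⟨Fin.init u, u (Fin.last N), (Fin.snoc_init_self u).symm⟩
    have e : (P.bind fun τ => (ρ τ).map fun r => τ.snoc r).map
        (fun τ => follow τ (Fin.snoc y b)) =
        (P.map fun τ => follow τ y).bind fun w =>
          (K (Fin.last N) (lastEntry w) y).map fun a => (Fin.snoc w a : Fin (N + 1) → U) := by
      rw [PMF.map_bind, PMF.bind_map]
      congr 1
      funext τ
      simp only [Function.comp_apply]
      rw [← hρ τ y, PMF.map_comp, PMF.map_comp]
      congr 1
      funext r
      exact follow_snoc τ r y b
    rw [e, weight_snoc, PMF.bind_apply, tsum_eq_single u, hP, PMF.map_apply, tsum_eq_single a]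
    · rw [if_pos rfl]
    · intro a' h
      refine if_neg fun h' => h ?_
      have := congrFun h' (Fin.last N)
      rw [Fin.snoc_last, Fin.snoc_last] at this
      exact this.symm
    · intro w h
      refine mul_eq_zero_of_right _ ?_
      rw [PMF.map_apply, ENNReal.tsum_eq_zero]
      refine fun a' => if_neg fun h' => h ?_
      have := congrArg Fin.init h'
      rw [Fin.init_snoc, Fin.init_snoc] at this
      exact this.symm

end Auxiliary

/-! ### Single-letter expressions and random decision trees -/

section Objective

open Classical in
/-- The joint law of `g τ`, `A` and `D` when `A` depends on `τ` and on a function of `D`, and `D` is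
produced from `g τ` by the kernel `W`. -/
theorem marginal_kernel_comp {T' T O α γ δ : Type*} (P : T' → ℝ≥0∞) (W : T → O → ℝ≥0∞)
    (g : T' → T) (D : O → δ) (c : δ → γ) (A : T' → γ → α) (t : T) (a : α) (d : δ) :
    marginal (fun ω : T' × O => P ω.1 * W (g ω.1) ω.2)
        (fun ω => (g ω.1, A ω.1 (c (D ω.2)), D ω.2)) (t, a, d) =
      (∑' τ, if g τ = t ∧ A τ (c d) = a then P τ else 0) * marginal (W t) D d := by
  unfold marginal
  rw [ENNReal.tsum_prod', ← ENNReal.tsum_mul_right]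
  refine tsum_congr fun τ => ?_
  rw [← ENNReal.tsum_mul_left]
  refine tsum_congr fun y => ?_
  by_cases h1 : g τ = t
  · subst h1
    by_cases h2 : D y = d
    · subst h2
      by_cases h3 : A τ (c (D y)) = a <;> simp [h3]
    · simp [h2]
  · simp [h1]

/-- If `A` is a function of a source `τ` and of `C`, and the law of the pair `(B, C)` given `τ`
depends on `g τ` only, then `A — (g τ, C) — B` is a Markov chain. -/
theorem markov_kernel {T' T O α β γ : Type*} (P : T' → ℝ≥0∞) (W : T → O → ℝ≥0∞)
    (g : T' → T) (B : O → β) (C : O → γ) (A : T' → γ → α) (a : α) (t : T) (b : β) (c : γ) :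
    let p := fun ω : T' × O => P ω.1 * W (g ω.1) ω.2
    marginal p (fun ω => (g ω.1, A ω.1 (C ω.2), B ω.2, C ω.2)) (t, a, b, c) *
          marginal p (fun ω => (g ω.1, C ω.2)) (t, c) =
        marginal p (fun ω => (g ω.1, A ω.1 (C ω.2), C ω.2)) (t, a, c) *
          marginal p (fun ω => (g ω.1, B ω.2, C ω.2)) (t, b, c) := by
  classical
  intro p
  have h1 := marginal_kernel_comp P W g (fun y => (B y, C y)) Prod.snd A t a (b, c)
  have h2 := marginal_kernel_comp P W g C id A t a c
  have h3 : ∀ {δ : Type _} (D : O → δ) (d : δ), marginal p (fun ω => (g ω.1, D ω.2)) (t, d) =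
      marginal P g t * marginal (W t) D d := by
    intro δ D d
    have h4 := marginal_kernel_comp P W g D (fun _ => ()) (fun _ _ => ()) t () d
    have h5 : marginal p (fun ω => (g ω.1, D ω.2)) (t, d) =
        marginal p (fun ω => (g ω.1, (), D ω.2)) (t, (), d) :=
      marginal_congr_iff _ _ _ _ _ fun ω => by simp
    rw [h5, h4]
    simp [marginal]
  have h4 : marginal p (fun ω => (g ω.1, B ω.2, C ω.2)) (t, b, c) =
      marginal P g t * marginal (W t) (fun y => (B y, C y)) (b, c) := by
    have h4 := marginal_kernel_comp P W g (fun y => (B y, C y)) (fun _ => ()) (fun _ _ => ())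
      t () (b, c)
    have h5 : marginal p (fun ω => (g ω.1, B ω.2, C ω.2)) (t, b, c) =
        marginal p (fun ω => (g ω.1, (), B ω.2, C ω.2)) (t, (), b, c) :=
      marginal_congr_iff _ _ _ _ _ fun ω => by simp
    rw [h5, h4]
    simp [marginal]
  rw [h4, h3 C c]
  simp only [id] at h2
  rw [h1, h2]
  ring

/-- The Markov property of `d A' — (A', C) — B`, for a function `d` of `A'`. -/
theorem markov_function {Ω α α' β γ : Type*} (p : Ω → ℝ≥0∞) (A' : Ω → α') (B : Ω → β) (C : Ω → γ)
    (d : α' → α) (a : α) (a' : α') (b : β) (c : γ) :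
    marginal p (fun ω => (A' ω, d (A' ω), B ω, C ω)) (a', a, b, c) *
          marginal p (fun ω => (A' ω, C ω)) (a', c) =
        marginal p (fun ω => (A' ω, d (A' ω), C ω)) (a', a, c) *
          marginal p (fun ω => (A' ω, B ω, C ω)) (a', b, c) := by
  classical
  by_cases h : d a' = a
  · subst h
    rw [marginal_congr_iff p (fun ω => (A' ω, d (A' ω), B ω, C ω)) (fun ω => (A' ω, B ω, C ω))
        (a', d a', b, c) (a', b, c) (fun ω => by simp; rintro rfl; simp),
      marginal_congr_iff p (fun ω => (A' ω, d (A' ω), C ω)) (fun ω => (A' ω, C ω))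
        (a', d a', c) (a', c) (fun ω => by simp; rintro rfl; simp), mul_comm]
  · have h1 : marginal p (fun ω => (A' ω, d (A' ω), B ω, C ω)) (a', a, b, c) = 0 :=
      ENNReal.tsum_eq_zero.2 fun ω => if_neg fun h' => by
        simp only [Prod.mk.injEq] at h'
        exact h (h'.1 ▸ h'.2.1)
    have h2 : marginal p (fun ω => (A' ω, d (A' ω), C ω)) (a', a, c) = 0 :=
      ENNReal.tsum_eq_zero.2 fun ω => if_neg fun h' => by
        simp only [Prod.mk.injEq] at h'
        exact h (h'.1 ▸ h'.2.1)
    rw [h1, h2, zero_mul, zero_mul]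

variable {X Y S U : Type*}

/-- The input law that draws a decision tree once, at the first time, stores it in the auxiliary
symbol by means of `mk`, reads it off the preceding symbol by means of `dec`, and follows it. -/
def storedTreeLaw {N : ℕ} (P : PMF (Tree (S → X) Y N)) (mk : Tree (S → X) Y N → (S → X) → U)
    (dec : U → Tree (S → X) Y N) : InputLaw U Y N
  | i, none, c => P.map fun t => mk t (t i c)
  | i, some u, c => PMF.pure (mk (dec u) (dec u i c))

/-- The symbols that the stored tree prescribes along `y` have the causally conditioned law of
`storedTreeLaw`. -/
theorem storedTreeLaw_weight {N : ℕ} (hN : 0 < N) (P : PMF (Tree (S → X) Y N))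
    (mk : Tree (S → X) Y N → (S → X) → U) (dec : U → Tree (S → X) Y N)
    (hdec : ∀ t v, dec (mk t v) = t) (u : Fin N → U) (y : Fin N → Y) :
    P.map (fun t i => mk t (follow t y i)) u = (storedTreeLaw P mk dec).weight u y := by
  classical
  -- the first symbol determines the tree
  set t₀ := dec (u ⟨0, hN⟩) with ht₀
  have hL : P.map (fun t i => mk t (follow t y i)) u =
      if u = (fun i => mk t₀ (follow t₀ y i)) then P t₀ else 0 := by
    rw [PMF.map_apply, tsum_eq_single t₀]
    · split_ifs <;> rfl
    · intro t ht
      refine if_neg fun h => ht ?_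
      rw [ht₀, h, hdec]
  rw [hL]
  unfold InputLaw.weight
  split_ifs with h
  · have hu : ∀ i, u i = mk t₀ (follow t₀ y i) := fun i => congrFun h i
    rw [Finset.prod_eq_single ⟨0, hN⟩]
    · have h1 : prev u ⟨0, hN⟩ = none := dif_pos rfl
      rw [h1]
      simp only [storedTreeLaw]
      rw [PMF.map_apply, tsum_eq_single t₀]
      · rw [if_pos]
        exact hu _
      · intro t ht
        refine if_neg fun h => ht ?_
        rw [ht₀, h, hdec]
    · intro i _ hi
      have hi' : ¬ (i : ℕ) = 0 := fun h => hi (Fin.ext h)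
      have h1 : prev u i = some (u ⟨(i : ℕ) - 1, by omega⟩) := dif_neg hi'
      rw [h1]
      simp only [storedTreeLaw]
      rw [hu ⟨(i : ℕ) - 1, _⟩, hdec, hu i, PMF.pure_apply]
      exact if_pos rfl
    · exact fun h => absurd (Finset.mem_univ _) h
  · -- the first symbol that deviates from the stored tree has probability zero
    have hex : ∃ j : ℕ, ∃ hj : j < N, u ⟨j, hj⟩ ≠ mk t₀ (follow t₀ y ⟨j, hj⟩) := by
      by_contra hcon
      push Not at hcon
      exact h (funext fun i => hcon i i.isLt)
    obtain ⟨j, ⟨hj, hne⟩, hmin⟩ : ∃ j : ℕ,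
        (∃ hj : j < N, u ⟨j, hj⟩ ≠ mk t₀ (follow t₀ y ⟨j, hj⟩)) ∧
          ∀ j' < j, ¬ ∃ hj' : j' < N, u ⟨j', hj'⟩ ≠ mk t₀ (follow t₀ y ⟨j', hj'⟩) :=
      ⟨Nat.find hex, Nat.find_spec hex, fun _ => Nat.find_min hex⟩
    push Not at hmin
    symm
    refine Finset.prod_eq_zero (Finset.mem_univ ⟨j, hj⟩) ?_
    by_cases h0 : j = 0
    · have h1 : prev u ⟨j, hj⟩ = none := dif_pos h0
      rw [h1]
      simp only [storedTreeLaw]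
      rw [PMF.map_apply]
      refine ENNReal.tsum_eq_zero.2 fun t => if_neg fun h2 => hne ?_
      have h3 : t₀ = t := by
        rw [ht₀]
        have : (⟨0, hN⟩ : Fin N) = ⟨j, hj⟩ := Fin.ext h0.symm
        rw [this, h2, hdec]
      rw [h2, h3]
      rfl
    · have h1 : prev u ⟨j, hj⟩ = some (u ⟨j - 1, by omega⟩) := dif_neg h0
      rw [h1]
      simp only [storedTreeLaw]
      rw [hmin (j - 1) (by omega) (by omega), hdec, PMF.pure_apply]
      exact if_neg hne

variable [Fintype S]

/-- The mutual information between a random decision tree with distribution `w` and the outputs. -/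
def treeInfo [Fintype Y] (ch : Channel X Y S) {N : ℕ} [Fintype (Tree (S → X) Y N)]
    (w : Tree (S → X) Y N → ℝ) : ℝ :=
  mutInfo w fun t y => (ch.treeLaw t y).toReal

/-- The joint law of a random source `τ`, which determines the decision tree `g τ`, and the
outputs. -/
def sourceLaw (ch : Channel X Y S) {T' : Type*} {N : ℕ} (P : PMF T')
    (g : T' → Tree (S → X) Y N) (ω : T' × (Fin N → Y)) : ℝ≥0∞ :=
  P ω.1 * ch.treeLaw (g ω.1) ω.2

theorem tsum_sourceLaw [Fintype Y] (ch : Channel X Y S) {T' : Type*} {N : ℕ} (P : PMF T')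
    (g : T' → Tree (S → X) Y N) : ∑' ω, sourceLaw ch P g ω = 1 := by
  unfold sourceLaw
  rw [ENNReal.tsum_prod']
  simp_rw [ENNReal.tsum_mul_left, tsum_fintype, sum_treeLaw, mul_one]
  exact P.tsum_coe

/-- If the symbols are functions `ψ τ y` of a random source `τ` and of the outputs, with the same
causally conditioned law as the input law `K`, then `(U, Y)` has the same law in both models, hence
so have the terms of the objective. -/
theorem condMutualInfo_jointProb_eq (ch : Channel X Y S) {T' : Type*} {N : ℕ} (P : PMF T')
    (g : T' → Tree (S → X) Y N) (f : U → S → X) (K : InputLaw U Y N)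
    (ψ : T' → (Fin N → Y) → Fin N → U) (hψ : ∀ τ y, (fun i => f (ψ τ y i)) = follow (g τ) y)
    (hK : ∀ u y, P.map (fun τ => ψ τ y) u = K.weight u y) (i : Fin N) :
    condMutualInfo (jointProb ch f K) (fun ω => (ω.2.2.2 i, prev ω.2.2.2 i))
        (fun ω => ω.2.2.1 i) (fun ω => past ω.2.2.1 i) =
      condMutualInfo (sourceLaw ch P g) (fun ω => (ψ ω.1 ω.2 i, prev (ψ ω.1 ω.2) i))
        (fun ω => ω.2 i) (fun ω => past ω.2 i) := by
  classical
  have h : marginal (jointProb ch f K) (fun ω => (ω.2.2.2, ω.2.2.1)) =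
      marginal (sourceLaw ch P g) (fun ω => (ψ ω.1 ω.2, ω.2)) := by
    funext ⟨u, y⟩
    rw [marginal_jointProb, ← hK, PMF.map_apply, ← ENNReal.tsum_mul_right]
    unfold marginal sourceLaw
    rw [ENNReal.tsum_prod']
    refine tsum_congr fun τ => ?_
    rw [tsum_eq_single y]
    · by_cases h : u = ψ τ y
      · subst h
        simp only [if_true, hψ]
        rfl
      · have h' : ψ τ y ≠ u := fun h' => h h'.symm
        simp [h, h']
    · intro y' h
      simp [h]
  have h1 := condMutualInfo_comp (jointProb ch f K) (fun ω => (ω.2.2.2, ω.2.2.1))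
    (fun v => (v.1 i, prev v.1 i)) (fun v => v.2 i) (fun v => past v.2 i)
  have h2 := condMutualInfo_comp (sourceLaw ch P g) (fun ω => (ψ ω.1 ω.2, ω.2))
    (fun v => (v.1 i, prev v.1 i)) (fun v => v.2 i) (fun v => past v.2 i)
  rw [h1, h2, h]

/-- The chain rule for the decision tree `g τ` and the outputs. -/
theorem sum_condMutualInfo_source [Fintype Y] (ch : Channel X Y S) {T' : Type*} {N : ℕ}
    [Fintype (Tree (S → X) Y N)] (P : PMF T') (g : T' → Tree (S → X) Y N) :
    ∑ i : Fin N, condMutualInfo (sourceLaw ch P g) (fun ω => g ω.1) (fun ω => ω.2 i)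
      (fun ω => past ω.2 i) = treeInfo ch fun t => (P.map g t).toReal := by
  classical
  have h : marginal (sourceLaw ch P g) (fun ω => (g ω.1, ω.2)) =
      fun ω : Tree (S → X) Y N × (Fin N → Y) => P.map g ω.1 * ch.treeLaw ω.1 ω.2 := by
    funext ⟨t, y⟩
    unfold marginal sourceLaw
    rw [ENNReal.tsum_prod', PMF.map_apply, ← ENNReal.tsum_mul_right]
    refine tsum_congr fun τ => ?_
    rw [tsum_eq_single y]
    · by_cases h : t = g τ
      · subst h
        simp
      · have h' : g τ ≠ t := fun h' => h h'.symm
        simp [h, h']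
    · intro y' h
      simp [h]
  unfold treeInfo
  rw [← sum_condMutualInfo_eq_mutInfo (fun t => P.map g t) _ ch.treeLaw (sum_treeLaw ch)]
  · refine Finset.sum_congr rfl fun i _ => ?_
    rw [← h, ← condMutualInfo_comp]
  · have := (P.map g).tsum_coe
    rwa [tsum_fintype] at this

/-- The objective of a first-order input law is at most the mutual information of some random
decision tree and the outputs. -/
theorem objective_le_treeInfo [Fintype Y] (ch : Channel X Y S) {N : ℕ} [Fintype (Tree (S → X) Y N)]
    [Countable U] (f : U → S → X) (K : InputLaw U Y N) :
    ∃ P : PMF (Tree (S → X) Y N), objective ch f K ≤ treeInfo ch fun t => (P t).toReal := by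
  obtain ⟨P, hP⟩ := exists_random_tree K
  let g : Tree U Y N → Tree (S → X) Y N := fun τ i c => f (τ i c)
  refine ⟨P.map g, ?_⟩
  rw [← sum_condMutualInfo_source]
  unfold objective
  refine Finset.sum_le_sum fun i _ => ?_
  rw [condMutualInfo_jointProb_eq ch P g f K (fun τ y => follow τ y) (fun _ _ => rfl) hP]
  refine condMutualInfo_le_of_markov (by rw [tsum_sourceLaw]; exact ENNReal.one_ne_top) _ _ _ _ ?_
  intro a a' b c
  exact markov_kernel (fun τ => P τ) ch.treeLaw g (fun y => y i) (fun y => past y i)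
    (fun τ c => (τ i c, if h : (i : ℕ) = 0 then none else
      some (τ ⟨(i : ℕ) - 1, by omega⟩ fun j => c ⟨j, by have : (j : ℕ) < i - 1 := j.isLt; omega⟩)))
    a a' b c

/-- Every random decision tree is realized by a first-order input law on a finite alphabet. -/
theorem exists_treeInfo_le_objective [Finite X] [Fintype Y] (ch : Channel X Y S) {N : ℕ}
    [Fintype (Tree (S → X) Y N)] (P : PMF (Tree (S → X) Y N)) :
    ∃ (k : ℕ) (f : Fin k → S → X) (K : InputLaw (Fin k) Y N),
      treeInfo ch (fun t => (P t).toReal) ≤ objective ch f K := by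
  obtain ⟨k, ⟨e⟩⟩ := Finite.exists_equiv_fin (Tree (S → X) Y N × (S → X))
  let mk : Tree (S → X) Y N → (S → X) → Fin k := fun t v => e (t, v)
  let dec : Fin k → Tree (S → X) Y N := fun u => (e.symm u).1
  let f : Fin k → S → X := fun u => (e.symm u).2
  have hdec : ∀ t v, dec (mk t v) = t := fun t v => by simp [mk, dec]
  have hf : ∀ t v, f (mk t v) = v := fun t v => by simp [mk, f]
  refine ⟨k, f, storedTreeLaw P mk dec, ?_⟩
  have h := sum_condMutualInfo_source ch P id
  rw [PMF.map_id] at h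
  rw [← h]
  unfold objective
  refine Finset.sum_le_sum fun i _ => ?_
  rw [condMutualInfo_jointProb_eq ch P id f (storedTreeLaw P mk dec)
    (fun t y i => mk t (follow t y i)) (fun t y => funext fun i => hf _ _)
    (storedTreeLaw_weight i.pos P mk dec hdec)]
  refine condMutualInfo_le_of_markov (by rw [tsum_sourceLaw]; exact ENNReal.one_ne_top) _ _ _ _ ?_
  intro a a' b c
  have := markov_function (sourceLaw ch P id)
    (fun ω => (mk ω.1 (follow ω.1 ω.2 i), prev (fun i => mk ω.1 (follow ω.1 ω.2 i)) i))
    (fun ω => ω.2 i) (fun ω => past ω.2 i) (fun a' => dec a'.1) a a' b c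
  simpa only [hdec, id] using this

/-- The maximum of the objective exists, and it is the maximal mutual information between a random
decision tree and the outputs. -/
theorem exists_isGreatest_objectiveValues [Finite X] [Nonempty X] [Fintype Y]
    (ch : Channel X Y S) (N : ℕ) [Fintype (Tree (S → X) Y N)] :
    ∃ w ∈ stdSimplex ℝ (Tree (S → X) Y N), IsGreatest (objectiveValues ch N) (treeInfo ch w) ∧
      ∀ w' ∈ stdSimplex ℝ (Tree (S → X) Y N), treeInfo ch w' ≤ treeInfo ch w := by
  classical
  have hne : (stdSimplex ℝ (Tree (S → X) Y N)).Nonempty :=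
    ⟨_, single_mem_stdSimplex ℝ (fun _ _ _ => Classical.arbitrary X)⟩
  obtain ⟨w, hw, hmax⟩ := (isCompact_stdSimplex ℝ (Tree (S → X) Y N)).exists_isMaxOn hne
    (continuousOn_mutInfo (W := fun t y => (ch.treeLaw t y).toReal)
      fun _ _ => ENNReal.toReal_nonneg)
  have hP : ∀ P : PMF (Tree (S → X) Y N),
      (fun t => (P t).toReal) ∈ stdSimplex ℝ (Tree (S → X) Y N) := fun P => by
    refine ⟨fun t => ENNReal.toReal_nonneg, ?_⟩
    have := P.tsum_coe
    rw [tsum_fintype] at this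
    rw [← ENNReal.toReal_sum fun t _ => P.apply_ne_top t, this, ENNReal.toReal_one]
  have hmax' : ∀ w' ∈ stdSimplex ℝ (Tree (S → X) Y N), treeInfo ch w' ≤ treeInfo ch w :=
    fun w' hw' => hmax hw'
  have hub : ∀ (V : Type) [Countable V] (f : V → S → X) (K : InputLaw V Y N),
      objective ch f K ≤ treeInfo ch w := by
    intro V _ f K
    obtain ⟨P, h⟩ := objective_le_treeInfo ch f K
    exact h.trans (hmax' _ (hP P))
  refine ⟨w, hw, ⟨?_, ?_⟩, hmax'⟩
  · let P : PMF (Tree (S → X) Y N) := PMF.ofFintype (fun t => ENNReal.ofReal (w t)) (by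
      rw [← ENNReal.ofReal_sum_of_nonneg fun t _ => hw.1 t, hw.2, ENNReal.ofReal_one])
    obtain ⟨k, f, K, h⟩ := exists_treeInfo_le_objective ch P
    have hPw : (fun t => (P t).toReal) = w := funext fun t => by
      simp [P, PMF.ofFintype_apply, ENNReal.toReal_ofReal (hw.1 t)]
    rw [hPw] at h
    exact ⟨Fin k, inferInstance, f, K, le_antisymm h (hub (Fin k) f K)⟩
  · rintro r ⟨V, _, f, K, rfl⟩
    exact hub V f K

end Objective

/-! ### The converse -/

section Converse

variable {X Y S : Type*}

/-- An encoder for a single message: at time `i + 1` it sees `s₀, …, s_i` and `y₁, …, y_i`. -/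
abbrev Encoder (X Y S : Type*) (n : ℕ) : Type _ :=
  (i : Fin n) → (Fin ((i : ℕ) + 1) → S) → (Fin (i : ℕ) → Y) → X

/-- The inputs that an encoder chooses along given state and output sequences. -/
def Encoder.inputs {n : ℕ} (e : Encoder X Y S n) (s : Fin (n + 1) → S) (y : Fin n → Y) :
    Fin n → X :=
  fun i => e i (statesUpTo s i) (past y i)

/-- The expectation of a function of the outputs under a code, with the inputs summed out. -/
theorem sum_jointProb [Fintype X] [Fintype Y] [Fintype S] (ch : Channel X Y S) {n k : ℕ}
    (c : Code X Y S n k) (m : Fin k) (φ : (Fin n → Y) → ℝ≥0∞) :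
    ∑' ω : (Fin (n + 1) → S) × (Fin n → X) × (Fin n → Y), c.jointProb ch m ω * φ ω.2.2 =
      ∑ s : Fin (n + 1) → S, ∑ y : Fin n → Y, ch.init (s 0) *
        ch.pathWeight (Encoder.inputs (fun i => c.enc i m) s y) s y * φ y := by
  classical
  rw [ENNReal.tsum_prod', tsum_fintype]
  refine Finset.sum_congr rfl fun s _ => ?_
  rw [ENNReal.tsum_prod', ENNReal.tsum_comm, tsum_fintype]
  refine Finset.sum_congr rfl fun y _ => ?_
  rw [tsum_eq_single (Encoder.inputs (fun i => c.enc i m) s y)]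
  · congr 1
    simp only [Code.jointProb, Channel.pathWeight, Encoder.inputs, if_true, one_mul]
  · intro x hne
    obtain ⟨i, hi⟩ := Function.ne_iff.1 hne
    simp only [Code.jointProb]
    rw [Finset.prod_eq_zero (Finset.mem_univ i), mul_zero, zero_mul]
    have hi' : ¬ x i = c.enc i m (statesUpTo s i) (past y i) := hi
    rw [if_neg hi', zero_mul]

theorem inputs_snoc {n : ℕ} (e : Encoder X Y S (n + 1)) (s : Fin (n + 1) → S) (c : S)
    (y : Fin n → Y) (b : Y) :
    e.inputs (Fin.snoc s c : Fin (n + 2) → S) (Fin.snoc y b : Fin (n + 1) → Y) =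
      Fin.snoc (Encoder.inputs (fun i => e i.castSucc) s y) (e (Fin.last n) s y) := by
  have h1 : ∀ i : Fin n, statesUpTo (Fin.snoc s c : Fin (n + 2) → S) i.castSucc =
      statesUpTo s i := fun i => by
    funext j
    exact Fin.snoc_castSucc (α := fun _ => S) c s ⟨j, by omega⟩
  have h2 : statesUpTo (Fin.snoc s c : Fin (n + 2) → S) (Fin.last n) = s := by
    funext j
    exact Fin.snoc_castSucc (α := fun _ => S) c s j
  funext i
  refine Fin.lastCases ?_ (fun i => ?_) i
  · rw [Fin.snoc_last]
    unfold Encoder.inputs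
    rw [past_snoc_last, h2]
  · rw [Fin.snoc_castSucc (α := fun _ => X)]
    unfold Encoder.inputs
    rw [past_snoc_castSucc, h1]

/-- A decision tree does at least as well as a given encoder that remembers all states: the input
at the last time may be chosen so as to minimize the conditional cost, which depends on the past
outputs and the current state only. -/
theorem exists_tree_le [Finite X] [Nonempty X] [Fintype Y] [Fintype S] (ch : Channel X Y S) {n : ℕ}
    (e : Encoder X Y S n) (φ : (Fin n → Y) → S → ℝ≥0∞) :
    ∃ t : Tree (S → X) Y n,
      ∑ s : Fin (n + 1) → S, ∑ y : Fin n → Y, ch.init (s 0) *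
          ch.pathWeight (fun i => follow t y i (s i.castSucc)) s y * φ y (s (Fin.last n)) ≤
        ∑ s : Fin (n + 1) → S, ∑ y : Fin n → Y, ch.init (s 0) *
          ch.pathWeight (e.inputs s y) s y * φ y (s (Fin.last n)) := by
  induction n with
  | zero =>
    refine ⟨fun i => i.elim0, le_of_eq ?_⟩
    simp [Channel.pathWeight]
  | succ n ih =>
    have hx : ∀ (y : Fin n → Y) (s : S), ∃ x : X, ∀ x',
        ∑ c, ∑ b, ch.trans x s (b, c) * φ (Fin.snoc y b) c ≤
          ∑ c, ∑ b, ch.trans x' s (b, c) * φ (Fin.snoc y b) c := fun y s =>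
      Finite.exists_min _
    choose r hr using hx
    obtain ⟨t, ht⟩ := ih (fun i => e i.castSucc)
      (fun y s => ∑ c, ∑ b, ch.trans (r y s) s (b, c) * φ (Fin.snoc y b) c)
    refine ⟨t.snoc r, ?_⟩
    have split : ∀ F : (Fin (n + 2) → S) → (Fin (n + 1) → Y) → ℝ≥0∞,
        ∑ s, ∑ y, F s y = ∑ s : Fin (n + 1) → S, ∑ y : Fin n → Y, ∑ c, ∑ b,
          F (Fin.snoc s c) (Fin.snoc y b) := by
      intro F
      rw [sum_snoc]
      refine Finset.sum_congr rfl fun s _ => ?_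
      simp_rw [sum_snoc (fun y => F _ y)]
      rw [Finset.sum_comm]
    rw [split, split]
    simp_rw [inputs_snoc, follow_snoc, snoc_apply_castSucc_family, pathWeight_snoc, snoc_apply_zero,
      Fin.snoc_last, ← mul_assoc, mul_assoc _ (ch.trans _ _ _) (φ _ _), ← Finset.mul_sum]
    refine ht.trans ?_
    exact Finset.sum_le_sum fun s _ => Finset.sum_le_sum fun y _ => mul_le_mul_right (hr y _ _) _

theorem errorProb_ne_top [Finite X] [Finite Y] [Finite S] (ch : Channel X Y S) {n k : ℕ}
    (hk : 0 < k) (c : Code X Y S n k) : c.errorProb ch ≠ ⊤ := by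
  classical
  have := Fintype.ofFinite X
  have := Fintype.ofFinite Y
  have := Fintype.ofFinite S
  unfold Code.errorProb
  refine ENNReal.mul_ne_top (ENNReal.inv_ne_top.2 (by exact_mod_cast hk.ne')) ?_
  refine ENNReal.sum_ne_top.2 fun m _ => ?_
  rw [tsum_fintype]
  refine ENNReal.sum_ne_top.2 fun ω _ => ?_
  split_ifs
  · refine ENNReal.mul_ne_top (ch.init.apply_ne_top _) (ENNReal.prod_ne_top fun i _ => ?_)
    refine ENNReal.mul_ne_top ?_ ((ch.trans _ _).apply_ne_top _)
    split_ifs <;> simp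
  · simp

/-- Fano's inequality, for codes whose encoders have been replaced by decision trees. The
distribution of trees is that of the tree of a uniformly distributed message. -/
theorem fano_le_treeInfo [Fintype X] [Nonempty X] [Fintype Y] [Fintype S] (ch : Channel X Y S)
    {n k : ℕ} [Fintype (Tree (S → X) Y n)] (hk : 0 < k) (c : Code X Y S n k) :
    ∃ w ∈ stdSimplex ℝ (Tree (S → X) Y n),
      (1 - (c.errorProb ch).toReal) * Real.logb 2 k - 1 ≤ treeInfo ch w := by
  classical
  have hk0 : (0 : ℝ) < k := by exact_mod_cast hk
  choose t ht using fun m : Fin k => exists_tree_le ch (fun i => c.enc i m)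
    (fun y _ => if c.dec y ≠ m then 1 else 0)
  have hW : ∀ m y, 0 ≤ (ch.treeLaw (t m) y).toReal := fun _ _ => ENNReal.toReal_nonneg
  have hWt : ∀ m y, ch.treeLaw (t m) y ≠ ⊤ := fun m y => by
    refine ne_top_of_le_ne_top ENNReal.one_ne_top ?_
    rw [← sum_treeLaw ch (t m)]
    exact Finset.single_le_sum (fun _ _ => zero_le) (Finset.mem_univ y)
  have hW1 : ∀ m, ∑ y, (ch.treeLaw (t m) y).toReal = 1 := fun m => by
    rw [← ENNReal.toReal_sum fun y _ => hWt m y, sum_treeLaw, ENNReal.toReal_one]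
  -- the average error probability of the decision trees
  have herr : (k : ℝ≥0∞)⁻¹ * ∑ m, ∑ y, ch.treeLaw (t m) y * (if c.dec y ≠ m then 1 else 0) ≤
      c.errorProb ch := by
    unfold Code.errorProb
    gcongr with m
    have e1 := sum_jointProb ch c m (fun y => if c.dec y ≠ m then 1 else 0)
    calc ∑ y, ch.treeLaw (t m) y * (if c.dec y ≠ m then 1 else 0) = _ := by
          unfold Channel.treeLaw Channel.outputLaw
          simp_rw [Finset.sum_mul]
          exact Finset.sum_comm
      _ ≤ _ := ht m
      _ = _ := e1.symm
      _ ≤ _ := ENNReal.tsum_le_tsum fun ω => by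
          by_cases h : c.dec ω.2.2 = m <;> simp [h]
  have hPtop : c.errorProb ch ≠ ⊤ := errorProb_ne_top ch hk c
  let w : Tree (S → X) Y n → ℝ := fun τ => ∑ m, if t m = τ then (1 / k : ℝ) else 0
  have hsum : ∀ F : Tree (S → X) Y n → ℝ, ∑ τ, w τ * F τ = ∑ m, (1 / k : ℝ) * F (t m) := by
    intro F
    simp only [w, Finset.sum_mul]
    rw [Finset.sum_comm]
    refine Finset.sum_congr rfl fun m _ => ?_
    simp [ite_mul]
  refine ⟨w, ⟨fun τ => Finset.sum_nonneg fun m _ => by split_ifs <;> positivity, ?_⟩, ?_⟩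
  · have := hsum fun _ => 1
    simp only [mul_one] at this
    rw [this]
    simp [hk0.ne']
  · have hmut : treeInfo ch w = mutInfo (fun _ : Fin k => (1 / k : ℝ))
        (fun m y => (ch.treeLaw (t m) y).toReal) := by
      unfold treeInfo mutInfo
      simp_rw [hsum fun τ => (ch.treeLaw τ _).toReal, mul_assoc, ← Finset.mul_sum]
      exact (hsum _).trans (by rw [Finset.mul_sum])
    rw [hmut]
    -- the guess of the posterior: half of the mass on the decoded message, half spread uniformly
    have key := le_mutInfo (w := fun _ : Fin k => (1 / k : ℝ))
      (W := fun m y => (ch.treeLaw (t m) y).toReal) (fun _ => by positivity)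
      (by simp [hk0.ne']) hW hW1
      (fun m y => if c.dec y = m then 1 / 2 else 1 / (2 * k))
      (fun m y => by split_ifs <;> positivity)
      (fun y => by
        calc ∑ m, (if c.dec y = m then (1 / 2 : ℝ) else 1 / (2 * k)) ≤
              ∑ m : Fin k, ((if c.dec y = m then (1 / 2 : ℝ) else 0) + 1 / (2 * k)) :=
              Finset.sum_le_sum fun m _ => by
                have : (0 : ℝ) ≤ 1 / (2 * k) := by positivity
                split_ifs <;> linarith
          _ = 1 := by
              rw [Finset.sum_add_distrib]
              simp only [Finset.sum_ite_eq, Finset.mem_univ, if_true, Finset.sum_const,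
                Finset.card_univ, Fintype.card_fin, nsmul_eq_mul]
              field_simp
              norm_num)
    refine le_trans ?_ key
    have hlogk : 0 ≤ Real.logb 2 k := Real.logb_nonneg (by norm_num) (by exact_mod_cast hk)
    have hlog : ∀ m y, Real.logb 2 ((if c.dec y = m then (1 / 2 : ℝ) else 1 / (2 * k)) / (1 / k)) =
        Real.logb 2 k - 1 - (if c.dec y ≠ m then 1 else 0) * Real.logb 2 k := by
      intro m y
      by_cases h : c.dec y = m
      · rw [if_pos h, if_neg (by simpa using h), show (1 / 2 : ℝ) / (1 / k) = k / 2 by field_simp,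
          Real.logb_div hk0.ne' (by norm_num), Real.logb_self_eq_one (by norm_num)]
        ring
      · rw [if_neg h, if_pos h, show (1 / (2 * k) : ℝ) / (1 / k) = 2⁻¹ by field_simp,
          Real.logb_inv, Real.logb_self_eq_one (by norm_num)]
        ring
    have hE : ∑ m, ∑ y, (1 / k : ℝ) * (ch.treeLaw (t m) y).toReal * (if c.dec y ≠ m then 1 else 0) ≤
        (c.errorProb ch).toReal := by
      refine le_trans (le_of_eq ?_) (ENNReal.toReal_mono hPtop herr)
      rw [ENNReal.toReal_mul, ENNReal.toReal_sum, Finset.mul_sum]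
      · refine Finset.sum_congr rfl fun m _ => ?_
        rw [ENNReal.toReal_sum, Finset.mul_sum]
        · refine Finset.sum_congr rfl fun y _ => ?_
          rw [ENNReal.toReal_mul, ENNReal.toReal_inv, ENNReal.toReal_natCast, mul_assoc, one_div]
          split_ifs <;> simp
        · exact fun y _ => ENNReal.mul_ne_top (hWt m y) (by split_ifs <;> simp)
      · exact fun m _ => ENNReal.sum_ne_top.2 fun y _ =>
          ENNReal.mul_ne_top (hWt m y) (by split_ifs <;> simp)
    have h1 : ∑ m : Fin k, ∑ y, (1 / k : ℝ) * (ch.treeLaw (t m) y).toReal = 1 := by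
      simp_rw [← Finset.mul_sum, hW1]
      simp [hk0.ne']
    simp_rw [hlog, mul_sub, Finset.sum_sub_distrib, ← mul_assoc, ← Finset.sum_mul, h1]
    nlinarith [mul_le_mul_of_nonneg_right hE hlogk]

end Converse

/-! ### Strategies -/

section Strategies

variable {X Y S : Type*}

/-- A strategy of unlimited length for a single message: it chooses an input from the list of past
states and outputs (oldest first) and the current state. -/
abbrev Strategy (X Y S : Type*) : Type _ := List (S × Y) → S → X

/-- The continuation of a strategy after a first state and output. -/
def Strategy.shift (σ : Strategy X Y S) (p : S × Y) : Strategy X Y S := fun h s => σ (p :: h) s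

/-- Follow `σ` for `n` steps, then forget the past and follow `σ'`. -/
def Strategy.switch (σ' : Strategy X Y S) : ℕ → Strategy X Y S → Strategy X Y S
  | 0, _ => σ'
  | n + 1, σ => fun h s =>
    match h with
    | [] => σ [] s
    | p :: h => Strategy.switch σ' n (σ.shift p) h s

/-- The first `n` steps of a strategy, as an encoder. -/
def Strategy.encoder (σ : Strategy X Y S) (n : ℕ) : Encoder X Y S n :=
  fun i s y => σ (List.ofFn fun j : Fin i => (s j.castSucc, y j)) (s (Fin.last i))

theorem inputs_cons (σ : Strategy X Y S) {n : ℕ} (s : S) (s' : Fin (n + 1) → S) (b : Y)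
    (y : Fin n → Y) :
    (σ.encoder (n + 1)).inputs (Fin.cons s s' : Fin (n + 2) → S) (Fin.cons b y : Fin (n + 1) → Y) =
      Fin.cons (σ [] s) (((σ.shift (s, b)).encoder n).inputs s' y) := by
  funext i
  refine Fin.cases ?_ (fun i => ?_) i
  · rfl
  · rw [Fin.cons_succ]
    unfold Encoder.inputs Strategy.encoder Strategy.shift
    change σ (List.ofFn (n := (i : ℕ) + 1) fun j =>
      (statesUpTo (Fin.cons s s' : Fin (n + 2) → S) i.succ j.castSucc,
        past (Fin.cons b y : Fin (n + 1) → Y) i.succ j)) _ = _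
    rw [List.ofFn_succ]
    rfl

theorem pathWeight_cons (ch : Channel X Y S) {n : ℕ} (a : X) (x : Fin n → X) (s : S)
    (s' : Fin (n + 1) → S) (b : Y) (y : Fin n → Y) :
    ch.pathWeight (Fin.cons a x : Fin (n + 1) → X) (Fin.cons s s' : Fin (n + 2) → S)
      (Fin.cons b y : Fin (n + 1) → Y) = ch.trans a s (b, s' 0) * ch.pathWeight x s' y := by
  unfold Channel.pathWeight
  rw [Fin.prod_univ_succ]
  rfl

/-- A decision tree as a strategy; the inputs after the end of the tree are arbitrary. -/
def treeStrategy [Nonempty X] {N : ℕ} (t : Tree (S → X) Y N) : Strategy X Y S := fun h s =>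
  if hl : h.length < N then t ⟨h.length, hl⟩ (fun j => (h.get j).2) s else Classical.arbitrary X

theorem encoder_treeStrategy [Nonempty X] {N : ℕ} (t : Tree (S → X) Y N) (s : Fin (N + 1) → S)
    (y : Fin N → Y) :
    ((treeStrategy t).encoder N).inputs s y = fun i => follow t y i (s i.castSucc) := by
  have key : ∀ (i : Fin N) (h : List (S × Y)) (hl : h.length = i) (c : Fin (i : ℕ) → Y) (s : S),
      (∀ j : Fin i, (h.get (j.cast hl.symm)).2 = c j) → treeStrategy t h s = t i c s := by
    rintro ⟨i, hi⟩ h hl c s hc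
    obtain rfl : h.length = i := hl
    unfold treeStrategy
    rw [dif_pos hi]
    congr 1
    funext j
    exact hc j
  funext i
  refine key i _ (List.length_ofFn) (past y i) _ fun j => ?_
  simp

variable [Fintype Y] [Fintype S]

/-- The expected value of a function of the first `n` outputs and of the state after them, when
the strategy `σ` is followed from the state `s` on. -/
def Channel.expect (ch : Channel X Y S) : ℕ → Strategy X Y S → S → (List Y → S → ℝ) → ℝ
  | 0, _, s, φ => φ [] s
  | n + 1, σ, s, φ => ∑ y, ∑ s', (ch.trans (σ [] s) s (y, s')).toReal *
      ch.expect n (σ.shift (s, y)) s' fun ys => φ (y :: ys)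

theorem sum_trans_toReal (ch : Channel X Y S) (x : X) (s : S) :
    ∑ y, ∑ s', (ch.trans x s (y, s')).toReal = 1 := by
  rw [← Fintype.sum_prod_type (f := fun p => (ch.trans x s p).toReal),
    ← ENNReal.toReal_sum fun p _ => (ch.trans x s).apply_ne_top p]
  have := (ch.trans x s).tsum_coe
  rw [tsum_fintype] at this
  rw [this, ENNReal.toReal_one]

theorem expect_mono (ch : Channel X Y S) (n : ℕ) (σ : Strategy X Y S) (s : S)
    {φ ψ : List Y → S → ℝ} (h : ∀ ys s', ys.length = n → φ ys s' ≤ ψ ys s') :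
    ch.expect n σ s φ ≤ ch.expect n σ s ψ := by
  induction n generalizing σ s φ ψ with
  | zero => exact h [] s rfl
  | succ n ih =>
    refine Finset.sum_le_sum fun y _ => Finset.sum_le_sum fun s' _ =>
      mul_le_mul_of_nonneg_left ?_ ENNReal.toReal_nonneg
    exact ih _ _ fun ys s'' hl => h _ _ (by simp [hl])

theorem expect_congr (ch : Channel X Y S) (n : ℕ) (σ : Strategy X Y S) (s : S)
    {φ ψ : List Y → S → ℝ} (h : ∀ ys s', ys.length = n → φ ys s' = ψ ys s') :
    ch.expect n σ s φ = ch.expect n σ s ψ :=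
  le_antisymm (expect_mono ch n σ s fun ys s' hl => (h ys s' hl).le)
    (expect_mono ch n σ s fun ys s' hl => (h ys s' hl).ge)

theorem expect_const (ch : Channel X Y S) (n : ℕ) (σ : Strategy X Y S) (s : S) (c : ℝ) :
    ch.expect n σ s (fun _ _ => c) = c := by
  induction n generalizing σ s with
  | zero => rfl
  | succ n ih =>
    simp only [Channel.expect, ih]
    simp_rw [← Finset.sum_mul, sum_trans_toReal, one_mul]

theorem expect_add (ch : Channel X Y S) (n : ℕ) (σ : Strategy X Y S) (s : S)
    (φ ψ : List Y → S → ℝ) :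
    ch.expect n σ s (fun ys s' => φ ys s' + ψ ys s') =
      ch.expect n σ s φ + ch.expect n σ s ψ := by
  induction n generalizing σ s φ ψ with
  | zero => rfl
  | succ n ih =>
    simp only [Channel.expect, ih, mul_add, Finset.sum_add_distrib]

theorem expect_const_mul (ch : Channel X Y S) (n : ℕ) (σ : Strategy X Y S) (s : S) (c : ℝ)
    (φ : List Y → S → ℝ) :
    ch.expect n σ s (fun ys s' => c * φ ys s') = c * ch.expect n σ s φ := by
  induction n generalizing σ s φ with
  | zero => rfl
  | succ n ih =>
    simp only [Channel.expect, ih, Finset.mul_sum]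
    exact Finset.sum_congr rfl fun y _ => Finset.sum_congr rfl fun s' _ => by ring

theorem expect_sum (ch : Channel X Y S) (n : ℕ) (σ : Strategy X Y S) (s : S) {ι : Type*}
    (I : Finset ι) (φ : ι → List Y → S → ℝ) :
    ch.expect n σ s (fun ys s' => ∑ i ∈ I, φ i ys s') = ∑ i ∈ I, ch.expect n σ s (φ i) := by
  classical
  induction I using Finset.induction_on with
  | empty => simpa using expect_const ch n σ s 0
  | insert a I ha ih =>
    simp_rw [Finset.sum_insert ha]
    rw [expect_add, ih]

/-- A function of the first `n` outputs has the same mean whether or not the transmission goes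
on. -/
theorem expect_take (ch : Channel X Y S) (n m : ℕ) (σ : Strategy X Y S) (s : S)
    (φ : List Y → ℝ) :
    ch.expect (n + m) σ s (fun ys _ => φ (ys.take n)) = ch.expect n σ s fun ys _ => φ ys := by
  induction n generalizing σ s φ with
  | zero =>
    simp only [List.take_zero]
    rw [expect_const]
    rfl
  | succ n ih =>
    rw [Nat.succ_add]
    simp only [Channel.expect, List.take_succ_cons]
    exact Finset.sum_congr rfl fun y _ => Finset.sum_congr rfl fun s' _ => by
      rw [ih (σ.shift (s, y)) s' (fun ys => φ (y :: ys))]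

/-- The Markov property at the time `n`, when the strategy forgets the past. -/
theorem expect_switch (ch : Channel X Y S) (n m : ℕ) (σ σ' : Strategy X Y S) (s : S)
    (φ : List Y → S → ℝ) :
    ch.expect (n + m) (σ'.switch n σ) s φ =
      ch.expect n σ s fun ys s' => ch.expect m σ' s' fun zs => φ (ys ++ zs) := by
  induction n generalizing σ s φ with
  | zero =>
    rw [Nat.zero_add]
    rfl
  | succ n ih =>
    rw [Nat.succ_add]
    refine Finset.sum_congr rfl fun y _ => Finset.sum_congr rfl fun s' _ => ?_
    congr 1
    exact ih (σ.shift (s, y)) s' (fun ys => φ (y :: ys))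

/-- The recursive definition of `expect` agrees with the sum over all paths. -/
theorem expect_eq_sum (ch : Channel X Y S) (n : ℕ) (σ : Strategy X Y S) (s : S)
    (φ : List Y → S → ℝ) :
    ch.expect n σ s φ = ∑ s' : Fin n → S, ∑ y : Fin n → Y,
      (ch.pathWeight ((σ.encoder n).inputs (Fin.cons s s' : Fin (n + 1) → S) y)
        (Fin.cons s s') y).toReal *
        φ (List.ofFn y) ((Fin.cons s s' : Fin (n + 1) → S) (Fin.last n)) := by
  induction n generalizing σ s φ with
  | zero =>
    simp [Channel.expect, Channel.pathWeight]
  | succ n ih =>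
    rw [sum_cons]
    simp_rw [sum_cons (fun y : Fin (n + 1) → Y => _), inputs_cons, pathWeight_cons,
      ENNReal.toReal_mul, Fin.cons_zero, List.ofFn_cons, ← Fin.succ_last, Fin.cons_succ]
    simp only [Channel.expect, ih]
    rw [Finset.sum_comm]
    refine Finset.sum_congr rfl fun s₁ _ => ?_
    rw [Finset.sum_comm]
    refine Finset.sum_congr rfl fun b _ => ?_
    rw [Finset.mul_sum]
    refine Finset.sum_congr rfl fun s' _ => ?_
    rw [Finset.mul_sum]
    refine Finset.sum_congr rfl fun y _ => ?_
    ring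

/-- The code that assigns a strategy to each message. -/
def strategyCode {n k : ℕ} (σ : Fin k → Strategy X Y S) (d : List Y → Fin k) : Code X Y S n k where
  enc i m := (σ m).encoder n i
  dec y := d (List.ofFn y)

open Classical in
theorem errorProb_strategyCode [Finite X] (ch : Channel X Y S) {n k : ℕ}
    (σ : Fin k → Strategy X Y S) (d : List Y → Fin k) :
    ((strategyCode (n := n) σ d).errorProb ch).toReal = (1 / k : ℝ) * ∑ m, ∑ s, (ch.init s).toReal *
      ch.expect n (σ m) s fun ys _ => if d ys ≠ m then 1 else 0 := by
  have := Fintype.ofFinite X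
  unfold Code.errorProb
  have hpw : ∀ x s y, ch.pathWeight (N := n) x s y ≠ ⊤ := fun x s y =>
    ENNReal.prod_ne_top fun i _ => (ch.trans _ _).apply_ne_top _
  have h : ∀ m, (∑' ω : (Fin (n + 1) → S) × (Fin n → X) × (Fin n → Y),
      if (strategyCode (n := n) σ d).dec ω.2.2 ≠ m
        then (strategyCode (n := n) σ d).jointProb ch m ω else 0) =
      ∑ s : Fin (n + 1) → S, ∑ y : Fin n → Y, ch.init (s 0) *
        ch.pathWeight (((σ m).encoder n).inputs s y) s y *
          if d (List.ofFn y) ≠ m then 1 else 0 := by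
    intro m
    refine Eq.trans (tsum_congr fun ω => ?_) (sum_jointProb ch (strategyCode (n := n) σ d) m
      fun y => if d (List.ofFn y) ≠ m then 1 else 0)
    by_cases h : d (List.ofFn ω.2.2) = m <;> simp [h, strategyCode]
  have hfin : ∀ (m : Fin k) (s : Fin (n + 1) → S) (y : Fin n → Y), ch.init (s 0) *
        ch.pathWeight (((σ m).encoder n).inputs s y) s y *
          (if d (List.ofFn y) ≠ m then 1 else 0) ≠ ⊤ := fun m s y =>
    ENNReal.mul_ne_top (ENNReal.mul_ne_top (ch.init.apply_ne_top _) (hpw _ _ _))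
      (by split_ifs <;> simp)
  rw [Finset.sum_congr rfl fun m _ => h m, ENNReal.toReal_mul, ENNReal.toReal_inv,
    ENNReal.toReal_natCast, one_div,
    ENNReal.toReal_sum fun m _ => ENNReal.sum_ne_top.2 fun s _ => ENNReal.sum_ne_top.2
      fun y _ => hfin m s y]
  congr 1
  refine Finset.sum_congr rfl fun m _ => ?_
  rw [ENNReal.toReal_sum fun s _ => ENNReal.sum_ne_top.2 fun y _ => hfin m s y, sum_cons]
  refine Finset.sum_congr rfl fun s₀ _ => ?_
  rw [expect_eq_sum, Finset.mul_sum]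
  refine Finset.sum_congr rfl fun s _ => ?_
  rw [ENNReal.toReal_sum fun y _ => hfin m _ y, Finset.mul_sum]
  refine Finset.sum_congr rfl fun y _ => ?_
  rw [ENNReal.toReal_mul, ENNReal.toReal_mul, Fin.cons_zero, mul_assoc]
  split_ifs <;> simp

/-- The channel with a deterministic initial state. -/
def Channel.startAt (ch : Channel X Y S) (s : S) : Channel X Y S where
  trans := ch.trans
  init := PMF.pure s

theorem expect_treeStrategy [Nonempty X] (ch : Channel X Y S) {N : ℕ} (t : Tree (S → X) Y N)
    (s : S) (φ : List Y → ℝ) :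
    ch.expect N (treeStrategy t) s (fun ys _ => φ ys) =
      ∑ y : Fin N → Y, ((ch.startAt s).treeLaw t y).toReal * φ (List.ofFn y) := by
  classical
  have hpw : ∀ x s y, ch.pathWeight (N := N) x s y ≠ ⊤ := fun x s y =>
    ENNReal.prod_ne_top fun i _ => (ch.trans _ _).apply_ne_top _
  rw [expect_eq_sum, Finset.sum_comm]
  refine Finset.sum_congr rfl fun y _ => ?_
  rw [← Finset.sum_mul]
  congr 1
  unfold Channel.treeLaw Channel.outputLaw
  rw [sum_cons, Finset.sum_eq_single s]
  · rw [ENNReal.toReal_sum]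
    · refine Finset.sum_congr rfl fun s' _ => ?_
      rw [encoder_treeStrategy]
      simp [Channel.startAt, Channel.pathWeight]
    · intro s' _
      exact ENNReal.mul_ne_top ((ch.startAt s).init.apply_ne_top _) (hpw _ _ _)
  · intro s₁ _ h
    refine Finset.sum_eq_zero fun s' _ => ?_
    simp [Channel.startAt, h]
  · exact fun h => absurd (Finset.mem_univ _) h

/-- The output law is the mixture of the output laws for deterministic initial states. -/
theorem treeLaw_toReal_eq_sum (ch : Channel X Y S) {N : ℕ} (t : Tree (S → X) Y N)
    (y : Fin N → Y) :
    (ch.treeLaw t y).toReal = ∑ s, (ch.init s).toReal * ((ch.startAt s).treeLaw t y).toReal := by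
  classical
  have h : ch.treeLaw t y = ∑ s, ch.init s * (ch.startAt s).treeLaw t y := by
    unfold Channel.treeLaw Channel.outputLaw
    simp_rw [Finset.mul_sum]
    rw [Finset.sum_comm]
    refine Finset.sum_congr rfl fun s' _ => ?_
    rw [Finset.sum_eq_single (s' 0)]
    · simp [Channel.startAt, Channel.pathWeight]
    · intro s _ h
      simp [Channel.startAt, Ne.symm h]
    · exact fun h => absurd (Finset.mem_univ _) h
  have h1 : ∀ s, (ch.startAt s).treeLaw t y ≠ ⊤ := fun s => by
    refine ne_top_of_le_ne_top ENNReal.one_ne_top ?_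
    rw [← sum_treeLaw (ch.startAt s) t]
    exact Finset.single_le_sum (fun _ _ => zero_le) (Finset.mem_univ y)
  rw [h, ENNReal.toReal_sum fun s _ => ENNReal.mul_ne_top (ch.init.apply_ne_top _) (h1 s)]
  simp_rw [ENNReal.toReal_mul]

end Strategies

/-! ### Driving the state to a target -/

section Drive

variable {X Y S : Type*} [Fintype Y] [Fintype S]

open Classical in
/-- The least probability, over all ways to choose the inputs, that the state `s₁` is not visited
at any of the times `0, …, d`, when the state at time `0` is `s`. -/
def Channel.missProb (ch : Channel X Y S) (s₁ : S) : ℕ → S → ℝ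
  | 0, s => if s = s₁ then 0 else 1
  | d + 1, s => if s = s₁ then 0 else
      ⨅ x : X, ∑ y, ∑ s', (ch.trans x s (y, s')).toReal * ch.missProb s₁ d s'

theorem missProb_self (ch : Channel X Y S) (s₁ : S) (d : ℕ) : ch.missProb s₁ d s₁ = 0 := by
  cases d <;> simp [Channel.missProb]

theorem sum_trans_mul_le (ch : Channel X Y S) (x : X) (s : S) (F : S → ℝ) (c : ℝ)
    (h : ∀ s', F s' ≤ c) : ∑ y, ∑ s', (ch.trans x s (y, s')).toReal * F s' ≤ c := by
  calc ∑ y, ∑ s', (ch.trans x s (y, s')).toReal * F s' ≤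
        ∑ y, ∑ s', (ch.trans x s (y, s')).toReal * c :=
        Finset.sum_le_sum fun y _ => Finset.sum_le_sum fun s' _ =>
          mul_le_mul_of_nonneg_left (h s') ENNReal.toReal_nonneg
    _ = c := by simp_rw [← Finset.sum_mul, sum_trans_toReal, one_mul]

variable [Finite X] [Nonempty X]

theorem exists_missProb_succ_eq (ch : Channel X Y S) (s₁ : S) (d : ℕ) (s : S) (h : s ≠ s₁) :
    ∃ x : X, ch.missProb s₁ (d + 1) s =
      ∑ y, ∑ s', (ch.trans x s (y, s')).toReal * ch.missProb s₁ d s' := by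
  simp only [Channel.missProb, if_neg h]
  obtain ⟨x, hx⟩ := exists_eq_ciInf_of_finite
    (f := fun x : X => ∑ y, ∑ s', (ch.trans x s (y, s')).toReal * ch.missProb s₁ d s')
  exact ⟨x, hx.symm⟩

theorem missProb_nonneg (ch : Channel X Y S) (s₁ : S) (d : ℕ) (s : S) :
    0 ≤ ch.missProb s₁ d s := by
  induction d generalizing s with
  | zero =>
    simp only [Channel.missProb]
    split_ifs <;> norm_num
  | succ d ih =>
    by_cases h : s = s₁
    · rw [h, missProb_self]
    · obtain ⟨x, hx⟩ := exists_missProb_succ_eq ch s₁ d s h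
      rw [hx]
      exact Finset.sum_nonneg fun y _ => Finset.sum_nonneg fun s' _ =>
        mul_nonneg ENNReal.toReal_nonneg (ih s')

theorem missProb_succ_le (ch : Channel X Y S) (s₁ : S) (d : ℕ) (s : S) (x : X) :
    ch.missProb s₁ (d + 1) s ≤
      ∑ y, ∑ s', (ch.trans x s (y, s')).toReal * ch.missProb s₁ d s' := by
  by_cases h : s = s₁
  · rw [h, missProb_self]
    exact Finset.sum_nonneg fun y _ => Finset.sum_nonneg fun s' _ =>
        mul_nonneg ENNReal.toReal_nonneg (missProb_nonneg ch s₁ d s')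
  · simp only [Channel.missProb, if_neg h]
    exact ciInf_le (Set.finite_range _).bddBelow x

theorem missProb_le_one (ch : Channel X Y S) (s₁ : S) (d : ℕ) (s : S) :
    ch.missProb s₁ d s ≤ 1 := by
  induction d generalizing s with
  | zero =>
    simp only [Channel.missProb]
    split_ifs <;> norm_num
  | succ d ih =>
    exact (missProb_succ_le ch s₁ d s (Classical.arbitrary X)).trans
      (sum_trans_mul_le ch _ s _ 1 ih)

theorem missProb_succ_le_self (ch : Channel X Y S) (s₁ : S) (d : ℕ) (s : S) :
    ch.missProb s₁ (d + 1) s ≤ ch.missProb s₁ d s := by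
  induction d generalizing s with
  | zero =>
    by_cases h : s = s₁
    · rw [h, missProb_self, missProb_self]
    · refine (missProb_le_one ch s₁ _ s).trans ?_
      simp [Channel.missProb, h]
  | succ d ih =>
    by_cases h : s = s₁
    · rw [h, missProb_self, missProb_self]
    · obtain ⟨x, hx⟩ := exists_missProb_succ_eq ch s₁ d s h
      rw [hx]
      exact (missProb_succ_le ch s₁ (d + 1) s x).trans (Finset.sum_le_sum fun y _ =>
        Finset.sum_le_sum fun s' _ => mul_le_mul_of_nonneg_left (ih s') ENNReal.toReal_nonneg)

theorem missProb_antitone (ch : Channel X Y S) (s₁ s : S) :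
    Antitone fun d => ch.missProb s₁ d s :=
  antitone_nat_of_succ_le fun d => missProb_succ_le_self ch s₁ d s

/-- Missing the target in `d + j` steps means to miss it in `j` steps, and then again in `d`. -/
theorem missProb_add_le (ch : Channel X Y S) (s₁ : S) (d : ℕ) (c : ℝ)
    (h : ∀ s, ch.missProb s₁ d s ≤ c) (j : ℕ) (s : S) :
    ch.missProb s₁ (d + j) s ≤ c * ch.missProb s₁ j s := by
  induction j generalizing s with
  | zero =>
    by_cases hs : s = s₁
    · rw [hs, missProb_self, missProb_self, mul_zero]
    · simpa [Channel.missProb, hs] using h s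
  | succ j ih =>
    by_cases hs : s = s₁
    · rw [hs, missProb_self, missProb_self, mul_zero]
    · obtain ⟨x, hx⟩ := exists_missProb_succ_eq ch s₁ j s hs
      rw [hx, Finset.mul_sum]
      refine (missProb_succ_le ch s₁ (d + j) s x).trans (Finset.sum_le_sum fun y _ => ?_)
      rw [Finset.mul_sum]
      refine Finset.sum_le_sum fun s' _ => ?_
      refine (mul_le_mul_of_nonneg_left (ih s') ENNReal.toReal_nonneg).trans_eq ?_
      ring

/-- No policy that is based on the current state does better than `missProb`. -/
theorem missProb_le_sum_stateLaw (ch : Channel X Y S) (s₁ : S) (P : ℕ → S → PMF X) (s : S)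
    (i j : ℕ) :
    ch.missProb s₁ (i + j) s ≤ ∑ s', (ch.stateLaw P s i s').toReal * ch.missProb s₁ j s' := by
  classical
  have := Fintype.ofFinite X
  induction i generalizing j with
  | zero =>
    rw [Finset.sum_eq_single s]
    · simp [Channel.stateLaw]
    · intro s' _ h
      simp [Channel.stateLaw, h]
    · exact fun h => absurd (Finset.mem_univ _) h
  | succ i ih =>
    have e : ∀ s'', (ch.stateLaw P s (i + 1) s'').toReal = ∑ s', (ch.stateLaw P s i s').toReal *
        ∑ x, (P i s' x).toReal * ∑ y, (ch.trans x s' (y, s'')).toReal := by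
      intro s''
      have e1 : ch.stateLaw P s (i + 1) s'' = ∑ s', ch.stateLaw P s i s' *
          ∑ x, P i s' x * ∑ y, ch.trans x s' (y, s'') := by
        simp only [Channel.stateLaw, PMF.bind_apply, tsum_fintype, PMF.map_apply]
        refine Finset.sum_congr rfl fun s' _ => ?_
        congr 1
        refine Finset.sum_congr rfl fun x _ => ?_
        congr 1
        rw [Fintype.sum_prod_type]
        refine Finset.sum_congr rfl fun y _ => ?_
        simp
      have h1 : ∀ x s', ∑ y, ch.trans x s' (y, s'') ≠ ⊤ := fun x s' =>
        ENNReal.sum_ne_top.2 fun y _ => (ch.trans _ _).apply_ne_top _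
      have h2 : ∀ s', ∑ x, P i s' x * ∑ y, ch.trans x s' (y, s'') ≠ ⊤ := fun s' =>
        ENNReal.sum_ne_top.2 fun x _ => ENNReal.mul_ne_top ((P i s').apply_ne_top _) (h1 x s')
      rw [e1, ENNReal.toReal_sum fun s' _ =>
        ENNReal.mul_ne_top ((ch.stateLaw P s i).apply_ne_top _) (h2 s')]
      refine Finset.sum_congr rfl fun s' _ => ?_
      rw [ENNReal.toReal_mul, ENNReal.toReal_sum fun x _ =>
        ENNReal.mul_ne_top ((P i s').apply_ne_top _) (h1 x s')]
      congr 1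
      refine Finset.sum_congr rfl fun x _ => ?_
      rw [ENNReal.toReal_mul, ENNReal.toReal_sum fun y _ => (ch.trans _ _).apply_ne_top _]
    have hP : ∀ s', ∑ x, (P i s' x).toReal = 1 := fun s' => by
      rw [← ENNReal.toReal_sum fun x _ => (P i s').apply_ne_top x]
      have := (P i s').tsum_coe
      rw [tsum_fintype] at this
      rw [this, ENNReal.toReal_one]
    rw [Nat.succ_add_eq_add_succ]
    refine (ih (j + 1)).trans ?_
    simp_rw [e, Finset.sum_mul]
    rw [Finset.sum_comm]
    refine Finset.sum_le_sum fun s' _ => ?_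
    simp_rw [mul_assoc, ← Finset.mul_sum]
    refine mul_le_mul_of_nonneg_left ?_ ENNReal.toReal_nonneg
    calc ch.missProb s₁ (j + 1) s' = ∑ x, (P i s' x).toReal * ch.missProb s₁ (j + 1) s' := by
          rw [← Finset.sum_mul, hP, one_mul]
      _ ≤ ∑ x, (P i s' x).toReal *
            ∑ y, ∑ s'', (ch.trans x s' (y, s'')).toReal * ch.missProb s₁ j s'' :=
          Finset.sum_le_sum fun x _ => mul_le_mul_of_nonneg_left
            (missProb_succ_le ch s₁ j s' x) ENNReal.toReal_nonneg
      _ = _ := by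
          simp_rw [Finset.sum_mul]
          rw [Finset.sum_comm]
          refine Finset.sum_congr rfl fun x _ => ?_
          rw [Finset.sum_comm, Finset.mul_sum]
          refine Finset.sum_congr rfl fun s'' _ => ?_
          rw [mul_assoc, Finset.sum_mul]

theorem missProb_lt_one (ch : Channel X Y S) (s₁ : S) (P : ℕ → S → PMF X) (s : S) (i : ℕ)
    (h : 0 < ch.stateLaw P s i s₁) : ch.missProb s₁ i s < 1 := by
  classical
  have h1 := missProb_le_sum_stateLaw ch s₁ P s i 0
  have h2 : ∑ s', (ch.stateLaw P s i s').toReal = 1 := by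
    rw [← ENNReal.toReal_sum fun s' _ => (ch.stateLaw P s i).apply_ne_top s']
    have := (ch.stateLaw P s i).tsum_coe
    rw [tsum_fintype] at this
    rw [this, ENNReal.toReal_one]
  have h3 : 0 < (ch.stateLaw P s i s₁).toReal :=
    ENNReal.toReal_pos h.ne' ((ch.stateLaw P s i).apply_ne_top _)
  refine h1.trans_lt ?_
  calc ∑ s', (ch.stateLaw P s i s').toReal * ch.missProb s₁ 0 s' <
        ∑ s', (ch.stateLaw P s i s').toReal :=
        Finset.sum_lt_sum (fun s' _ => mul_le_of_le_one_right ENNReal.toReal_nonneg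
          (missProb_le_one ch s₁ 0 s')) ⟨s₁, Finset.mem_univ _, by
            rw [missProb_self, mul_zero]; exact h3⟩
    _ = 1 := h2

/-- In a strongly connected channel every state can be reached, uniformly with probability close
to one, within a bounded time. -/
theorem exists_missProb_le (ch : Channel X Y S) (hconn : ch.StronglyConnected) {ε : ℝ}
    (hε : 0 < ε) : ∃ D, ∀ s₁ s, ch.missProb s₁ D s ≤ ε := by
  have h1 : ∀ s₁, ∃ D, ∀ s, ch.missProb s₁ D s ≤ ε := by
    intro s₁
    obtain ⟨T, P, hT⟩ := hconn s₁
    have hlt : ∀ s, ch.missProb s₁ T s < 1 := by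
      intro s
      obtain ⟨i, hi, hpos⟩ := Finset.exists_ne_zero_of_sum_ne_zero (hT s).ne'
      exact (missProb_antitone ch s₁ s (Finset.mem_Icc.1 hi).2).trans_lt
        (missProb_lt_one ch s₁ P s i (pos_iff_ne_zero.2 hpos))
    have : Nonempty S := ⟨s₁⟩
    obtain ⟨s₂, hs₂⟩ := Finite.exists_max fun s => ch.missProb s₁ T s
    set c := ch.missProb s₁ T s₂
    have hc0 : 0 ≤ c := missProb_nonneg ch s₁ T s₂
    have hpow : ∀ k s, ch.missProb s₁ (k * T) s ≤ c ^ k := by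
      intro k
      induction k with
      | zero => simpa using missProb_le_one ch s₁ 0
      | succ k ih =>
        intro s
        rw [Nat.succ_mul, pow_succ]
        exact (missProb_add_le ch s₁ _ _ ih T s).trans
          (mul_le_mul_of_nonneg_left (hs₂ s) (pow_nonneg hc0 k))
    obtain ⟨k, hk⟩ := exists_pow_lt_of_lt_one hε (hlt s₂)
    exact ⟨k * T, fun s => (hpow k s).trans hk.le⟩
  choose D hD using h1
  refine ⟨∑ s₁, D s₁, fun s₁ s => (missProb_antitone ch s₁ s ?_).trans (hD s₁ s)⟩
  exact Finset.single_le_sum (fun _ _ => Nat.zero_le _) (Finset.mem_univ s₁)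

/-- An input that attains the infimum in the recursion for `missProb`. -/
def Channel.driveInput (ch : Channel X Y S) (s₁ : S) (d : ℕ) (s : S) : X :=
  open Classical in
  if h : s = s₁ then Classical.arbitrary X else (exists_missProb_succ_eq ch s₁ d s h).choose

open Classical in
/-- Drive the state to `s₁` and start the strategy `σ` once `s₁` is reached, or else after `d`
steps. -/
def Channel.drive (ch : Channel X Y S) (s₁ : S) (σ : Strategy X Y S) : ℕ → Strategy X Y S
  | 0 => σ
  | d + 1 => fun h s =>
    match h with
    | [] => if s = s₁ then σ [] s else ch.driveInput s₁ d s
    -- if the first state was `s₁`, the strategy `σ` has been started with it and has seen the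
    -- whole past; otherwise its past has not begun yet
    | p :: h => if p.1 = s₁ then σ (p :: h) s else ch.drive s₁ σ d h s

/-- If the payoff `F` is at least `G`, evaluated at the `N` outputs after any delay `τ ≤ d`, then
the expected payoff after driving is at least that of starting in `s₁`, up to the probability of
missing `s₁`. -/
theorem le_expect_drive (ch : Channel X Y S) (s₁ : S) (σ : Strategy X Y S) (N d : ℕ) (s : S)
    (F G : List Y → ℝ) (hF : ∀ ys, -1 ≤ F ys)
    (hG : ∀ τ ≤ d, ∀ ys, G ((ys.drop τ).take N) ≤ F ys) :
    (1 - ch.missProb s₁ d s) * ch.expect N σ s₁ (fun ys _ => G ys) - ch.missProb s₁ d s ≤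
      ch.expect (N + d) (ch.drive s₁ σ d) s fun ys _ => F ys := by
  -- once `s₁` is reached, the delay is zero and the outputs after the first `N` do not matter
  have hit : ∀ d (F : List Y → ℝ), (∀ ys, G (ys.take N) ≤ F ys) →
      ch.expect N σ s₁ (fun ys _ => G ys) ≤ ch.expect (N + d) σ s₁ fun ys _ => F ys := by
    intro d F h
    rw [← expect_take ch N d]
    exact expect_mono ch _ _ _ fun ys _ _ => h ys
  induction d generalizing s F with
  | zero =>
    by_cases hs : s = s₁
    · subst hs
      rw [missProb_self, sub_zero, sub_zero, one_mul]
      exact hit 0 F fun ys => hG 0 le_rfl ys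
    · have h0 : ch.missProb s₁ 0 s = 1 := by simp [Channel.missProb, hs]
      rw [h0, sub_self, zero_mul, zero_sub, ← expect_const ch (N + 0) (ch.drive s₁ σ 0) s (-1)]
      exact expect_mono ch _ _ _ fun ys _ _ => hF ys
  | succ d ih =>
    by_cases hs : s = s₁
    · subst hs
      rw [missProb_self, sub_zero, sub_zero, one_mul]
      have hstep : ch.expect (N + (d + 1)) (ch.drive s σ (d + 1)) s (fun ys _ => F ys) =
          ch.expect (N + (d + 1)) σ s (fun ys _ => F ys) := by
        rw [← add_assoc]
        simp only [Channel.expect]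
        have h1 : ch.drive s σ (d + 1) [] s = σ [] s := by simp [Channel.drive]
        have h2 : ∀ y, (ch.drive s σ (d + 1)).shift (s, y) = σ.shift (s, y) := fun y => by
          funext h s'
          simp [Channel.drive, Strategy.shift]
        simp_rw [h1, h2]
      rw [hstep]
      exact hit (d + 1) F fun ys => hG 0 (Nat.zero_le _) ys
    · rw [← add_assoc]
      simp only [Channel.expect]
      have h1 : ch.drive s₁ σ (d + 1) [] s = ch.driveInput s₁ d s := by simp [Channel.drive, hs]
      have h2 : ∀ y, (ch.drive s₁ σ (d + 1)).shift (s, y) = ch.drive s₁ σ d := fun y => by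
        funext h s'
        simp [Channel.drive, Strategy.shift, hs]
      simp_rw [h1, h2]
      have h3 : ch.missProb s₁ (d + 1) s = ∑ y, ∑ s',
          (ch.trans (ch.driveInput s₁ d s) s (y, s')).toReal * ch.missProb s₁ d s' := by
        unfold Channel.driveInput
        rw [dif_neg hs]
        exact (exists_missProb_succ_eq ch s₁ d s hs).choose_spec
      set J := ch.expect N σ s₁ (fun ys _ => G ys)
      calc (1 - ch.missProb s₁ (d + 1) s) * J - ch.missProb s₁ (d + 1) s =
            J - (J + 1) * ch.missProb s₁ (d + 1) s := by ring
        _ = ∑ y, ∑ s', (ch.trans (ch.driveInput s₁ d s) s (y, s')).toReal * J - (J + 1) *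
              ∑ y, ∑ s', (ch.trans (ch.driveInput s₁ d s) s (y, s')).toReal *
                ch.missProb s₁ d s' := by
            rw [h3]
            simp_rw [← Finset.sum_mul, sum_trans_toReal, one_mul]
        _ = ∑ y, ∑ s', (ch.trans (ch.driveInput s₁ d s) s (y, s')).toReal *
              ((1 - ch.missProb s₁ d s') * J - ch.missProb s₁ d s') := by
            rw [Finset.mul_sum, ← Finset.sum_sub_distrib]
            refine Finset.sum_congr rfl fun y _ => ?_
            rw [Finset.mul_sum, ← Finset.sum_sub_distrib]
            exact Finset.sum_congr rfl fun s' _ => by ring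
        _ ≤ _ := Finset.sum_le_sum fun y _ => Finset.sum_le_sum fun s' _ =>
            mul_le_mul_of_nonneg_left (ih s' (fun ys => F (y :: ys)) (fun ys => hF _)
              fun τ hτ ys => hG (τ + 1) (by omega) (y :: ys)) ENNReal.toReal_nonneg

end Drive

/-! ### Scored random strategies -/

section Score

variable {X Y S : Type*} [Fintype S]

/-- The likelihood ratio of the decision tree `t`, when trees are drawn from `w` and the state is
initially `s₁`, as a function of a list of outputs; it is zero for lists of the wrong length. -/
def Channel.likelihood (ch : Channel X Y S) (s₁ : S) {N : ℕ} [Fintype (Tree (S → X) Y N)]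
    (w : Tree (S → X) Y N → ℝ) (t : Tree (S → X) Y N) (l : List Y) : ℝ :=
  if h : l.length = N then
    ((ch.startAt s₁).treeLaw t fun i => l.get (i.cast h.symm)).toReal /
      ∑ t', w t' * ((ch.startAt s₁).treeLaw t' fun i => l.get (i.cast h.symm)).toReal
  else 0

variable (ch : Channel X Y S) (s₁ : S) {N : ℕ} [Fintype (Tree (S → X) Y N)]
  {w : Tree (S → X) Y N → ℝ}

theorem likelihood_ofFn (t : Tree (S → X) Y N) (y : Fin N → Y) :
    ch.likelihood s₁ w t (List.ofFn y) = ((ch.startAt s₁).treeLaw t y).toReal /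
      ∑ t', w t' * ((ch.startAt s₁).treeLaw t' y).toReal := by
  unfold Channel.likelihood
  rw [dif_pos List.length_ofFn]
  have : (fun i : Fin N => (List.ofFn y).get (i.cast (List.length_ofFn (f := y)).symm)) = y := by
    funext i
    simp
  rw [this]

theorem likelihood_nonneg (hw : ∀ t, 0 ≤ w t) (t : Tree (S → X) Y N) (l : List Y) :
    0 ≤ ch.likelihood s₁ w t l := by
  unfold Channel.likelihood
  split_ifs
  · exact div_nonneg ENNReal.toReal_nonneg
      (Finset.sum_nonneg fun t' _ => mul_nonneg (hw t') ENNReal.toReal_nonneg)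
  · exact le_rfl

/-- The mean likelihood ratio is one, or zero where the denominator vanishes or the length is
wrong. -/
theorem sum_likelihood_le (l : List Y) : ∑ t, w t * ch.likelihood s₁ w t l ≤ 1 := by
  unfold Channel.likelihood
  split_ifs
  · simp_rw [← mul_div_assoc, ← Finset.sum_div]
    exact div_self_le_one _
  · simp

/-- The score of a tree that is started after an unknown delay of at most `D` steps: half the
mean likelihood ratio over all delays, and `1 / 2` to make its logarithm bounded below. -/
def Channel.score (w : Tree (S → X) Y N → ℝ) (D : ℕ) (t : Tree (S → X) Y N) (l : List Y) : ℝ :=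
  1 / 2 + 1 / (2 * (D + 1)) *
    ∑ τ ∈ Finset.range (D + 1), ch.likelihood s₁ w t ((l.drop τ).take N)

theorem half_le_score (hw : ∀ t, 0 ≤ w t) (D : ℕ) (t : Tree (S → X) Y N) (l : List Y) :
    1 / 2 ≤ ch.score s₁ w D t l := by
  unfold Channel.score
  have : 0 ≤ 1 / (2 * ((D : ℝ) + 1)) *
      ∑ τ ∈ Finset.range (D + 1), ch.likelihood s₁ w t ((l.drop τ).take N) :=
    mul_nonneg (by positivity) (Finset.sum_nonneg fun τ _ => likelihood_nonneg ch s₁ hw t _)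
  linarith

/-- For any outputs, the mean score of a tree that is drawn independently of them is at most one. -/
theorem sum_score_le (hw1 : ∑ t, w t = 1) (D : ℕ) (l : List Y) :
    ∑ t, w t * ch.score s₁ w D t l ≤ 1 := by
  have hD : (0 : ℝ) < (D : ℝ) + 1 := by positivity
  have e : ∑ t, w t * ch.score s₁ w D t l = 1 / 2 + 1 / (2 * (D + 1)) *
      ∑ τ ∈ Finset.range (D + 1), ∑ t, w t * ch.likelihood s₁ w t ((l.drop τ).take N) := by
    unfold Channel.score
    simp_rw [mul_add, Finset.sum_add_distrib, ← Finset.sum_mul, hw1, one_mul]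
    congr 1
    rw [Finset.sum_comm, Finset.mul_sum]
    refine Finset.sum_congr rfl fun t _ => ?_
    simp_rw [Finset.mul_sum]
    exact Finset.sum_congr rfl fun τ _ => by ring
  rw [e]
  have h : ∑ τ ∈ Finset.range (D + 1), ∑ t, w t * ch.likelihood s₁ w t ((l.drop τ).take N) ≤
      ∑ τ ∈ Finset.range (D + 1), (1 : ℝ) :=
    Finset.sum_le_sum fun τ _ => sum_likelihood_le ch s₁ _
  rw [Finset.sum_const, Finset.card_range, nsmul_eq_mul, mul_one] at h
  push_cast at h
  have h2 : 1 / (2 * ((D : ℝ) + 1)) * ((D : ℝ) + 1) = 1 / 2 := by field_simp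
  have h3 := mul_le_mul_of_nonneg_left h (by positivity : (0 : ℝ) ≤ 1 / (2 * ((D : ℝ) + 1)))
  linarith

variable [Fintype Y]

theorem exists_likelihood_le (w : Tree (S → X) Y N → ℝ) :
    ∃ B : ℝ, 0 ≤ B ∧ ∀ t l, ch.likelihood s₁ w t l ≤ B := by
  have hfin : (Set.range fun p : Tree (S → X) Y N × (Fin N → Y) =>
      ch.likelihood s₁ w p.1 (List.ofFn p.2)).Finite := Set.finite_range _
  obtain ⟨B, hB⟩ := hfin.bddAbove
  refine ⟨max B 0, le_max_right _ _, fun t l => ?_⟩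
  by_cases h : l.length = N
  · subst h
    have := hB ⟨(t, fun i => l.get i), rfl⟩
    simp only [List.ofFn_get] at this
    exact this.trans (le_max_left _ _)
  · unfold Channel.likelihood
    rw [dif_neg h]
    exact le_max_right _ _

theorem exists_score_le (w : Tree (S → X) Y N → ℝ) (D : ℕ) :
    ∃ B : ℝ, ∀ t l, ch.score s₁ w D t l ≤ B := by
  obtain ⟨B, hB0, hB⟩ := exists_likelihood_le ch s₁ w
  refine ⟨1 / 2 + 1 / (2 * (D + 1)) * ∑ τ ∈ Finset.range (D + 1), B, fun t l => ?_⟩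
  unfold Channel.score
  have : (0 : ℝ) ≤ 1 / (2 * ((D : ℝ) + 1)) := by positivity
  gcongr
  exact hB _ _

variable [Finite X] [Nonempty X]

/-- The mean logarithmic score of a block of length `N + D` is close to the mutual information of
the tree and the outputs when the initial state is `s₁`. -/
theorem le_expect_log_score (hw : ∀ t, 0 ≤ w t) (hw1 : ∑ t, w t = 1) (D : ℕ) {ε : ℝ}
    (hD : ∀ s, ch.missProb s₁ D s ≤ ε) (s : S) :
    (1 - ε) * treeInfo (ch.startAt s₁) w - Real.logb 2 (2 * (D + 1)) - 1 ≤
      ∑ t, w t * ch.expect (N + D) (ch.drive s₁ (treeStrategy t) D) s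
        fun ys _ => Real.logb 2 (ch.score s₁ w D t ys) := by
  set c := Real.logb 2 (2 * ((D : ℝ) + 1)) with hc
  have hD0 : (0 : ℝ) ≤ D := Nat.cast_nonneg D
  have hc1 : 1 ≤ c := by
    rw [hc, Real.le_logb_iff_rpow_le (by norm_num) (by positivity)]
    simp
  have hlow : ∀ t ys, -1 ≤ Real.logb 2 (ch.score s₁ w D t ys) := fun t ys => by
    have h := half_le_score ch s₁ hw D t ys
    rw [Real.le_logb_iff_rpow_le (by norm_num) (by linarith), Real.rpow_neg_one]
    linarith
  have hlik : ∀ t, ∀ τ ≤ D, ∀ ys : List Y,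
      Real.logb 2 (ch.likelihood s₁ w t ((ys.drop τ).take N)) - c ≤
        Real.logb 2 (ch.score s₁ w D t ys) := by
    intro t τ hτ ys
    rcases (likelihood_nonneg ch s₁ hw t ((ys.drop τ).take N)).eq_or_lt with h | h
    · -- the logarithm of zero is zero by convention, and `-c ≤ -1` is below the score
      rw [← h, Real.logb_zero]
      linarith [hlow t ys]
    · have hD1 : (0 : ℝ) < 2 * ((D : ℝ) + 1) := by positivity
      rw [hc, ← Real.logb_div h.ne' hD1.ne']
      refine Real.logb_le_logb_of_le (by norm_num) (div_pos h hD1) ?_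
      unfold Channel.score
      have h1 := Finset.single_le_sum
        (f := fun τ => ch.likelihood s₁ w t ((ys.drop τ).take N))
        (fun τ _ => likelihood_nonneg ch s₁ hw t _) (Finset.mem_range.2 (Nat.lt_succ_of_le hτ))
      have h2 := mul_le_mul_of_nonneg_left h1 (one_div_nonneg.2 hD1.le)
      rw [div_eq_inv_mul, ← one_div]
      linarith
  set J : Tree (S → X) Y N → ℝ := fun t => ch.expect N (treeStrategy t) s₁
    fun ys _ => Real.logb 2 (ch.likelihood s₁ w t ys) - c with hJ
  have hblock : ∀ t, (1 - ch.missProb s₁ D s) * J t - ch.missProb s₁ D s ≤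
      ch.expect (N + D) (ch.drive s₁ (treeStrategy t) D) s
        fun ys _ => Real.logb 2 (ch.score s₁ w D t ys) := fun t =>
    le_expect_drive ch s₁ (treeStrategy t) N D s _
      (fun ys => Real.logb 2 (ch.likelihood s₁ w t ys) - c) (hlow t) (hlik t)
  have hW1 : ∀ t : Tree (S → X) Y N, ∑ y, ((ch.startAt s₁).treeLaw t y).toReal = 1 := fun t => by
    rw [← ENNReal.toReal_sum, sum_treeLaw, ENNReal.toReal_one]
    intro y _
    refine ne_top_of_le_ne_top ENNReal.one_ne_top ?_
    rw [← sum_treeLaw (ch.startAt s₁) t]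
    exact Finset.single_le_sum (fun _ _ => zero_le) (Finset.mem_univ y)
  have hJsum : ∑ t, w t * J t = treeInfo (ch.startAt s₁) w - c := by
    have h1 : ∀ t, J t = ∑ y, ((ch.startAt s₁).treeLaw t y).toReal *
        Real.logb 2 (((ch.startAt s₁).treeLaw t y).toReal /
          ∑ t', w t' * ((ch.startAt s₁).treeLaw t' y).toReal) - c := fun t => by
      rw [hJ]
      simp only
      rw [expect_treeStrategy]
      simp_rw [likelihood_ofFn, mul_sub, Finset.sum_sub_distrib, ← Finset.sum_mul, hW1, one_mul]
    simp_rw [h1, mul_sub, Finset.sum_sub_distrib, ← Finset.sum_mul, hw1, one_mul]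
    unfold treeInfo mutInfo
    simp_rw [Finset.mul_sum, mul_assoc]
  have hI : 0 ≤ treeInfo (ch.startAt s₁) w :=
    mutInfo_nonneg hw hw1 (fun _ _ => ENNReal.toReal_nonneg) hW1
  have hm0 := missProb_nonneg ch s₁ D s
  have hm1 := missProb_le_one ch s₁ D s
  calc (1 - ε) * treeInfo (ch.startAt s₁) w - c - 1 ≤
        (1 - ch.missProb s₁ D s) * (treeInfo (ch.startAt s₁) w - c) - ch.missProb s₁ D s := by
        nlinarith [mul_nonneg (sub_nonneg.2 (hD s)) hI, mul_nonneg hm0 (zero_le_one.trans hc1)]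
    _ = ∑ t, w t * ((1 - ch.missProb s₁ D s) * J t - ch.missProb s₁ D s) := by
        rw [← hJsum, Finset.mul_sum]
        simp_rw [mul_sub (w _), Finset.sum_sub_distrib, ← Finset.sum_mul, hw1, one_mul]
        congr 1
        exact Finset.sum_congr rfl fun t _ => by ring
    _ ≤ _ := Finset.sum_le_sum fun t _ => mul_le_mul_of_nonneg_left (hblock t) (hw t)

end Score

/-! ### Exponential moments and concatenation of blocks -/

section Ensemble

variable {X Y S : Type*} [Fintype Y] [Fintype S]

/-- Exponential moments: if the mean logarithmic score is at least `μ` from every initial state,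
then for `r < μ` some negative power `-l` of the score has a mean of at most some `ρ < 2 ^ (-l r)`
from every initial state. -/
theorem exists_exponent (ch : Channel X Y S) {A : Type*} [Fintype A] (w : A → ℝ)
    (hw : ∀ a, 0 ≤ w a) (hw1 : ∑ a, w a = 1) (L : ℕ) (σ : A → Strategy X Y S)
    (g : A → List Y → ℝ) (hg : ∀ a ys, 1 / 2 ≤ g a ys) (B : ℝ) (hB : ∀ a ys, g a ys ≤ B)
    (r μ : ℝ) (hr : r < μ)
    (hμ : ∀ s, μ ≤ ∑ a, w a * ch.expect L (σ a) s fun ys _ => Real.logb 2 (g a ys)) :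
    ∃ l > 0, ∃ ρ > 0, (2 : ℝ) ^ (l * r) * ρ < 1 ∧
      ∀ s, ∑ a, w a * ch.expect L (σ a) s (fun ys _ => g a ys ^ (-l)) ≤ ρ := by
  have hlog2 : 0 < Real.log 2 := Real.log_pos (by norm_num)
  set K : ℝ := 1 + Real.log 2 + |Real.log B| with hK
  have hK1 : 1 ≤ K := by have := abs_nonneg (Real.log B); linarith
  have hgpos : ∀ a ys, 0 < g a ys := fun a ys => by have := hg a ys; linarith
  have habs : ∀ a ys, |Real.log (g a ys)| ≤ K := by
    intro a ys
    rw [abs_le]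
    constructor
    · have h1 := Real.log_le_log (by norm_num) (hg a ys)
      rw [one_div, Real.log_inv] at h1
      have := abs_nonneg (Real.log B)
      linarith
    · have h1 := Real.log_le_log (hgpos a ys) (hB a ys)
      have := le_abs_self (Real.log B)
      linarith
  -- `K` bounds the logarithms of the scores; `l` is so small that `l K ≤ 1`, where the exponential
  -- is quadratically close to its linear part, and that the quadratic error is below the gain
  set l : ℝ := min (1 / K) (Real.log 2 * (μ - r) / (2 * K ^ 2)) with hl
  have hl0 : 0 < l := lt_min (by positivity) (by have := sub_pos.2 hr; positivity)
  have hlK : l * K ≤ 1 := by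
    have := mul_le_mul_of_nonneg_right (min_le_left (1 / K) (Real.log 2 * (μ - r) / (2 * K ^ 2)))
      (by linarith : (0 : ℝ) ≤ K)
    have h1 : 1 / K * K = 1 := one_div_mul_cancel (by linarith)
    rwa [h1] at this
  have hlK2 : l * K ^ 2 < Real.log 2 * (μ - r) := by
    have h1 := mul_le_mul_of_nonneg_right
      (min_le_right (1 / K) (Real.log 2 * (μ - r) / (2 * K ^ 2))) (by positivity : (0 : ℝ) ≤ K ^ 2)
    have h2 : Real.log 2 * (μ - r) / (2 * K ^ 2) * K ^ 2 = Real.log 2 * (μ - r) / 2 := by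
      field_simp
    rw [h2] at h1
    have := mul_pos hlog2 (sub_pos.2 hr)
    linarith
  refine ⟨l, hl0, Real.exp (-(l * Real.log 2) * μ + l ^ 2 * K ^ 2), Real.exp_pos _, ?_, ?_⟩
  · rw [Real.rpow_def_of_pos (by norm_num), ← Real.exp_add]
    rw [← Real.exp_zero]
    refine Real.exp_lt_exp.2 ?_
    nlinarith [mul_lt_mul_of_pos_left hlK2 hl0]
  · intro s
    have hpt : ∀ a ys, g a ys ^ (-l) ≤
        (1 + l ^ 2 * K ^ 2) + (-(l * Real.log 2)) * Real.logb 2 (g a ys) := by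
      intro a ys
      rw [Real.rpow_def_of_pos (hgpos a ys)]
      have hx : |Real.log (g a ys) * -l| ≤ 1 := by
        rw [abs_mul, abs_neg, abs_of_pos hl0]
        have := mul_le_mul_of_nonneg_right (habs a ys) hl0.le
        linarith
      have h1 := (abs_le.1 (Real.abs_exp_sub_one_sub_id_le hx)).2
      have h2 : (Real.log (g a ys) * -l) ^ 2 ≤ l ^ 2 * K ^ 2 := by
        have := sq_le_sq' (abs_le.1 (habs a ys)).1 (abs_le.1 (habs a ys)).2
        nlinarith [sq_nonneg l]
      have h3 : -(l * Real.log 2) * Real.logb 2 (g a ys) = Real.log (g a ys) * -l := by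
        rw [Real.logb]
        field_simp
      linarith
    calc ∑ a, w a * ch.expect L (σ a) s (fun ys _ => g a ys ^ (-l)) ≤
          ∑ a, w a * ((1 + l ^ 2 * K ^ 2) + (-(l * Real.log 2)) *
            ch.expect L (σ a) s fun ys _ => Real.logb 2 (g a ys)) := by
          refine Finset.sum_le_sum fun a _ => mul_le_mul_of_nonneg_left ?_ (hw a)
          refine (expect_mono ch L (σ a) s fun ys _ _ => hpt a ys).trans_eq ?_
          rw [expect_add, expect_const, expect_const_mul]
      _ = (1 + l ^ 2 * K ^ 2) + (-(l * Real.log 2)) *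
            ∑ a, w a * ch.expect L (σ a) s fun ys _ => Real.logb 2 (g a ys) := by
          simp_rw [mul_add, Finset.sum_add_distrib, ← Finset.sum_mul, hw1, one_mul]
          rw [Finset.mul_sum]
          congr 1
          exact Finset.sum_congr rfl fun a _ => by ring
      _ ≤ (1 + l ^ 2 * K ^ 2) + (-(l * Real.log 2)) * μ := by
          have := mul_le_mul_of_nonneg_left (hμ s) (mul_pos hl0 hlog2).le
          linarith
      _ ≤ Real.exp (-(l * Real.log 2) * μ + l ^ 2 * K ^ 2) := by
          have := Real.add_one_le_exp (-(l * Real.log 2) * μ + l ^ 2 * K ^ 2)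
          linarith

/-- Concatenating `B` blocks, with independent labels, multiplies the scores. The exponential
moments multiply as well, because the bound `ρ` for one block is uniform in the state at its start. -/
theorem exists_block_ensemble (ch : Channel X Y S) {T : Type*} [Fintype T] (w : T → ℝ)
    (hw : ∀ a, 0 ≤ w a) (hw1 : ∑ a, w a = 1) (L : ℕ) (σ : T → Strategy X Y S)
    (g : T → List Y → ℝ) (hg : ∀ a ys, 0 < g a ys) (hg1 : ∀ ys, ∑ a, w a * g a ys ≤ 1)
    (l ρ : ℝ) (hρ : 0 < ρ)
    (h : ∀ s, ∑ a, w a * ch.expect L (σ a) s (fun ys _ => g a ys ^ (-l)) ≤ ρ) (B : ℕ) :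
    ∃ (A : Type) (_ : Fintype A) (v : A → ℝ) (τ : A → Strategy X Y S) (f : A → List Y → ℝ),
      (∀ a, 0 ≤ v a) ∧ ∑ a, v a = 1 ∧ (∀ a ys, 0 < f a ys) ∧ (∀ ys, ∑ a, v a * f a ys ≤ 1) ∧
      ∀ s, ∑ a, v a * ch.expect (B * L) (τ a) s (fun ys _ => f a ys ^ (-l)) ≤ ρ ^ B := by
  obtain ⟨k, ⟨e⟩⟩ := Finite.exists_equiv_fin T
  induction B with
  | zero =>
    have hT : Nonempty T := by
      by_contra hT
      rw [not_nonempty_iff] at hT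
      simp at hw1
    refine ⟨Unit, inferInstance, fun _ => 1, fun _ => σ hT.some, fun _ _ => 1, ?_, ?_, ?_, ?_, ?_⟩
    · simp
    · simp
    · simp
    · simp
    · intro s
      simp [expect_const]
  | succ B ih =>
    obtain ⟨A, _, v, τ, f, hv, hv1, hf, hf1, hmom⟩ := ih
    refine ⟨Fin k × A, inferInstance, fun a => w (e.symm a.1) * v a.2,
      fun a => (τ a.2).switch L (σ (e.symm a.1)),
      fun a ys => g (e.symm a.1) (ys.take L) * f a.2 (ys.drop L), ?_, ?_, ?_, ?_, ?_⟩
    · exact fun a => mul_nonneg (hw _) (hv _)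
    · rw [Fintype.sum_prod_type]
      simp_rw [← Finset.mul_sum, hv1, mul_one]
      rw [e.symm.sum_comp w, hw1]
    · exact fun a ys => mul_pos (hg _ _) (hf _ _)
    · intro ys
      rw [Fintype.sum_prod_type]
      calc ∑ i, ∑ a, w (e.symm i) * v a * (g (e.symm i) (ys.take L) * f a (ys.drop L)) =
            ∑ i, w (e.symm i) * g (e.symm i) (ys.take L) * ∑ a, v a * f a (ys.drop L) := by
            refine Finset.sum_congr rfl fun i _ => ?_
            rw [Finset.mul_sum]
            exact Finset.sum_congr rfl fun a _ => by ring
        _ ≤ ∑ i, w (e.symm i) * g (e.symm i) (ys.take L) * 1 :=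
            Finset.sum_le_sum fun i _ => mul_le_mul_of_nonneg_left (hf1 _)
              (mul_nonneg (hw _) (hg _ _).le)
        _ ≤ 1 := by
            simp_rw [mul_one]
            rw [e.symm.sum_comp fun t => w t * g t (ys.take L)]
            exact hg1 _
    · intro s
      have hL : (B + 1) * L = L + B * L := by ring
      rw [hL, Fintype.sum_prod_type]
      have hterm : ∀ i a, ch.expect (L + B * L) ((τ a).switch L (σ (e.symm i))) s
          (fun ys _ => (g (e.symm i) (ys.take L) * f a (ys.drop L)) ^ (-l)) =
          ch.expect L (σ (e.symm i)) s fun ys s' => g (e.symm i) ys ^ (-l) *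
            ch.expect (B * L) (τ a) s' fun zs _ => f a zs ^ (-l) := by
        intro i a
        rw [expect_switch]
        refine expect_congr ch _ _ _ fun ys s' hl => ?_
        rw [← expect_const_mul]
        refine expect_congr ch _ _ _ fun zs _ _ => ?_
        rw [List.take_left' hl, List.drop_left' hl, Real.mul_rpow (hg _ _).le (hf _ _).le]
      simp_rw [hterm]
      calc ∑ i, ∑ a, w (e.symm i) * v a * ch.expect L (σ (e.symm i)) s (fun ys s' =>
              g (e.symm i) ys ^ (-l) * ch.expect (B * L) (τ a) s' fun zs _ => f a zs ^ (-l)) =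
            ∑ i, w (e.symm i) * ch.expect L (σ (e.symm i)) s (fun ys s' =>
              g (e.symm i) ys ^ (-l) *
                ∑ a, v a * ch.expect (B * L) (τ a) s' fun zs _ => f a zs ^ (-l)) := by
            refine Finset.sum_congr rfl fun i _ => ?_
            simp_rw [mul_assoc, ← Finset.mul_sum]
            congr 1
            rw [Finset.sum_congr rfl fun a _ => (expect_const_mul ch _ _ _ (v a) _).symm,
              ← expect_sum]
            refine expect_congr ch _ _ _ fun ys s' _ => ?_
            rw [Finset.mul_sum]
            refine Finset.sum_congr rfl fun a _ => ?_
            ring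
        _ ≤ ∑ i, w (e.symm i) * ch.expect L (σ (e.symm i)) s (fun ys s' =>
              ρ ^ B * g (e.symm i) ys ^ (-l)) := by
            refine Finset.sum_le_sum fun i _ => mul_le_mul_of_nonneg_left ?_ (hw _)
            refine expect_mono ch _ _ _ fun ys s' _ => ?_
            rw [mul_comm]
            exact mul_le_mul_of_nonneg_right (hmom s') (Real.rpow_nonneg (hg _ _).le _)
        _ = ρ ^ B * ∑ t, w t * ch.expect L (σ t) s fun ys _ => g t ys ^ (-l) := by
            simp_rw [expect_const_mul]
            rw [e.symm.sum_comp fun t => w t * (ρ ^ B *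
              ch.expect L (σ t) s fun ys _ => g t ys ^ (-l)), Finset.mul_sum]
            exact Finset.sum_congr rfl fun t _ => by ring
        _ ≤ ρ ^ (B + 1) := by
            rw [pow_succ]
            exact mul_le_mul_of_nonneg_left (h s) (pow_nonneg hρ.le _)

end Ensemble

/-! ### Random coding -/

section RandomCoding

/-- A codebook that is as good as the average one, for a cost that involves single codewords and
pairs of them. It is built codeword by codeword. -/
theorem exists_codebook {A : Type*} [Fintype A] (v : A → ℝ) (hv : ∀ a, 0 ≤ v a)
    (hv1 : ∑ a, v a = 1) (k : ℕ) (α : A → ℝ) (β : A → A → ℝ) :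
    ∃ c : Fin k → A, ∑ m, (α (c m) + ∑ m', if m' ≠ m then β (c m) (c m') else 0) ≤
      k * ∑ a, v a * α a + k * (k - 1) * ∑ a, ∑ b, v a * (v b * β a b) := by
  classical
  induction k generalizing α with
  | zero => exact ⟨fun i => i.elim0, by simp⟩
  | succ k ih =>
    -- with `a` as first codeword, the pairs that involve it become costs of single codewords
    choose c hc using fun a => ih fun x => α x + β a x + β x a
    set E := ∑ a, ∑ b, v a * (v b * β a b) with hE
    -- the cost of the codebook that starts with `a`
    set G : A → ℝ := fun a => α a + (k * ∑ x, v x * (α x + β a x + β x a) + k * (k - 1) * E) with hG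
    have hmean : ∑ a, v a * G a =
        (k + 1 : ℕ) * ∑ a, v a * α a + (k + 1 : ℕ) * ((k + 1 : ℕ) - 1) * E := by
      have h1 : ∑ a, v a * ∑ x, v x * (α x + β a x + β x a) =
          ∑ x, v x * α x + E + E := by
        have e1 : ∑ a, v a * ∑ x, v x * (α x + β a x + β x a) =
            (∑ a, v a * ∑ x, v x * α x) + E + ∑ a, ∑ x, v a * (v x * β x a) := by
          rw [hE, ← Finset.sum_add_distrib, ← Finset.sum_add_distrib]
          refine Finset.sum_congr rfl fun a _ => ?_
          simp_rw [mul_add, Finset.sum_add_distrib, mul_add, Finset.mul_sum]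
        have e2 : ∑ a, ∑ x, v a * (v x * β x a) = E := by
          rw [hE, Finset.sum_comm]
          exact Finset.sum_congr rfl fun a _ => Finset.sum_congr rfl fun b _ => by ring
        rw [e1, e2, ← Finset.sum_mul, hv1, one_mul]
      have h2 : ∑ a, v a * G a = ∑ a, v a * α a + k * ∑ a, v a * ∑ x, v x * (α x + β a x + β x a) +
          (∑ a, v a) * (k * (k - 1) * E) := by
        rw [Finset.mul_sum, Finset.sum_mul, ← Finset.sum_add_distrib, ← Finset.sum_add_distrib]
        refine Finset.sum_congr rfl fun a _ => ?_
        rw [hG]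
        ring
      rw [h2, h1, hv1]
      push_cast
      ring
    obtain ⟨a, ha⟩ : ∃ a, G a ≤ ∑ a, v a * G a := by
      by_contra hcon
      push Not at hcon
      have hpos : ∃ a ∈ Finset.univ, 0 < v a := by
        by_contra h
        push Not at h
        have := Finset.sum_nonpos h
        linarith
      obtain ⟨a, ha, hva⟩ := hpos
      have h1 : ∑ a, v a * (∑ a, v a * G a) < ∑ a, v a * G a :=
        Finset.sum_lt_sum (fun a _ => mul_le_mul_of_nonneg_left (hcon a).le (hv a))
          ⟨a, ha, mul_lt_mul_of_pos_left (hcon a) hva⟩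
      rw [← Finset.sum_mul, hv1, one_mul] at h1
      exact lt_irrefl _ h1
    refine ⟨Fin.cons a (c a), ?_⟩
    rw [← hmean]
    refine le_trans (le_of_eq ?_) ((add_le_add_right (hc a) (α a)).trans ha)
    rw [Fin.sum_univ_succ]
    simp only [Fin.cons_zero, Fin.cons_succ, Fin.sum_univ_succ, ne_eq, not_true_eq_false, if_false,
      zero_add, Fin.succ_ne_zero, not_false_eq_true, if_true, (Fin.succ_ne_zero _).symm,
      Fin.succ_inj]
    simp_rw [Finset.sum_add_distrib]
    ring

variable {X Y S : Type*} [Fintype S]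

theorem sum_init_toReal (ch : Channel X Y S) : ∑ s, (ch.init s).toReal = 1 := by
  rw [← ENNReal.toReal_sum fun s _ => ch.init.apply_ne_top s]
  have := ch.init.tsum_coe
  rw [tsum_fintype] at this
  rw [this, ENNReal.toReal_one]

variable [Fintype Y]

/-- Random coding with threshold decoding: the decoder looks for a message whose score exceeds
`θ`. The moment bound controls the probability that the true message stays below `θ`, and Markov's
inequality that of a false one to exceed it. The last `j` channel uses do not contribute. -/
theorem exists_code_errorProb_le [Finite X] (ch : Channel X Y S) {A : Type*} [Fintype A]
    (v : A → ℝ) (hv : ∀ a, 0 ≤ v a) (hv1 : ∑ a, v a = 1) (σ : A → Strategy X Y S)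
    (f : A → List Y → ℝ) (hf : ∀ a ys, 0 < f a ys) (hf1 : ∀ ys, ∑ a, v a * f a ys ≤ 1)
    (l M : ℝ) (hl : 0 < l) (m₀ j : ℕ)
    (hmom : ∀ s, ∑ a, v a * ch.expect m₀ (σ a) s (fun ys _ => f a ys ^ (-l)) ≤ M)
    {k : ℕ} (hk : 0 < k) {θ : ℝ} (hθ : 0 < θ) :
    ∃ c : Code X Y S (m₀ + j) k, (c.errorProb ch).toReal ≤ θ ^ l * M + k / θ := by
  classical
  have hk0 : (0 : ℝ) < k := by exact_mod_cast hk
  -- `α a`: the codeword `a`, when sent, stays below the threshold; `β a b`: the codeword `b`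
  -- exceeds it when `a` is sent
  let α : A → ℝ := fun a => ∑ s, (ch.init s).toReal *
    ch.expect (m₀ + j) (σ a) s fun ys _ => if f a (ys.take m₀) ≤ θ then 1 else 0
  let β : A → A → ℝ := fun a b => ∑ s, (ch.init s).toReal *
    ch.expect (m₀ + j) (σ a) s fun ys _ => if θ < f b (ys.take m₀) then 1 else 0
  have hα : ∑ a, v a * α a ≤ θ ^ l * M := by
    have h1 : ∀ s, ∑ a, v a * ch.expect (m₀ + j) (σ a) s
        (fun ys _ => if f a (ys.take m₀) ≤ θ then 1 else 0) ≤ θ ^ l * M := by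
      intro s
      calc ∑ a, v a * ch.expect (m₀ + j) (σ a) s
            (fun ys _ => if f a (ys.take m₀) ≤ θ then 1 else 0) ≤
            ∑ a, v a * (θ ^ l * ch.expect m₀ (σ a) s fun ys _ => f a ys ^ (-l)) := by
            refine Finset.sum_le_sum fun a _ => mul_le_mul_of_nonneg_left ?_ (hv a)
            rw [expect_take ch m₀ j (σ a) s fun ys => if f a ys ≤ θ then 1 else 0,
              ← expect_const_mul]
            refine expect_mono ch _ _ _ fun ys _ _ => ?_
            rw [Real.rpow_neg (hf a ys).le, ← div_eq_mul_inv]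
            split_ifs with h
            · rw [one_le_div (Real.rpow_pos_of_pos (hf a ys) l)]
              exact Real.rpow_le_rpow (hf a ys).le h hl.le
            · exact div_nonneg (Real.rpow_nonneg hθ.le _) (Real.rpow_nonneg (hf a ys).le _)
        _ = θ ^ l * ∑ a, v a * ch.expect m₀ (σ a) s fun ys _ => f a ys ^ (-l) := by
            rw [Finset.mul_sum]
            exact Finset.sum_congr rfl fun a _ => by ring
        _ ≤ _ := mul_le_mul_of_nonneg_left (hmom s) (Real.rpow_nonneg hθ.le _)
    calc ∑ a, v a * α a = ∑ s, (ch.init s).toReal * ∑ a, v a * ch.expect (m₀ + j) (σ a) s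
            (fun ys _ => if f a (ys.take m₀) ≤ θ then 1 else 0) := by
          simp only [α, Finset.mul_sum]
          rw [Finset.sum_comm]
          exact Finset.sum_congr rfl fun s _ => Finset.sum_congr rfl fun a _ => by ring
      _ ≤ ∑ s, (ch.init s).toReal * (θ ^ l * M) :=
          Finset.sum_le_sum fun s _ => mul_le_mul_of_nonneg_left (h1 s) ENNReal.toReal_nonneg
      _ = θ ^ l * M := by rw [← Finset.sum_mul, sum_init_toReal, one_mul]
  have hβ : ∑ a, ∑ b, v a * (v b * β a b) ≤ 1 / θ := by
    have h1 : ∀ a, ∑ b, v b * β a b ≤ 1 / θ := by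
      intro a
      have h2 : ∀ s, ∑ b, v b * ch.expect (m₀ + j) (σ a) s
          (fun ys _ => if θ < f b (ys.take m₀) then 1 else 0) ≤ 1 / θ := by
        intro s
        rw [Finset.sum_congr rfl fun b _ => (expect_const_mul ch _ _ _ (v b) _).symm,
          ← expect_sum, ← expect_const ch (m₀ + j) (σ a) s (1 / θ)]
        refine expect_mono ch _ _ _ fun ys _ _ => ?_
        rw [le_div_iff₀ hθ, Finset.sum_mul]
        refine le_trans (Finset.sum_le_sum fun b _ => ?_) (hf1 (ys.take m₀))
        rw [mul_assoc]
        refine mul_le_mul_of_nonneg_left ?_ (hv b)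
        split_ifs with h
        · rw [one_mul]; exact h.le
        · rw [zero_mul]; exact (hf b _).le
      calc ∑ b, v b * β a b = ∑ s, (ch.init s).toReal * ∑ b, v b * ch.expect (m₀ + j) (σ a) s
              (fun ys _ => if θ < f b (ys.take m₀) then 1 else 0) := by
            simp only [β, Finset.mul_sum]
            rw [Finset.sum_comm]
            exact Finset.sum_congr rfl fun s _ => Finset.sum_congr rfl fun a _ => by ring
        _ ≤ ∑ s, (ch.init s).toReal * (1 / θ) :=
            Finset.sum_le_sum fun s _ => mul_le_mul_of_nonneg_left (h2 s) ENNReal.toReal_nonneg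
        _ = 1 / θ := by rw [← Finset.sum_mul, sum_init_toReal, one_mul]
    calc ∑ a, ∑ b, v a * (v b * β a b) = ∑ a, v a * ∑ b, v b * β a b := by
          simp_rw [Finset.mul_sum]
      _ ≤ ∑ a, v a * (1 / θ) :=
          Finset.sum_le_sum fun a _ => mul_le_mul_of_nonneg_left (h1 a) (hv a)
      _ = 1 / θ := by rw [← Finset.sum_mul, hv1, one_mul]
  obtain ⟨c, hc⟩ := exists_codebook v hv hv1 k α β
  let d : List Y → Fin k := fun ys =>
    if h : ∃ m, θ < f (c m) (ys.take m₀) then h.choose else ⟨0, hk⟩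
  refine ⟨strategyCode (fun m => σ (c m)) d, ?_⟩
  rw [errorProb_strategyCode]
  have herr : ∀ m ys, (if d ys ≠ m then (1 : ℝ) else 0) ≤
      (if f (c m) (ys.take m₀) ≤ θ then 1 else 0) +
        ∑ m', (if m' ≠ m then 1 else 0) * if θ < f (c m') (ys.take m₀) then 1 else 0 := by
    intro m ys
    have hnn : ∀ m' ∈ Finset.univ, (0 : ℝ) ≤
        (if m' ≠ m then 1 else 0) * if θ < f (c m') (ys.take m₀) then 1 else 0 := fun m' _ =>
      mul_nonneg (by split_ifs <;> norm_num) (by split_ifs <;> norm_num)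
    by_cases hd : d ys = m
    · rw [if_neg (by simpa using hd)]
      exact add_nonneg (by split_ifs <;> norm_num) (Finset.sum_nonneg hnn)
    · rw [if_pos hd]
      by_cases h : f (c m) (ys.take m₀) ≤ θ
      · rw [if_pos h]
        linarith [Finset.sum_nonneg hnn]
      · have hex : ∃ m, θ < f (c m) (ys.take m₀) := ⟨m, not_le.1 h⟩
        have hspec : θ < f (c (d ys)) (ys.take m₀) := by
          simp only [d, dif_pos hex]
          exact hex.choose_spec
        have := Finset.single_le_sum hnn (Finset.mem_univ (d ys))
        rw [if_pos hd, if_pos hspec] at this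
        rw [if_neg h]
        linarith
  have hm : ∀ m, ∑ s, (ch.init s).toReal * ch.expect (m₀ + j) (σ (c m)) s
      (fun ys _ => if d ys ≠ m then 1 else 0) ≤
      α (c m) + ∑ m', if m' ≠ m then β (c m) (c m') else 0 := by
    intro m
    calc ∑ s, (ch.init s).toReal * ch.expect (m₀ + j) (σ (c m)) s
          (fun ys _ => if d ys ≠ m then 1 else 0) ≤
          ∑ s, (ch.init s).toReal * (ch.expect (m₀ + j) (σ (c m)) s
            (fun ys _ => if f (c m) (ys.take m₀) ≤ θ then 1 else 0) +
            ∑ m', (if m' ≠ m then 1 else 0) * ch.expect (m₀ + j) (σ (c m)) s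
              (fun ys _ => if θ < f (c m') (ys.take m₀) then 1 else 0)) := by
          refine Finset.sum_le_sum fun s _ => mul_le_mul_of_nonneg_left ?_ ENNReal.toReal_nonneg
          refine (expect_mono ch _ _ _ fun ys _ _ => herr m ys).trans_eq ?_
          rw [expect_add, expect_sum]
          simp_rw [expect_const_mul]
      _ = _ := by
          simp_rw [mul_add, Finset.sum_add_distrib]
          congr 1
          simp_rw [Finset.mul_sum]
          rw [Finset.sum_comm]
          refine Finset.sum_congr rfl fun m' _ => ?_
          split_ifs <;> simp [β]
  calc (1 / k : ℝ) * ∑ m, ∑ s, (ch.init s).toReal * ch.expect (m₀ + j) (σ (c m)) s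
        (fun ys _ => if d ys ≠ m then 1 else 0) ≤
        (1 / k : ℝ) * (k * ∑ a, v a * α a + k * (k - 1) * ∑ a, ∑ b, v a * (v b * β a b)) :=
        mul_le_mul_of_nonneg_left ((Finset.sum_le_sum fun m _ => hm m).trans hc) (by positivity)
    _ = ∑ a, v a * α a + (k - 1) * ∑ a, ∑ b, v a * (v b * β a b) := by
        field_simp
    _ ≤ θ ^ l * M + (k - 1) * (1 / θ) := by
        have : (0 : ℝ) ≤ k - 1 := sub_nonneg.2 (by exact_mod_cast hk)
        exact add_le_add hα (mul_le_mul_of_nonneg_left hβ this)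
    _ ≤ θ ^ l * M + k / θ := by
        have : 0 < 1 / θ := by positivity
        have e : (k : ℝ) / θ = k * (1 / θ) := by ring
        rw [e]
        linarith

/-- A rate is achievable if it is smaller than the mean logarithmic score per channel use, for a
random strategy of length `L` and a score that is bounded, bounded away from zero, and of mean at
most one for independent outputs. -/
theorem achievable_of_lt_score [Finite X] (ch : Channel X Y S) {T : Type*} [Fintype T] (w : T → ℝ)
    (hw : ∀ a, 0 ≤ w a) (hw1 : ∑ a, w a = 1) (L : ℕ) (hL : 0 < L) (σ : T → Strategy X Y S)
    (g : T → List Y → ℝ) (hg : ∀ a ys, 1 / 2 ≤ g a ys) (hg1 : ∀ ys, ∑ a, w a * g a ys ≤ 1)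
    (C : ℝ) (hC : ∀ a ys, g a ys ≤ C) (R μ : ℝ) (hR : 0 ≤ R) (hRμ : L * R < μ)
    (hμ : ∀ s, μ ≤ ∑ a, w a * ch.expect L (σ a) s fun ys _ => Real.logb 2 (g a ys)) :
    ch.Achievable R := by
  obtain ⟨r, hr1, hr2⟩ := exists_between hRμ
  obtain ⟨l, hl, ρ, hρ, hlρ, hmom⟩ := exists_exponent ch w hw hw1 L σ g hg C hC r μ hr2 hμ
  have hgpos : ∀ a ys, 0 < g a ys := fun a ys => by have := hg a ys; linarith
  have hk : ∀ n : ℕ, 0 < ⌈(2 : ℝ) ^ ((n : ℝ) * R)⌉₊ := fun n =>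
    Nat.ceil_pos.2 (Real.rpow_pos_of_pos (by norm_num) _)
  -- `n / L` blocks and the threshold `2 ^ (r (n / L + 1))`, for a rate `r` per block between `L R`
  -- and `μ`
  have hcode : ∀ n : ℕ, ∃ c : Code X Y S n ⌈(2 : ℝ) ^ ((n : ℝ) * R)⌉₊,
      (c.errorProb ch).toReal ≤ (2 : ℝ) ^ (l * r) * ((2 : ℝ) ^ (l * r) * ρ) ^ (n / L) +
        2 * ((2 : ℝ) ^ (L * R - r)) ^ (n / L + 1) := by
    intro n
    set B := n / L with hB
    obtain ⟨A, _, v, τ, f, hv, hv1, hf, hf1, hmomB⟩ :=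
      exists_block_ensemble ch w hw hw1 L σ g hgpos hg1 l ρ hρ hmom B
    have hn : n = B * L + n % L := by rw [hB, mul_comm]; exact (Nat.div_add_mod n L).symm
    have hnle : (n : ℝ) ≤ L * (B + 1) := by
      have : n < L * (B + 1) := by
        have := Nat.lt_mul_div_succ n hL
        exact this
      exact_mod_cast this.le
    have hθ : (0 : ℝ) < (2 : ℝ) ^ (r * (B + 1)) := Real.rpow_pos_of_pos (by norm_num) _
    obtain ⟨c, hc⟩ := exists_code_errorProb_le ch v hv hv1 τ f hf hf1 l (ρ ^ B) hl (B * L) (n % L)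
      hmomB (hk n) hθ
    have hfinal : ((2 : ℝ) ^ (r * (B + 1))) ^ l * ρ ^ B +
        (⌈(2 : ℝ) ^ ((n : ℝ) * R)⌉₊ : ℝ) / (2 : ℝ) ^ (r * (B + 1)) ≤
        (2 : ℝ) ^ (l * r) * ((2 : ℝ) ^ (l * r) * ρ) ^ B +
          2 * ((2 : ℝ) ^ (L * R - r)) ^ (B + 1) := by
      have e1 : ((2 : ℝ) ^ (r * (B + 1))) ^ l = (2 : ℝ) ^ (l * r) * ((2 : ℝ) ^ (l * r)) ^ B := by
        rw [← Real.rpow_mul (by norm_num), ← Real.rpow_mul_natCast (by norm_num),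
          ← Real.rpow_add (by norm_num)]
        congr 1
        ring
      rw [e1, mul_pow, mul_assoc]
      refine add_le_add le_rfl ?_
      have h1 : (1 : ℝ) ≤ (2 : ℝ) ^ ((n : ℝ) * R) :=
        Real.one_le_rpow (by norm_num) (mul_nonneg (Nat.cast_nonneg n) hR)
      have h2 : (⌈(2 : ℝ) ^ ((n : ℝ) * R)⌉₊ : ℝ) ≤ 2 * (2 : ℝ) ^ ((n : ℝ) * R) := by
        have := Nat.ceil_lt_add_one (a := (2 : ℝ) ^ ((n : ℝ) * R)) (by linarith)
        linarith
      rw [div_le_iff₀ hθ]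
      refine h2.trans ?_
      rw [mul_assoc]
      refine mul_le_mul_of_nonneg_left ?_ (by norm_num)
      rw [← Real.rpow_mul_natCast (by norm_num), ← Real.rpow_add (by norm_num)]
      refine Real.rpow_le_rpow_of_exponent_le (by norm_num) ?_
      push_cast
      nlinarith [mul_le_mul_of_nonneg_right hnle hR]
    -- a code of length `B L + n mod L` is a code of length `n`
    have key : ∀ n', n = n' → (∃ c : Code X Y S n' ⌈(2 : ℝ) ^ ((n : ℝ) * R)⌉₊,
        (c.errorProb ch).toReal ≤ (2 : ℝ) ^ (l * r) * ((2 : ℝ) ^ (l * r) * ρ) ^ B +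
          2 * ((2 : ℝ) ^ (L * R - r)) ^ (B + 1)) →
        ∃ c : Code X Y S n ⌈(2 : ℝ) ^ ((n : ℝ) * R)⌉₊,
        (c.errorProb ch).toReal ≤ (2 : ℝ) ^ (l * r) * ((2 : ℝ) ^ (l * r) * ρ) ^ B +
          2 * ((2 : ℝ) ^ (L * R - r)) ^ (B + 1) := by
      rintro n' rfl h
      exact h
    exact key _ hn ⟨c, hc.trans hfinal⟩
  choose c hc using hcode
  refine ⟨c, ?_⟩
  rw [← ENNReal.tendsto_toReal_iff (fun n => errorProb_ne_top ch (hk n) (c n)) ENNReal.zero_ne_top,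
    ENNReal.toReal_zero]
  have hdiv : Tendsto (fun n : ℕ => n / L) atTop atTop := Nat.tendsto_div_const_atTop hL.ne'
  have hq1 := tendsto_pow_atTop_nhds_zero_of_lt_one (r := (2 : ℝ) ^ (l * r) * ρ)
    (by positivity) hlρ
  have hq2 := tendsto_pow_atTop_nhds_zero_of_lt_one (r := (2 : ℝ) ^ (L * R - r))
    (by positivity) (Real.rpow_lt_one_of_one_lt_of_neg (by norm_num) (by linarith))
  have hlim := ((hq1.const_mul ((2 : ℝ) ^ (l * r))).add
    (((tendsto_add_atTop_iff_nat 1).2 hq2).const_mul 2)).comp hdiv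
  simp only [mul_zero, add_zero] at hlim
  exact squeeze_zero (fun n => ENNReal.toReal_nonneg) hc hlim

end RandomCoding

/-! ### The capacity -/

section Capacity

variable {X Y S : Type*}

/-- At rate zero there is a single message. -/
theorem achievable_zero [Nonempty X] (ch : Channel X Y S) : ch.Achievable 0 := by
  have hk : ∀ n : ℕ, ⌈(2 : ℝ) ^ ((n : ℝ) * 0)⌉₊ = 1 := fun n => by simp
  refine ⟨fun n => ⟨fun _ _ _ _ => Classical.arbitrary X, fun _ => ⟨0, by rw [hk]; norm_num⟩⟩, ?_⟩
  refine tendsto_const_nhds.congr fun n => ?_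
  unfold Code.errorProb
  have hsub : Subsingleton (Fin ⌈(2 : ℝ) ^ ((n : ℝ) * 0)⌉₊) := by
    rw [hk]
    infer_instance
  symm
  refine mul_eq_zero_of_right _ (Finset.sum_eq_zero fun m _ => ENNReal.tsum_eq_zero.2 fun ω => ?_)
  exact if_neg fun h => h (Subsingleton.elim _ _)

variable [Fintype Y] [Fintype S]

theorem treeInfo_le (ch : Channel X Y S) {N : ℕ} [Fintype (Tree (S → X) Y N)]
    {w : Tree (S → X) Y N → ℝ} (hw : w ∈ stdSimplex ℝ (Tree (S → X) Y N)) :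
    treeInfo ch w ≤ N * Real.logb 2 (Fintype.card Y) := by
  refine (mutInfo_le hw.1 hw.2 (fun _ _ => ENNReal.toReal_nonneg) fun t => ?_).trans_eq ?_
  · rw [← ENNReal.toReal_sum, sum_treeLaw, ENNReal.toReal_one]
    intro y _
    refine ne_top_of_le_ne_top ENNReal.one_ne_top ?_
    rw [← sum_treeLaw ch t]
    exact Finset.single_le_sum (fun _ _ => zero_le) (Finset.mem_univ y)
  · rw [Fintype.card_fun, Fintype.card_fin, Nat.cast_pow, Real.logb_pow]

/-- Some deterministic initial state is at least as good as the random one, since mutual information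
is convex in the channel. -/
theorem exists_treeInfo_le_startAt (ch : Channel X Y S) {N : ℕ} [Fintype (Tree (S → X) Y N)]
    {w : Tree (S → X) Y N → ℝ} (hw : w ∈ stdSimplex ℝ (Tree (S → X) Y N)) :
    ∃ s, treeInfo ch w ≤ treeInfo (ch.startAt s) w := by
  have h : treeInfo ch w ≤ ∑ s, (ch.init s).toReal * treeInfo (ch.startAt s) w := by
    have := mutInfo_le_average hw.1 (fun s => (ch.init s).toReal) (fun _ => ENNReal.toReal_nonneg)
      (fun s t y => ((ch.startAt s).treeLaw (N := N) t y).toReal)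
      (fun _ _ _ => ENNReal.toReal_nonneg)
    refine le_trans (le_of_eq ?_) this
    unfold treeInfo
    congr 1
    funext t y
    exact treeLaw_toReal_eq_sum ch t y
  by_contra hcon
  push Not at hcon
  obtain ⟨s₀, hs₀⟩ := ch.init.support_nonempty
  have hpos : 0 < (ch.init s₀).toReal :=
    ENNReal.toReal_pos hs₀ (ch.init.apply_ne_top _)
  have h1 : ∑ s, (ch.init s).toReal * treeInfo (ch.startAt s) w <
      ∑ s, (ch.init s).toReal * treeInfo ch w :=
    Finset.sum_lt_sum (fun s _ => mul_le_mul_of_nonneg_left (hcon s).le ENNReal.toReal_nonneg)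
      ⟨s₀, Finset.mem_univ _, mul_lt_mul_of_pos_left (hcon s₀) hpos⟩
  rw [← Finset.sum_mul, sum_init_toReal, one_mul] at h1
  exact absurd h (not_le.2 h1)

variable [Fintype X] [Nonempty X]

/-- Block coding: each block of length `N + D` drives the state to a fixed state `s₁` and then uses
a random decision tree of depth `N`. The state `s₁` is chosen after `D`, which is uniform in it. -/
theorem achievable_of_lt_treeInfo (ch : Channel X Y S) {N D : ℕ} (hN : 0 < N)
    [Fintype (Tree (S → X) Y N)] {w : Tree (S → X) Y N → ℝ}
    (hw : w ∈ stdSimplex ℝ (Tree (S → X) Y N)) {ε : ℝ} (hε : ε ≤ 1)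
    (hD : ∀ s₁ s, ch.missProb s₁ D s ≤ ε) {R : ℝ} (hR : 0 ≤ R)
    (h : (N + D) * R < (1 - ε) * treeInfo ch w - Real.logb 2 (2 * (D + 1)) - 1) :
    ch.Achievable R := by
  obtain ⟨s₁, hs₁⟩ := exists_treeInfo_le_startAt ch hw
  obtain ⟨B, hB⟩ := exists_score_le ch s₁ w D
  refine achievable_of_lt_score ch w hw.1 hw.2 (N + D) (by omega)
    (fun t => ch.drive s₁ (treeStrategy t) D) (fun t => ch.score s₁ w D t)
    (half_le_score ch s₁ hw.1 D) (sum_score_le ch s₁ hw.2 D) B hB R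
    ((1 - ε) * treeInfo (ch.startAt s₁) w - Real.logb 2 (2 * (D + 1)) - 1) hR ?_
    (le_expect_log_score ch s₁ hw.1 hw.2 D (hD s₁))
  push_cast
  have := mul_le_mul_of_nonneg_left hs₁ (sub_nonneg.2 hε)
  linarith

/-- The converse bound for a sequence of codes: the maximal mutual information per channel use is
eventually not much smaller than an achievable rate. -/
theorem tendsto_of_achievable (ch : Channel X Y S) [∀ N, Fintype (Tree (S → X) Y N)] {R : ℝ}
    (h : ch.Achievable R) (M : ℕ → ℝ)
    (hM : ∀ N, ∀ w ∈ stdSimplex ℝ (Tree (S → X) Y N), treeInfo ch w ≤ M N) :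
    ∃ u : ℕ → ℝ, Tendsto u atTop (𝓝 R) ∧ ∀ᶠ n : ℕ in atTop, u n ≤ 1 / (n : ℝ) * M n := by
  obtain ⟨c, hc⟩ := h
  have hk : ∀ n : ℕ, 0 < ⌈(2 : ℝ) ^ ((n : ℝ) * R)⌉₊ := fun n =>
    Nat.ceil_pos.2 (Real.rpow_pos_of_pos (by norm_num) _)
  have he : Tendsto (fun n => ((c n).errorProb ch).toReal) atTop (𝓝 0) := by
    have := (ENNReal.tendsto_toReal_iff (fun n => errorProb_ne_top ch (hk n) (c n))
      ENNReal.zero_ne_top).2 hc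
    rwa [ENNReal.toReal_zero] at this
  refine ⟨fun n => (1 - ((c n).errorProb ch).toReal) * R - 1 / (n : ℝ), ?_, ?_⟩
  · have h1 := ((tendsto_const_nhds (x := (1 : ℝ))).sub he).mul_const R
    have h2 := h1.sub (tendsto_one_div_atTop_nhds_zero_nat (𝕜 := ℝ))
    simpa using h2
  · filter_upwards [he.eventually (gt_mem_nhds zero_lt_one), eventually_gt_atTop 0] with n hn hn0
    obtain ⟨w, hw, hfano⟩ := fano_le_treeInfo ch (hk n) (c n)
    have hn0' : (0 : ℝ) < n := by exact_mod_cast hn0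
    have hlog : n * R ≤ Real.logb 2 ⌈(2 : ℝ) ^ ((n : ℝ) * R)⌉₊ := by
      rw [Real.le_logb_iff_rpow_le (by norm_num) (by exact_mod_cast hk n)]
      exact Nat.le_ceil _
    have h1 := mul_le_mul_of_nonneg_left hlog (sub_nonneg.2 hn.le)
    have h2 := hM n w hw
    rw [one_div, ← div_eq_inv_mul, le_div_iff₀ hn0', sub_mul, inv_mul_cancel₀ hn0'.ne']
    linarith

end Capacity

end FiniteState

end

theorem theorem2 {X Y S : Type*} [Finite X] [Finite Y] [Finite S]
    (ch : FiniteState.Channel X Y S) (hconn : ch.StronglyConnected) :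
    IsLUB {R : ℝ | ch.Achievable R} ch.feedbackCapacity ∧
      ∃ M : ℕ → ℝ,
        (∀ N : ℕ, IsGreatest (FiniteState.objectiveValues ch N) (M N)) ∧
          Tendsto (fun N : ℕ => 1 / (N : ℝ) * M N) atTop (𝓝 ch.feedbackCapacity) := by
  classical
  have := Fintype.ofFinite X
  have := Fintype.ofFinite Y
  have := Fintype.ofFinite S
  have hX : Nonempty X := by
    obtain ⟨s, -⟩ := ch.init.support_nonempty
    obtain ⟨T, P, -⟩ := hconn s
    obtain ⟨x, -⟩ := (P 0 s).support_nonempty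
    exact ⟨x⟩
  choose w hw hgreat hmax using fun N => FiniteState.exists_isGreatest_objectiveValues ch N
  set M : ℕ → ℝ := fun N => FiniteState.treeInfo ch (w N) with hM
  have hconv := fun {R : ℝ} (hR : ch.Achievable R) =>
    FiniteState.tendsto_of_achievable ch hR M hmax
  have hbdd : BddAbove {R : ℝ | ch.Achievable R} := by
    refine ⟨Real.logb 2 (Fintype.card Y), fun R hR => ?_⟩
    obtain ⟨u, hu, hle⟩ := hconv hR
    refine le_of_tendsto hu ?_
    filter_upwards [hle, eventually_gt_atTop 0] with n hn hn0
    have hn0' : (0 : ℝ) < n := by exact_mod_cast hn0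
    refine hn.trans ?_
    rw [one_div, ← div_eq_inv_mul, div_le_iff₀ hn0', mul_comm]
    exact FiniteState.treeInfo_le ch (hw n)
  have hzero := FiniteState.achievable_zero ch
  have hlub : IsLUB {R : ℝ | ch.Achievable R} ch.feedbackCapacity := isLUB_csSup ⟨0, hzero⟩ hbdd
  refine ⟨hlub, M, hgreat, tendsto_order.2 ⟨fun a ha => ?_, fun b hb => ?_⟩⟩
  · obtain ⟨R, hR, haR⟩ := (lt_isLUB_iff hlub).1 ha
    obtain ⟨u, hu, hle⟩ := hconv hR
    filter_upwards [hu.eventually (lt_mem_nhds haR), hle] with n h1 h2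
    exact h1.trans_le h2
  · set C := ch.feedbackCapacity
    have hC : 0 ≤ C := hlub.1 hzero
    have hb0 : 0 < b := hC.trans_lt hb
    -- with this choice `(1 - ε) b` is the midpoint of `C` and `b`
    set ε : ℝ := (b - C) / (2 * b) with hε
    have hε0 : 0 < ε := div_pos (sub_pos.2 hb) (by positivity)
    have hεb : (1 - ε) * b = (b + C) / 2 := by
      rw [hε]
      field_simp
      ring
    have hε1 : ε < 1 := by
      rw [hε, div_lt_one (by positivity)]
      linarith
    obtain ⟨D, hD⟩ := FiniteState.exists_missProb_le ch hconn hε0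
    set K := Real.logb 2 (2 * (D + 1)) + 1 with hK
    -- otherwise some rate above `C` would be achievable
    have hup : ∀ N : ℕ, 0 < N → (1 - ε) * M N - K ≤ (N + D) * C := by
      intro N hN
      by_contra hcon
      push Not at hcon
      have hND : (0 : ℝ) < N + D := by
        have : (0 : ℝ) < N := by exact_mod_cast hN
        positivity
      obtain ⟨R, hR1, hR2⟩ := exists_between ((lt_div_iff₀' hND).2 hcon)
      have hach : ch.Achievable R := FiniteState.achievable_of_lt_treeInfo ch hN (hw N) hε1.le hD
        (hC.trans hR1.le) (by
          have := (lt_div_iff₀' hND).1 hR2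
          rw [hK] at this
          simp only [hM] at this
          linarith)
      exact absurd (hlub.1 hach) (not_le.2 hR1)
    have hlim : Tendsto (fun N : ℕ => C + (D * C + K) * (1 / (N : ℝ))) atTop (𝓝 C) := by
      have := (tendsto_one_div_atTop_nhds_zero_nat (𝕜 := ℝ)).const_mul (D * C + K)
      simpa using this.const_add C
    filter_upwards [hlim.eventually (gt_mem_nhds (show C < (b + C) / 2 by linarith)),
      eventually_gt_atTop 0] with N h1 hN
    have hN' : (0 : ℝ) < N := by exact_mod_cast hN
    have h2 := hup N hN
    have h3 : (1 - ε) * (1 / (N : ℝ) * M N) < (1 - ε) * b := by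
      rw [hεb]
      refine lt_of_le_of_lt ?_ h1
      have h4 := mul_le_mul_of_nonneg_left h2 (one_div_nonneg.2 hN'.le)
      have h5 : 1 / (N : ℝ) * ((N + D) * C) = C + D * C * (1 / (N : ℝ)) := by
        field_simp
      nlinarith
    exact lt_of_mul_lt_mul_left h3 (by linarith)
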